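/- Let $\mathbb T=\mathbb R/\mathbb Z$ and $T_1=\mathbb R^3/\Gamma_1=\mathbb T\times\mathbb R^2$ (the cell of the one-dimensional lattice $\Gamma_1=\mathbb Z$ in $\mathbb R^3$), with coordinates $x=(x_1,x_2,x_3)$ and Lebesgue measure. Let $\hbar,m,e>0$, and let $\sigma=\rho_1^{\rm per}:T_1\to\mathbb R$ be the periodized charge density of the single ion per cell, placed at $x_1^0=0$. For $f\in L^1(T_1)$ put $$\hat f(k,\xi)=\frac1{2\pi}\int_{T_1}e^{i(kx_1+\xi_1x_2+\xi_2x_3)}f(x)\,dx,\qquad k\in 2\pi\mathbb Z,\ \xi\in\mathbb R^2 .$$ Assume: * Condition I: $\sigma\in L^1(T_1)\cap L^2(T_1)$; * $Z_1:=\frac1e\int_{T_1}\sigma\,dx>0$; * Condition III: $\dfrac{\hat\sigma(0,\xi)-\hat\sigma(0,0)}{|\xi|}\in L^2(\{\xi\in\mathbb R^2:|\xi|\le1\})$, where $\hat\sigma(0,0)=eZ_1/(2\pi)$. Let $M_1$ be the set of complex $\psi\in H^1(T_1)$ with $\int_{T_1}|\psi|^2dx=Z_1$, and for $\psi\in M_1$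 let $$\mathcal E(\psi)=\int_{T_1}\Big[\frac{\hbar^2}{2m}|\nabla\psi|^2+\frac12|\Lambda\rho|^2\Big]dx\in[0,\infty],\qquad \rho=\sigma-e|\psi|^2,$$ where $\Lambda=(-\Delta)^{-1/2}$ is the Fourier multiplier $(k^2+\xi^2)^{-1/2}$, that is, $\int_{T_1}|\Lambda\rho|^2dx=\sum_{k\in2\pi\mathbb Z}\int_{\mathbb R^2}\frac{|\hat\rho(k,\xi)|^2}{k^2+\xi^2}\,d\xi$ (equal to $+\infty$ if this diverges). Then: i) There is $\psi^0\in M_1$ with $\mathcal E(\psi^0)=\inf_{\psi\in M_1}\mathcal E(\psi)<\infty$. ii) Moreover, $\psi^0\in H^2_{\rm loc}(T_1)$, and there are a real potential $\phi^0\in H^2_{\rm loc}(T_1)$ and $\omega^0\in\mathbb R$ such that, with derivatives in the sense of distributions, $$\hbar\omega^0\psi^0=-\frac{\hbar^2}{2m}\Delta\psi^0-e\phi^0\psi^0,\qquad -\Delta\phi^0=\sigma-e|\psi^0|^2\qquad\text{on }T_1,$$ $$0=-\int_{T_1}\nabla\phi^0(x)\,\sigma(x)\,dx,$$ the last integral being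 absolutely convergent. iii) There is a constant $C$ such that $|\phi^0(x)|\le C(1+|x_2|+|x_3|)^{1/2}$ for all $x\in T_1$. -/

import Mathlib

open MeasureTheory
open scoped ENNReal ContDiff

noncomputable section

namespace CrystalSlab

/-- The cell `T₁ = ℝ³ / Γ₁ = 𝕋¹ × ℝ²` for `Γ₁ = ℤ`, with coordinates `(x₁, x₂, x₃)`. Its `volume`
is the product of the Lebesgue measures (total mass one on the circle). -/
abbrev Slab : Type := UnitAddCircle × ℝ × ℝ

/-- The one-parameter translation `s ↦ s eᵢ` along the `i`-th coordinate axis. -/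
def axis (i : Fin 3) (s : ℝ) : Slab :=
  ![((s : UnitAddCircle), (0 : ℝ), (0 : ℝ)), (0, s, 0), (0, 0, s)] i

/-- The classical partial derivative `∂ᵢ η`. -/
def pderiv (i : Fin 3) (η : Slab → ℝ) (x : Slab) : ℝ :=
  deriv (fun s : ℝ => η (x + axis i s)) 0

/-- Real test functions, the space `C₀^∞(T₁)`; smoothness is that of the lift to `ℝ³`. -/
def IsTest (η : Slab → ℝ) : Prop :=
  ContDiff ℝ ∞ (fun p : ℝ × ℝ × ℝ => η ((p.1 : UnitAddCircle), p.2)) ∧ HasCompactSupport η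

section Weak

variable {E : Type*} [NormedAddCommGroup E] [NormedSpace ℝ E]

/-- `∂ᵢ f = g` in the sense of distributions on `T₁`, for locally integrable `f` and `g`. -/
def HasWeakDeriv (i : Fin 3) (f g : Slab → E) : Prop :=
  LocallyIntegrable f ∧ LocallyIntegrable g ∧
    ∀ η : Slab → ℝ, IsTest η → ∫ x, pderiv i η x • f x = -∫ x, η x • g x

open Classical in
/-- A representative of the distributional derivative `∂ᵢ f`, when it is a locally integrable
function; it is unique up to null sets. (The value is `0` otherwise.) -/
def weakDeriv (i : Fin 3) (f : Slab → E) : Slab → E :=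
  if h : ∃ g, HasWeakDeriv i f g then h.choose else 0

/-- The distributional Laplacian, for functions with weak derivatives of second order. -/
def weakLaplacian (f : Slab → E) (x : Slab) : E :=
  ∑ i : Fin 3, weakDeriv i (weakDeriv i f) x

/-- Membership in `L²_loc(T₁)`. -/
def InL2loc (f : Slab → E) : Prop :=
  ∀ K : Set Slab, IsCompact K → MemLp f 2 (volume.restrict K)

/-- Membership in the Sobolev space `H¹(T₁)`. -/
def InH1 (f : Slab → E) : Prop :=
  MemLp f 2 volume ∧
    ∀ i : Fin 3, (∃ g, HasWeakDeriv i f g) ∧ MemLp (weakDeriv i f) 2 volume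

/-- Membership in the Sobolev space `H²_loc(T₁)`. -/
def InH2loc (f : Slab → E) : Prop :=
  InL2loc f ∧
    ∀ i : Fin 3, (∃ g, HasWeakDeriv i f g) ∧ InL2loc (weakDeriv i f) ∧
      ∀ j : Fin 3, (∃ g, HasWeakDeriv j (weakDeriv i f) g) ∧
        InL2loc (weakDeriv j (weakDeriv i f))

end Weak

/-- The Fourier transform on `T₁` of an integrable real function, at `(k, ξ)` with `k = 2πn`:
`(2π)⁻¹ ∫ exp (i (k x₁ + ξ₁ x₂ + ξ₂ x₃)) f(x) dx`. Here `fourier n x₁ = exp (2πi n x₁)`. -/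
def fourierT (f : Slab → ℝ) (n : ℤ) (ξ : ℝ × ℝ) : ℂ :=
  (1 / (2 * Real.pi) : ℂ) *
    ∫ x : Slab, fourier n x.1 *
      Complex.exp (Complex.I * ((ξ.1 * x.2.1 + ξ.2 * x.2.2 : ℝ) : ℂ)) * (f x : ℂ)

/-- `‖Λ ρ‖²`, where `Λ = (-Δ)^{-1/2}` is the Fourier multiplier `(k² + ξ²)^{-1/2}`:
`∑ₖ ∫ |ρ̂(k, ξ)|² / (k² + ξ²) dξ`, which is `∞` when the quotient `ρ̂ / (k² + ξ²)^{1/2}` is not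
square integrable. -/
def coulombNormSq (ρ : Slab → ℝ) : ℝ≥0∞ :=
  ∑' n : ℤ, ∫⁻ ξ : ℝ × ℝ,
    ENNReal.ofReal (‖fourierT ρ n ξ‖ ^ 2 / ((2 * Real.pi * n) ^ 2 + (ξ.1 ^ 2 + ξ.2 ^ 2)))

/-- The total charge density `ρ = σ - e|ψ|²`. -/
def chargeDensity (e : ℝ) (σ : Slab → ℝ) (ψ : Slab → ℂ) (x : Slab) : ℝ :=
  σ x - e * ‖ψ x‖ ^ 2

/-- The energy per cell `∫ [ħ²/(2m) |∇ψ|² + ½ |Λρ|²] dx ∈ [0, ∞]`. -/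
def energy (ħ m e : ℝ) (σ : Slab → ℝ) (ψ : Slab → ℂ) : ℝ≥0∞ :=
  (∫⁻ x, ENNReal.ofReal (ħ ^ 2 / (2 * m) * ∑ i : Fin 3, ‖weakDeriv i ψ x‖ ^ 2)) +
    (1 / 2) * coulombNormSq (chargeDensity e σ ψ)

/-- The number `Z₁ = (∫ σ) / e`. -/
def chargeNumber (e : ℝ) (σ : Slab → ℝ) : ℝ := (∫ x, σ x) / e

/-- The set `M₁` of `ψ ∈ H¹(T₁)` with `∫ |ψ|² = Z₁`. -/
def neutralStates (e : ℝ) (σ : Slab → ℝ) : Set (Slab → ℂ) :=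
  {ψ | InH1 ψ ∧ ∫ x, ‖ψ x‖ ^ 2 = chargeNumber e σ}

/-- Condition I: `σ ∈ L¹(T₁) ∩ L²(T₁)`. -/
def ConditionI (σ : Slab → ℝ) : Prop :=
  MemLp σ 1 volume ∧ MemLp σ 2 volume

/-- Condition III: `(σ̂(0, ξ) - σ̂(0, 0)) / |ξ| ∈ L²(D)`, where `D` is the closed Euclidean unit disc
and `σ̂(0, 0) = e Z₁ / (2π)` for the Fourier transform above. -/
def ConditionIII (e : ℝ) (σ : Slab → ℝ) : Prop :=
  MemLp (fun ξ : ℝ × ℝ =>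
      (fourierT σ 0 ξ - ((e * chargeNumber e σ / (2 * Real.pi) : ℝ) : ℂ)) /
        ((Real.sqrt (ξ.1 ^ 2 + ξ.2 ^ 2) : ℝ) : ℂ))
    2 (volume.restrict {ξ : ℝ × ℝ | ξ.1 ^ 2 + ξ.2 ^ 2 ≤ 1})

end CrystalSlab

end

noncomputable section

namespace CrystalSlab

open scoped FourierTransform ComplexConjugate Topology

/-! The whole argument runs on the Fourier side. Parseval on the circle and Plancherel on the plane
combine to a unitary transform `ftL2` of the slab. With `bracket k = (1 + |k|²)^{1/2}`, a state is
in H¹ exactly when `bracket · ψ̂` is in L², and the Coulomb energy is the squared L² norm of `lam ρ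
= ρ̂ / |k|`. As the mass is prescribed, the energy is, up to an additive constant, a weighted sum of
two squared Hilbert norms.

Existence. Condition III makes a smooth, compactly supported state of the right mass a competitor of
finite energy (`isCharge_sub_test`). Along a minimizing sequence both Hilbert vectors converge
weakly after passing to a subsequence. A local compactness statement
(`tendsto_integral_mul_norm_sq`) carries |ψ|² to the limit against test functions, so the two weak
limits come from one and the same state (`isCharge_of_weak_limit`), and convexity gives lower
semicontinuity. Mass could still escape to infinity in the unbounded directions. It does not: the
limit has finite Coulomb energy, and since |ξ|⁻² is not integrable at the origin of the plane, its
continuous transform must vanish there. Finite energy thus forces neutrality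
(`IsCharge.integral_eq_zero`), which is the mass constraint. The embedding H¹ ⊂ L⁴ (`memLp_four`)
keeps the densities in L².

Potential. The quotient ρ̂ / |k|² need not be integrable at small k, so the inverse transform is
renormalized by subtracting the value of the character at x = 0 on the unit disc. There |e^{iθ} - 1|
is bounded both by 2 and by a multiple of |ξ| (1 + |x₂| + |x₃|); the geometric mean of the two
leaves |ξ|^{-1/2} times the L² function `lam ρ`, and |ξ|^{-1/2} is square integrable on a planar
disc. This yields the square-root growth. Derivatives of the potential are honest L² functions with
multipliers `fieldMult`.

Euler–Lagrange equation. The state ψ + tχ is renormalized to the correct mass; multiplying the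
energy difference by the square of the normalizing polynomial gives a polynomial in t with a local
minimum at 0 (`first_variation`). The resulting weak Schrödinger equation has a potential that
grows, so ψ is first multiplied by a decaying smooth weight, which places all terms in L²; there the
Laplacian controls every second derivative (`inH2loc_of_weak_schrodinger`).

Ion equation. Translating ψ leaves the kinetic energy unchanged, so the Coulomb energy is stationary
under translations and the force on |ψ|² vanishes. The total self-force of ρ vanishes by
antisymmetry. The difference is the force on σ (`integral_field_mul_ion`). -/

/-! ### Square integrability expressed through lower integrals. -/

theorem eLpNorm_two_sq {α E : Type*} [MeasurableSpace α] [NormedAddCommGroup E]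
    (μ : Measure α) (f : α → E) :
    eLpNorm f 2 μ ^ 2 = ∫⁻ x, ‖f x‖ₑ ^ 2 ∂μ := by
  have := eLpNorm_nnreal_pow_eq_lintegral (f := f) (μ := μ) (p := 2) two_ne_zero
  simpa using this

theorem lintegral_enorm_sq_lt_top {α E : Type*} [MeasurableSpace α] [NormedAddCommGroup E]
    {μ : Measure α} {f : α → E} (h : MemLp f 2 μ) : ∫⁻ x, ‖f x‖ₑ ^ 2 ∂μ < ⊤ := by
  rw [← eLpNorm_two_sq]; exact ENNReal.pow_lt_top h.2

theorem memLp_two_of_lintegral {α E : Type*} [MeasurableSpace α] [NormedAddCommGroup E]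
    {μ : Measure α} {f : α → E} (hm : AEStronglyMeasurable f μ) (h : ∫⁻ x, ‖f x‖ₑ ^ 2 ∂μ ≠ ⊤) : MemLp f 2 μ := by
  refine ⟨hm, ?_⟩
  rw [← eLpNorm_two_sq] at h
  by_contra hc
  exact h (by rw [not_lt_top_iff.1 hc]; rfl)

/-! ### The Fourier transform on `ℝ²` -/

section Euclidean

variable {V : Type*} [NormedAddCommGroup V] [InnerProductSpace ℝ V] [FiniteDimensional ℝ V]
  [MeasurableSpace V] [BorelSpace V]

/-- Plancherel's theorem for the Fourier integral of a function in `L¹ ∩ L²`. -/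
theorem fourier_toLp_ae_eq {u : V → ℂ} (h1 : Integrable u) (h2 : MemLp u 2) :
    (𝓕 (h2.toLp u) : Lp ℂ 2 (volume : Measure V)) =ᵐ[volume] 𝓕 u := by
  have hcont : Continuous (𝓕 u) :=
    VectorFourier.fourierIntegral_continuous Real.continuous_fourierChar
      (innerSL ℝ).continuous₂ h1
  refine ae_eq_of_integral_contDiff_smul_eq
    ((Lp.memLp _).locallyIntegrable (by norm_num)) hcont.locallyIntegrable fun g hg hgc => ?_
  let gs : SchwartzMap V ℂ := HasCompactSupport.toSchwartzMap (f := fun x => (g x : ℂ))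
    (hgc.comp_left (g := fun x : ℝ => (x : ℂ)) (by simp))
    (Complex.ofRealCLM.contDiff.comp hg)
  have hgs : ∀ x, gs x = (g x : ℂ) := fun x => rfl
  -- The L² transform agrees with the transform of tempered distributions. Testing against a smooth
  -- compactly supported `g` and moving the transform back onto `u` identifies it with the Fourier
  -- integral.
  have key := congrArg (fun T : TemperedDistribution V ℂ => T gs)
    (Lp.fourier_toTemperedDistribution_eq (h2.toLp u))
  simp only [TemperedDistribution.fourier_apply, Lp.toTemperedDistribution_apply] at key
  have e1 : ∫ x, g x • (𝓕 (h2.toLp u) : Lp ℂ 2 (volume : Measure V)) x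
      = ∫ x, gs x • (𝓕 (h2.toLp u) : Lp ℂ 2 (volume : Measure V)) x := by
    refine integral_congr_ae (Filter.Eventually.of_forall fun x => ?_)
    simp [hgs]
  rw [e1, ← key]
  have e2 : ∫ x, (𝓕 gs : SchwartzMap V ℂ) x • (h2.toLp u : Lp ℂ 2 (volume : Measure V)) x
      = ∫ x, (𝓕 (gs : V → ℂ)) x • u x := by
    refine integral_congr_ae ?_
    filter_upwards [h2.coeFn_toLp] with x hx
    rw [hx, SchwartzMap.fourier_coe]
  rw [e2]
  have := VectorFourier.integral_fourierIntegral_smul_eq_flip (L := innerₗ V) (μ := volume)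
    (ν := volume) (f := (gs : V → ℂ)) (g := u) Real.continuous_fourierChar
      (innerSL ℝ).continuous₂ gs.integrable h1
  rw [flip_innerₗ] at this
  refine this.trans (integral_congr_ae (Filter.Eventually.of_forall fun x => ?_))
  simp [hgs]
  left; rfl

theorem eLpNorm_fourier {u : V → ℂ} (h1 : Integrable u) (h2 : MemLp u 2) :
    eLpNorm (𝓕 u) 2 (volume : Measure V) = eLpNorm u 2 volume := by
  rw [← eLpNorm_congr_ae (fourier_toLp_ae_eq h1 h2), ← eLpNorm_congr_ae h2.coeFn_toLp]
  have := Lp.norm_fourier_eq (h2.toLp u)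
  simp only [Lp.norm_def] at this
  rwa [ENNReal.toReal_eq_toReal_iff' (Lp.eLpNorm_ne_top _) (Lp.eLpNorm_ne_top _)] at this

end Euclidean

/-- The unitary Fourier transform on `ℝ²`, with the positive sign in the exponent. -/
def planeFT (u : ℝ × ℝ → ℂ) (ξ : ℝ × ℝ) : ℂ :=
  (1 / (2 * Real.pi) : ℂ) *
    ∫ y : ℝ × ℝ, Complex.exp (Complex.I * ((ξ.1 * y.1 + ξ.2 * y.2 : ℝ) : ℂ)) * u y

theorem measurePreserving_ofLp :
    MeasurePreserving (WithLp.ofLp : WithLp 2 (ℝ × ℝ) → ℝ × ℝ) :=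
  WithLp.volume_preserving_ofLp _ _

theorem measurableEmbedding_ofLp :
    MeasurableEmbedding (WithLp.ofLp : WithLp 2 (ℝ × ℝ) → ℝ × ℝ) :=
  (MeasurableEquiv.toLp 2 (ℝ × ℝ)).symm.measurableEmbedding

/-- The kernel of `𝓕` is exp(-2πi⟨·,·⟩), so evaluating at -ξ/(2π) converts to the kernel exp(i ξ·y).
-/
theorem planeFT_eq (u : ℝ × ℝ → ℂ) (ξ : ℝ × ℝ) :
    planeFT u ξ = (1 / (2 * Real.pi) : ℂ) *
      𝓕 (fun w : WithLp 2 (ℝ × ℝ) => u w.ofLp) (WithLp.toLp 2 ((-(2 * Real.pi)⁻¹ : ℝ) • ξ)) := by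
  rw [planeFT, Real.fourier_eq']
  congr 1
  rw [← measurePreserving_ofLp.integral_comp measurableEmbedding_ofLp]
  refine integral_congr_ae (Filter.Eventually.of_forall fun w => ?_)
  simp only [WithLp.prod_inner_apply, smul_eq_mul]
  congr 2
  simp
  field_simp
  ring

/-- The substitution ξ ↦ -ξ/(2π) has Jacobian (2π)² in dimension two, which exactly cancels the
square of the prefactor 1/(2π). -/
theorem lintegral_planeFT {u : ℝ × ℝ → ℂ} (h1 : Integrable u) (h2 : MemLp u 2) :
    ∫⁻ ξ, ‖planeFT u ξ‖ₑ ^ 2 = ∫⁻ y, ‖u y‖ₑ ^ 2 := by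
  set v : WithLp 2 (ℝ × ℝ) → ℂ := fun w => u w.ofLp with hv
  have hv1 : Integrable v := (measurePreserving_ofLp.integrable_comp_emb
    measurableEmbedding_ofLp).2 h1
  have hv2 : MemLp v 2 := h2.comp_measurePreserving measurePreserving_ofLp
  have key := congrArg (fun t => t ^ 2) (eLpNorm_fourier hv1 hv2)
  beta_reduce at key
  rw [eLpNorm_two_sq, eLpNorm_two_sq] at key
  have hr : (∫⁻ w : WithLp 2 (ℝ × ℝ), ‖v w‖ₑ ^ 2) = ∫⁻ y, ‖u y‖ₑ ^ 2 :=
    measurePreserving_ofLp.lintegral_comp_emb measurableEmbedding_ofLp (fun y => ‖u y‖ₑ ^ 2)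
  rw [← hr, ← key]
  set F : ℝ × ℝ → ℝ≥0∞ := fun ξ => ‖𝓕 v (WithLp.toLp 2 ξ)‖ₑ ^ 2 with hF
  have hcont : Continuous (𝓕 v) :=
    VectorFourier.fourierIntegral_continuous Real.continuous_fourierChar
      (innerSL ℝ).continuous₂ hv1
  have hFm : Measurable F := by
    have : Continuous fun ξ : ℝ × ℝ => 𝓕 v (WithLp.toLp 2 ξ) :=
      hcont.comp (WithLp.prod_continuous_toLp 2 ℝ ℝ)
    exact (this.measurable.enorm).pow_const 2
  have e1 : ∫⁻ w, ‖𝓕 v w‖ₑ ^ 2 = ∫⁻ ξ, F ξ :=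
    measurePreserving_ofLp.lintegral_comp_emb measurableEmbedding_ofLp F
  have hpi : (0 : ℝ) < 2 * Real.pi := by positivity
  have e2 : ∀ ξ, ‖planeFT u ξ‖ₑ ^ 2
      = ENNReal.ofReal ((2 * Real.pi)⁻¹ ^ 2) * F ((-(2 * Real.pi)⁻¹ : ℝ) • ξ) := by
    intro ξ
    rw [planeFT_eq, enorm_mul, mul_pow, hF]
    congr 1
    rw [← ofReal_norm, ← ENNReal.ofReal_pow (norm_nonneg _)]
    congr 2
    simp [abs_of_pos Real.pi_pos]
  rw [e1]
  simp_rw [e2]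
  have hms : Measurable fun ξ : ℝ × ℝ => (-(2 * Real.pi)⁻¹ : ℝ) • ξ := measurable_const_smul _
  have hFc : Measurable fun ξ : ℝ × ℝ => F ((-(2 * Real.pi)⁻¹ : ℝ) • ξ) := hFm.comp hms
  rw [lintegral_const_mul _ hFc]
  have hne : (-(2 * Real.pi)⁻¹ : ℝ) ≠ 0 := neg_ne_zero.2 (inv_ne_zero hpi.ne')
  have := Measure.map_addHaar_smul (volume : Measure (ℝ × ℝ)) hne
  rw [← lintegral_map hFm hms, this, lintegral_smul_measure]
  rw [smul_eq_mul, ← mul_assoc, ← ENNReal.ofReal_mul (by positivity)]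
  have : ((2 * Real.pi)⁻¹ ^ 2 * |((-(2 * Real.pi)⁻¹ : ℝ) ^ Module.finrank ℝ (ℝ × ℝ))⁻¹|) = 1 := by
    simp only [Module.finrank_prod, Module.finrank_self, Nat.reduceAdd, neg_sq]
    rw [abs_of_nonneg (by positivity), mul_inv_cancel₀ (by positivity)]
  rw [this]; simp

/-- A square integrable function on `ℝ²` that annihilates all Fourier transforms vanishes. -/
theorem ae_eq_zero_of_integral_planeFT_mul {g : ℝ × ℝ → ℂ} (hg : MemLp g 2)
    (h : ∀ u : ℝ × ℝ → ℂ, Integrable u → MemLp u 2 → ∫ ξ, planeFT u ξ * g ξ = 0) :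
    g =ᵐ[volume] 0 := by
  refine ae_eq_zero_of_integral_contDiff_smul_eq_zero (hg.locallyIntegrable (by norm_num))
    fun s hs hsc => ?_
  have hpi : (0 : ℝ) < 2 * Real.pi := by positivity
  -- The rescaling by -2π and the factor 2π undo the normalization of `planeFT`, so that `planeFT`
  -- of the inverse transform of `t` is the given test function `s`.
  set t : WithLp 2 (ℝ × ℝ) → ℂ := fun w => (2 * Real.pi : ℂ) * (s ((-(2 * Real.pi)) • w.ofLp) : ℂ)
    with ht
  have hts : ContDiff ℝ ∞ t := by
    refine contDiff_const.mul (Complex.ofRealCLM.contDiff.comp (hs.comp ?_))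
    exact ((WithLp.prodContinuousLinearEquiv 2 ℝ ℝ ℝ).contDiff).const_smul _
  have htc : HasCompactSupport t := by
    have h1 : HasCompactSupport fun w : WithLp 2 (ℝ × ℝ) => s ((-(2 * Real.pi)) • w.ofLp) := by
      refine hsc.comp_homeomorph ((WithLp.homeomorphProd 2 ℝ ℝ).trans
        (Homeomorph.smulOfNeZero (-(2 * Real.pi)) (by simp [Real.pi_ne_zero])))
    exact h1.comp_left (g := fun x : ℝ => (2 * Real.pi : ℂ) * (x : ℂ)) (by simp)
  let ts : SchwartzMap (WithLp 2 (ℝ × ℝ)) ℂ := HasCompactSupport.toSchwartzMap htc hts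
  let us : SchwartzMap (WithLp 2 (ℝ × ℝ)) ℂ := 𝓕⁻ ts
  have hus : (fun w : WithLp 2 (ℝ × ℝ) => (fun y : ℝ × ℝ => us (WithLp.toLp 2 y)) w.ofLp)
      = us := rfl
  have h1 : Integrable fun y : ℝ × ℝ => us (WithLp.toLp 2 y) := by
    rw [← measurePreserving_ofLp.integrable_comp_emb measurableEmbedding_ofLp]
    exact us.integrable
  have h2 : MemLp (fun y : ℝ × ℝ => us (WithLp.toLp 2 y)) 2 := by
    rw [← measurePreserving_ofLp.map_eq, measurableEmbedding_ofLp.memLp_map_measure_iff]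
    exact us.memLp 2 volume
  have := h _ h1 h2
  rw [← this]
  refine integral_congr_ae (Filter.Eventually.of_forall fun ξ => ?_)
  have h3 : 𝓕 (us : WithLp 2 (ℝ × ℝ) → ℂ) = t := by
    rw [← SchwartzMap.fourier_coe]
    have : (𝓕 us : SchwartzMap (WithLp 2 (ℝ × ℝ)) ℂ) = ts := FourierTransform.fourier_fourierInv_eq ts
    rw [this]; rfl
  simp only [planeFT_eq, hus]
  rw [h3, ht]
  simp only [Complex.real_smul]
  rw [← mul_assoc]
  have : (-(2 * Real.pi)) • ((-(2 * Real.pi)⁻¹ : ℝ) • ξ) = ξ := by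
    rw [smul_smul]; rw [neg_mul_neg, mul_inv_cancel₀ hpi.ne', one_smul]
  rw [this]
  have : (Real.pi : ℂ) ≠ 0 := by exact_mod_cast Real.pi_ne_zero
  field_simp

/-! ### The Fourier transform on the slab -/

/-- The dual group `ℤ × ℝ²` of the slab. -/
abbrev Freq : Type := ℤ × ℝ × ℝ

/-- The Haar measure of the dual group. -/
def dualMeasure : Measure Freq := (Measure.count : Measure ℤ).prod volume

local notation "νF" => dualMeasure

instance : SFinite νF := by unfold dualMeasure; infer_instance

/-- The character of the slab with frequency `k`. -/
def character (k : Freq) (x : Slab) : ℂ :=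
  fourier k.1 x.1 * Complex.exp (Complex.I * ((k.2.1 * x.2.1 + k.2.2 * x.2.2 : ℝ) : ℂ))

/-- The components of the wave vector. -/
def wave (j : Fin 3) (k : Freq) : ℝ := ![2 * Real.pi * k.1, k.2.1, k.2.2] j

/-- The squared length of the wave vector. -/
def waveSq (k : Freq) : ℝ := (2 * Real.pi * k.1) ^ 2 + (k.2.1 ^ 2 + k.2.2 ^ 2)

theorem waveSq_eq_sum (k : Freq) : waveSq k = ∑ j, wave j k ^ 2 := by
  simp [waveSq, wave, Fin.sum_univ_three]; ring

theorem waveSq_nonneg (k : Freq) : 0 ≤ waveSq k := by unfold waveSq; positivity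

theorem continuous_wave (j : Fin 3) : Continuous (wave j) := by
  have h0 : Continuous fun k : Freq => (k.1 : ℝ) :=
    continuous_of_discreteTopology.comp continuous_fst
  fin_cases j
  · exact continuous_const.mul h0
  · exact continuous_snd.fst
  · exact continuous_snd.snd

theorem continuous_waveSq : Continuous waveSq := by
  have h0 : Continuous fun k : Freq => (k.1 : ℝ) :=
    continuous_of_discreteTopology.comp continuous_fst
  unfold waveSq; fun_prop

theorem continuous_character : Continuous fun p : Freq × Slab => character p.1 p.2 := by
  have h : Continuous fun q : ℤ × UnitAddCircle => (fourier q.1 q.2 : ℂ) :=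
    continuous_prod_of_discrete_left.2 fun n => (fourier n).continuous
  have h1 : Continuous fun p : Freq × Slab => (fourier p.1.1 p.2.1 : ℂ) :=
    h.comp (f := fun p : Freq × Slab => (p.1.1, p.2.1)) (by fun_prop)
  unfold character
  refine h1.mul (Complex.continuous_exp.comp (continuous_const.mul
    (Complex.continuous_ofReal.comp ?_)))
  fun_prop

theorem continuous_character_left (x : Slab) : Continuous fun k => character k x :=
  continuous_character.comp (by fun_prop : Continuous fun k : Freq => (k, x))

theorem continuous_character_right (k : Freq) : Continuous (character k) :=
  continuous_character.comp (by fun_prop : Continuous fun x : Slab => (k, x))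

theorem norm_fourier_apply (n : ℤ) (t : UnitAddCircle) : ‖(fourier n t : ℂ)‖ = 1 := by
  rw [fourier_apply]; exact Circle.norm_coe _

theorem norm_exp_I (s : ℝ) : ‖Complex.exp (Complex.I * (s : ℂ))‖ = 1 := by
  rw [mul_comm]; exact Complex.norm_exp_ofReal_mul_I s

@[simp] theorem norm_character (k : Freq) (x : Slab) : ‖character k x‖ = 1 := by
  rw [character, norm_mul, norm_fourier_apply, norm_exp_I, one_mul]

theorem character_add (k : Freq) (x z : Slab) :
    character k (x + z) = character k x * character k z := by
  simp only [character, Prod.fst_add, Prod.snd_add, fourier_apply, smul_add,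
    AddCircle.toCircle_add, Circle.coe_mul]
  have : Complex.I * ((k.2.1 * (x.2.1 + z.2.1) + k.2.2 * (x.2.2 + z.2.2) : ℝ) : ℂ)
      = Complex.I * ((k.2.1 * x.2.1 + k.2.2 * x.2.2 : ℝ) : ℂ)
        + Complex.I * ((k.2.1 * z.2.1 + k.2.2 * z.2.2 : ℝ) : ℂ) := by push_cast; ring
  rw [this, Complex.exp_add]; ring

theorem character_axis (k : Freq) (j : Fin 3) (s : ℝ) :
    character k (axis j s) = Complex.exp (Complex.I * ((wave j k * s : ℝ) : ℂ)) := by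
  fin_cases j
  · simp only [character, axis, wave, Fin.zero_eta, Matrix.cons_val_zero, fourier_coe_apply]
    simp; ring_nf
  · simp [character, axis, wave]
  · simp [character, axis, wave]

instance : (volume : Measure Slab).IsAddHaarMeasure := Measure.prod.instIsAddHaarMeasure _ _

/-- The Fourier transform of an integrable function on the slab. -/
def FT (f : Slab → ℂ) (k : Freq) : ℂ :=
  (1 / (2 * Real.pi) : ℂ) * ∫ x, character k x * f x

theorem fourierT_eq (f : Slab → ℝ) (n : ℤ) (ξ : ℝ × ℝ) :
    fourierT f n ξ = FT (fun x => (f x : ℂ)) (n, ξ) := rfl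

theorem integrable_character_mul {f : Slab → ℂ} (hf : Integrable f) (k : Freq) :
    Integrable fun x => character k x * f x :=
  hf.bdd_mul (continuous_character_right k).aestronglyMeasurable (c := 1)
    (Filter.Eventually.of_forall fun x => (norm_character k x).le)

theorem continuous_FT {f : Slab → ℂ} (hf : Integrable f) : Continuous (FT f) := by
  refine continuous_const.mul (continuous_of_dominated (bound := fun x => ‖f x‖) ?_ ?_ hf.norm ?_)
  · exact fun k => (integrable_character_mul hf k).aestronglyMeasurable
  · exact fun k => Filter.Eventually.of_forall fun x => by simp
  · exact Filter.Eventually.of_forall fun x => (continuous_character_left x).mul continuous_const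

theorem norm_FT_le (f : Slab → ℂ) (k : Freq) : ‖FT f k‖ ≤ (2 * Real.pi)⁻¹ * ∫ x, ‖f x‖ := by
  rw [FT, norm_mul]
  refine mul_le_mul ?_ ?_ (norm_nonneg _) (by positivity)
  · simp [abs_of_pos Real.pi_pos]
  · refine (norm_integral_le_integral_norm _).trans (le_of_eq ?_)
    simp

theorem FT_add {f g : Slab → ℂ} (hf : Integrable f) (hg : Integrable g) (k : Freq) :
    FT (fun x => f x + g x) k = FT f k + FT g k := by
  simp only [FT, mul_add]
  rw [integral_add (integrable_character_mul hf k) (integrable_character_mul hg k)]; ring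

theorem FT_const_mul (c : ℂ) (f : Slab → ℂ) (k : Freq) :
    FT (fun x => c * f x) k = c * FT f k := by
  simp only [FT]
  rw [← mul_assoc, mul_comm c, mul_assoc, ← integral_const_mul c]
  refine congrArg _ (integral_congr_ae (Filter.Eventually.of_forall fun x => ?_)); ring

theorem FT_congr {f g : Slab → ℂ} (h : f =ᵐ[volume] g) (k : Freq) : FT f k = FT g k := by
  unfold FT; congr 1; refine integral_congr_ae ?_
  filter_upwards [h] with x hx; rw [hx]

theorem FT_translate (f : Slab → ℂ) (a : Slab) (k : Freq) :
    FT (fun x => f (x + a)) k = conj (character k a) * FT f k := by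
  have h1 : conj (character k a) * character k a = 1 := by
    rw [← Complex.normSq_eq_conj_mul_self, Complex.normSq_eq_norm_sq, norm_character]; simp
  have h2 := integral_add_right_eq_self (μ := (volume : Measure Slab))
    (fun x => character k x * f x) a
  simp only [FT]
  rw [← h2, mul_left_comm, ← integral_const_mul (conj (character k a))]
  refine congrArg _ (integral_congr_ae (Filter.Eventually.of_forall fun x => ?_))
  beta_reduce
  rw [character_add]
  linear_combination (- character k x * f (x + a)) * h1

/-- The Fourier coefficients of `f` in the circle variable. -/
def slice (f : Slab → ℂ) (n : ℤ) (y : ℝ × ℝ) : ℂ := ∫ t : UnitAddCircle, fourier n t * f (t, y)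

theorem volume_unitAddCircle :
    (volume : Measure UnitAddCircle) = AddCircle.haarAddCircle := by
  have := AddCircle.volume_eq_smul_haarAddCircle (T := 1)
  rw [this]; simp

theorem tsum_enorm_sq_fourier {f : UnitAddCircle → ℂ} (hf : MemLp f 2) :
    ∑' n : ℤ, ‖∫ t, fourier n t * f t‖ₑ ^ 2 = ∫⁻ t, ‖f t‖ₑ ^ 2 := by
  have hf' : MemLp f 2 AddCircle.haarAddCircle := by rwa [← volume_unitAddCircle]
  have h := hasSum_sq_fourierCoeff (hf'.toLp f)
  have h2 : ∀ n : ℤ, ‖∫ t, fourier n t * f t‖ₑ ^ 2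
      = ENNReal.ofReal (‖fourierCoeff (hf'.toLp f) (-n)‖ ^ 2) := by
    intro n
    rw [ENNReal.ofReal_pow (norm_nonneg _), ofReal_norm]
    congr 2
    rw [fourierCoeff_congr_ae hf'.coeFn_toLp, fourierCoeff, volume_unitAddCircle]
    simp
  simp_rw [h2]
  have h3 := (Equiv.neg ℤ).tsum_eq (fun n : ℤ => ENNReal.ofReal (‖fourierCoeff (hf'.toLp f) n‖ ^ 2))
  simp only [Equiv.neg_apply] at h3
  rw [h3]
  rw [← ENNReal.ofReal_tsum_of_nonneg (fun n => by positivity) h.summable, h.tsum_eq]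
  rw [ofReal_integral_eq_lintegral_ofReal]
  · rw [volume_unitAddCircle]
    refine lintegral_congr_ae ?_
    filter_upwards [hf'.coeFn_toLp] with t ht
    rw [ht, ENNReal.ofReal_pow (norm_nonneg _), ofReal_norm]
  · exact (Lp.memLp _).integrable_norm_pow two_ne_zero
  · exact Filter.Eventually.of_forall fun t => by positivity

theorem integrable_fourier_fst_mul {f : Slab → ℂ} (h1 : Integrable f) (n : ℤ) :
    Integrable fun x : Slab => (fourier n x.1 : ℂ) * f x :=
  h1.bdd_mul (by
    have : Continuous fun x : Slab => (fourier n x.1 : ℂ) :=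
      (fourier n).continuous.comp continuous_fst
    exact this.aestronglyMeasurable) (c := 1)
    (Filter.Eventually.of_forall fun x => (norm_fourier_apply n x.1).le)

theorem integrable_slice {f : Slab → ℂ} (h1 : Integrable f) (n : ℤ) : Integrable (slice f n) :=
  (integrable_fourier_fst_mul h1 n).integral_prod_right

theorem FT_eq_planeFT_slice {f : Slab → ℂ} (h1 : Integrable f) (n : ℤ) (ξ : ℝ × ℝ) :
    FT f (n, ξ) = planeFT (slice f n) ξ := by
  rw [FT, planeFT]
  congr 1
  have := integral_prod_symm (μ := (volume : Measure UnitAddCircle))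
    (ν := (volume : Measure (ℝ × ℝ))) _ (integrable_character_mul h1 (n, ξ))
  refine this.trans (integral_congr_ae (Filter.Eventually.of_forall fun y => ?_))
  simp only [slice, character]
  rw [← integral_const_mul]
  congr 1; ext t; ring

/-- By Tonelli almost every circle fibre is square integrable, and Parseval applies on each such
fibre. -/
theorem ae_tsum_enorm_sq_slice {f : Slab → ℂ} (h2 : MemLp f 2) :
    ∀ᵐ y : ℝ × ℝ, ∑' n : ℤ, ‖slice f n y‖ₑ ^ 2 = ∫⁻ t : UnitAddCircle, ‖f (t, y)‖ₑ ^ 2 := by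
  have hm : AEStronglyMeasurable (fun z : (ℝ × ℝ) × UnitAddCircle => f z.swap)
      ((volume : Measure (ℝ × ℝ)).prod volume) := h2.1.prod_swap
  have hfin : ∀ᵐ y : ℝ × ℝ, ∫⁻ t : UnitAddCircle, ‖f (t, y)‖ₑ ^ 2 < ⊤ := by
    have := lintegral_enorm_sq_lt_top h2
    have e := lintegral_prod_symm (μ := (volume : Measure UnitAddCircle))
      (ν := (volume : Measure (ℝ × ℝ))) (fun x => ‖f x‖ₑ ^ 2) (h2.1.enorm.pow_const 2)
    have hne : ∫⁻ x, ‖f x‖ₑ ^ 2 ∂((volume : Measure UnitAddCircle).prod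
      (volume : Measure (ℝ × ℝ))) ≠ ⊤ := this.ne
    rw [e] at hne
    refine ae_lt_top' ?_ hne
    exact (hm.enorm.pow_const 2).lintegral_prod_right'
  filter_upwards [hfin, hm.prodMk_left] with y hy hym
  exact tsum_enorm_sq_fourier (memLp_two_of_lintegral hym hy.ne)

theorem tsum_lintegral_slice {f : Slab → ℂ} (h1 : Integrable f) (h2 : MemLp f 2) :
    ∑' n : ℤ, ∫⁻ y, ‖slice f n y‖ₑ ^ 2 = ∫⁻ x, ‖f x‖ₑ ^ 2 := by
  rw [← lintegral_tsum fun n => (integrable_slice h1 n).1.enorm.pow_const 2]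
  rw [lintegral_congr_ae (ae_tsum_enorm_sq_slice h2)]
  exact (lintegral_prod_symm (μ := (volume : Measure UnitAddCircle))
    (ν := (volume : Measure (ℝ × ℝ))) (fun x => ‖f x‖ₑ ^ 2) (h2.1.enorm.pow_const 2)).symm

theorem memLp_slice {f : Slab → ℂ} (h1 : Integrable f) (h2 : MemLp f 2) (n : ℤ) :
    MemLp (slice f n) 2 := by
  refine memLp_two_of_lintegral (integrable_slice h1 n).1 ?_
  refine ((ENNReal.le_tsum (f := fun n => ∫⁻ y, ‖slice f n y‖ₑ ^ 2) n).trans_lt ?_).ne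
  rw [tsum_lintegral_slice h1 h2]
  exact lintegral_enorm_sq_lt_top h2

theorem lintegral_dualMeasure {F : Freq → ℝ≥0∞} (hF : AEMeasurable F νF) :
    ∫⁻ k, F k ∂νF = ∑' n : ℤ, ∫⁻ ξ, F (n, ξ) := by
  rw [dualMeasure, lintegral_prod _ hF, lintegral_count]

/-- Plancherel on the slab: for each n the transform is the plane transform of the n-th circle
coefficient, and Parseval sums over n. -/
theorem lintegral_FT {f : Slab → ℂ} (h1 : Integrable f) (h2 : MemLp f 2) :
    ∫⁻ k, ‖FT f k‖ₑ ^ 2 ∂νF = ∫⁻ x, ‖f x‖ₑ ^ 2 := by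
  rw [lintegral_dualMeasure ((continuous_FT h1).measurable.enorm.pow_const 2).aemeasurable,
    ← tsum_lintegral_slice h1 h2]
  congr 1; ext n
  simp_rw [FT_eq_planeFT_slice h1]
  exact lintegral_planeFT (integrable_slice h1 n) (memLp_slice h1 h2 n)

theorem memLp_FT {f : Slab → ℂ} (h1 : Integrable f) (h2 : MemLp f 2) : MemLp (FT f) 2 νF := by
  refine memLp_two_of_lintegral (continuous_FT h1).measurable.aestronglyMeasurable ?_
  rw [lintegral_FT h1 h2]; exact (lintegral_enorm_sq_lt_top h2).ne

/-! ### The unitary Fourier transform on `L²` of the slab -/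

/-- The space `L¹ ∩ L²`. -/
def intSq : Submodule ℂ (Slab → ℂ) where
  carrier := {f | Integrable f volume ∧ MemLp f 2 volume}
  add_mem' hf hg := ⟨hf.1.add hg.1, hf.2.add hg.2⟩
  zero_mem' := ⟨integrable_zero _ _ _, MemLp.zero⟩
  smul_mem' c _ hf := ⟨hf.1.smul c, hf.2.const_smul c⟩

/-- The class in `L²` of a function in `L¹ ∩ L²`. -/
def intSqToL2 : intSq →ₗ[ℂ] Lp ℂ 2 (volume : Measure Slab) where
  toFun f := f.2.2.toLp f.1
  map_add' f g := MemLp.toLp_add f.2.2 g.2.2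
  map_smul' c f := MemLp.toLp_const_smul c f.2.2

/-- The class in `L²` of the Fourier transform of a function in `L¹ ∩ L²`. -/
def intSqFT : intSq →ₗ[ℂ] Lp ℂ 2 νF where
  toFun f := (memLp_FT f.2.1 f.2.2).toLp (FT f.1)
  map_add' f g := by
    rw [← MemLp.toLp_add]
    exact MemLp.toLp_congr _ _ (Filter.Eventually.of_forall fun k => FT_add f.2.1 g.2.1 k)
  map_smul' c f := by
    rw [RingHom.id_apply, ← MemLp.toLp_const_smul]
    exact MemLp.toLp_congr _ _ (Filter.Eventually.of_forall fun k => FT_const_mul c f.1 k)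

theorem norm_intSqFT (f : intSq) : ‖intSqFT f‖ = ‖intSqToL2 f‖ := by
  have h : eLpNorm (FT f.1) 2 νF ^ 2 = eLpNorm f.1 2 volume ^ 2 := by
    rw [eLpNorm_two_sq, eLpNorm_two_sq, lintegral_FT f.2.1 f.2.2]
  have h' : eLpNorm (FT f.1) 2 νF = eLpNorm f.1 2 volume :=
    (ENNReal.pow_right_strictMono two_ne_zero).injective h
  simp only [intSqFT, intSqToL2, LinearMap.coe_mk, AddHom.coe_mk, Lp.norm_toLp, h']

/-- Simple functions in L² have support of finite measure, hence are integrable, and they are dense.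
-/
theorem denseRange_intSqToL2 : DenseRange intSqToL2 := by
  have h : DenseRange ((↑) : Lp.simpleFunc ℂ 2 (volume : Measure Slab) →
      Lp ℂ 2 (volume : Measure Slab)) := Lp.simpleFunc.denseRange ENNReal.ofNat_ne_top
  refine h.mono ?_
  rintro _ ⟨f, rfl⟩
  have hm : MemLp (Lp.simpleFunc.toSimpleFunc f) 2 (volume : Measure Slab) :=
    Lp.simpleFunc.memLp f
  have hi : Integrable (Lp.simpleFunc.toSimpleFunc f) (volume : Measure Slab) :=
    (SimpleFunc.memLp_iff_integrable two_ne_zero (by norm_num)).1 hm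
  refine ⟨⟨_, hi, hm⟩, ?_⟩
  have := congrArg Subtype.val (Lp.simpleFunc.toLp_toSimpleFunc f)
  exact this

/-- The Fourier transform on `L²` as an isometry. -/
def ftIsometry : Lp ℂ 2 (volume : Measure Slab) →ₗᵢ[ℂ] Lp ℂ 2 νF where
  toLinearMap := (intSqFT.extendOfNorm intSqToL2).toLinearMap
  norm_map' := by
    refine denseRange_intSqToL2.induction ?_
      (isClosed_eq (intSqFT.extendOfNorm intSqToL2).continuous.norm continuous_norm)
    rintro _ ⟨f, rfl⟩
    have := LinearMap.extendOfNorm_eq (f := intSqFT) (e := intSqToL2) denseRange_intSqToL2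
      ⟨1, fun x => by rw [one_mul, norm_intSqFT]⟩ f
    rw [← norm_intSqFT f, ← this]; rfl

theorem ftIsometry_toL2 (f : intSq) : ftIsometry (intSqToL2 f) = intSqFT f :=
  LinearMap.extendOfNorm_eq (f := intSqFT) (e := intSqToL2) denseRange_intSqToL2
    ⟨1, fun x => by rw [one_mul, norm_intSqFT]⟩ f

theorem ae_dualMeasure {p : Freq → Prop} (h : ∀ n : ℤ, ∀ᵐ ξ : ℝ × ℝ, p (n, ξ))
    (hp : MeasurableSet {k | p k}) : ∀ᵐ k ∂νF, p k := by
  rw [dualMeasure, Measure.ae_prod_iff_ae_ae hp]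
  exact Filter.Eventually.of_forall h

theorem measurePreserving_freq (n : ℤ) : ∀ s : Set Freq, MeasurableSet s →
    volume ((fun ξ : ℝ × ℝ => ((n, ξ) : Freq)) ⁻¹' s) ≤ νF s := by
  intro s hs
  have h1 := lintegral_dualMeasure (F := s.indicator 1) (aemeasurable_one.indicator hs)
  rw [lintegral_indicator_one hs] at h1
  rw [h1]
  refine le_trans (le_of_eq ?_) (ENNReal.le_tsum n)
  rw [← lintegral_indicator_one (measurable_prodMk_left hs)]
  rfl

/-- Counting measure gives each point mass one, so a single slice embeds into the dual group without
exceeding its measure. This transfers a.e. and L^p statements from the dual group to each slice. -/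
theorem map_freq_le (n : ℤ) :
    Measure.map (fun ξ : ℝ × ℝ => ((n, ξ) : Freq)) volume ≤ νF := by
  refine Measure.le_iff.2 fun s hs => ?_
  rw [Measure.map_apply measurable_prodMk_left hs]
  exact measurePreserving_freq n s hs

theorem memLp_freq_slice {g : Freq → ℂ} {p : ℝ≥0∞} (hg : MemLp g p νF) (n : ℤ) :
    MemLp (fun ξ : ℝ × ℝ => g (n, ξ)) p := by
  have := hg.mono_measure (map_freq_le n)
  exact (memLp_map_measure_iff this.1 measurable_prodMk_left.aemeasurable).1 this

theorem ae_freq_slice {p : Freq → Prop} (h : ∀ᵐ k ∂νF, p k) (n : ℤ) :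
    ∀ᵐ ξ : ℝ × ℝ, p (n, ξ) :=
  ae_of_ae_map measurable_prodMk_left.aemeasurable ((map_freq_le n).absolutelyContinuous.ae_le h)

theorem integral_dualMeasure {g : Freq → ℂ} (hg : Integrable g νF) :
    ∫ k, g k ∂νF = ∑' n : ℤ, ∫ ξ, g (n, ξ) := by
  rw [dualMeasure, integral_prod _ hg, integral_countable]
  · simp [Measure.real]
  · exact hg.integral_prod_left

theorem FT_circle_mul (n : ℤ) (u : ℝ × ℝ → ℂ) (m : ℤ) (ξ : ℝ × ℝ) :
    FT (fun x => fourier (-n) x.1 * u x.2) (m, ξ) = if m = n then planeFT u ξ else 0 := by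
  have h1 : ∀ x : Slab, character (m, ξ) x * (fourier (-n) x.1 * u x.2)
      = fourier (m - n) x.1 *
        (Complex.exp (Complex.I * ((ξ.1 * x.2.1 + ξ.2 * x.2.2 : ℝ) : ℂ)) * u x.2) := by
    intro x
    rw [character, sub_eq_add_neg, fourier_add]; ring
  have h2 : (∫ t : UnitAddCircle, (fourier (m - n) t : ℂ)) = if m = n then 1 else 0 := by
    have := fourierCoeff_fourier (T := 1) (m - n)
    have h3 := congrFun this 0
    rw [fourierCoeff] at h3
    rw [volume_unitAddCircle]
    simp only [neg_zero, fourier_zero, one_smul] at h3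
    rw [h3, Pi.single_apply]
    simp only [eq_comm (a := (0 : ℤ)), sub_eq_zero]
  simp only [FT, h1]
  have h4 := integral_prod_mul (μ := (volume : Measure UnitAddCircle))
    (ν := (volume : Measure (ℝ × ℝ))) (fun t => (fourier (m - n) t : ℂ))
    (fun y => Complex.exp (Complex.I * ((ξ.1 * y.1 + ξ.2 * y.2 : ℝ) : ℂ)) * u y)
  have h5 : ∫ x : Slab, (fourier (m - n) x.1 : ℂ) *
        (Complex.exp (Complex.I * ((ξ.1 * x.2.1 + ξ.2 * x.2.2 : ℝ) : ℂ)) * u x.2)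
      = _ := h4
  rw [h5, h2]
  split_ifs <;> simp [planeFT]

theorem memLp_circle_mul (n : ℤ) {u : ℝ × ℝ → ℂ} {p : ℝ≥0∞} (hu : MemLp u p) :
    MemLp (fun x : Slab => fourier n x.1 * u x.2) p := by
  have h : MemLp (fun x : Slab => u x.2) p :=
    by
    have : IsProbabilityMeasure (volume : Measure UnitAddCircle) := by
      rw [volume_unitAddCircle]; infer_instance
    exact hu.comp_measurePreserving
      (measurePreserving_snd (μ := (volume : Measure UnitAddCircle)))
  have hc : Continuous fun x : Slab => (fourier n x.1 : ℂ) :=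
    (fourier n).continuous.comp continuous_fst
  refine (memLp_congr_norm (hc.aestronglyMeasurable.mul h.1) h.1
    (Filter.Eventually.of_forall fun x => ?_)).2 h
  rw [Pi.mul_apply, norm_mul, norm_fourier_apply, one_mul]

/-- A square integrable function on the dual group which is orthogonal to all Fourier transforms
vanishes. -/
theorem ae_eq_zero_of_integral_FT_mul {g : Freq → ℂ} (hg : MemLp g 2 νF)
    (h : ∀ f : Slab → ℂ, Integrable f → MemLp f 2 → ∫ k, FT f k * g k ∂νF = 0) :
    g =ᵐ[νF] 0 := by
  -- A function of the form exp(-2πi n x₁) u(x₂, x₃) has transform supported on the slice n, which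
  -- isolates that slice of `g`.
  have key : ∀ n : ℤ, ∀ᵐ ξ : ℝ × ℝ, g (n, ξ) = 0 := by
    intro n
    refine ae_eq_zero_of_integral_planeFT_mul (memLp_freq_slice hg n) fun u hu1 hu2 => ?_
    have hf1 : Integrable fun x : Slab => fourier (-n) x.1 * u x.2 := by
      rw [← memLp_one_iff_integrable] at hu1 ⊢; exact memLp_circle_mul (-n) hu1
    have hf2 := memLp_circle_mul (-n) hu2
    have := h _ hf1 hf2
    have hi : Integrable (fun k => FT (fun x : Slab => fourier (-n) x.1 * u x.2) k * g k) νF :=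
      (memLp_FT hf1 hf2).integrable_mul hg
    rw [integral_dualMeasure hi] at this
    simp only [FT_circle_mul] at this
    rw [tsum_eq_single n (fun m hm => by simp [hm])] at this
    simpa using this
  -- A measurable representative is needed because assembling null sets over slices requires a
  -- measurable exceptional set.
  obtain ⟨g', hg', hgg'⟩ := hg.1
  have : ∀ᵐ k ∂νF, g' k = 0 := by
    refine ae_dualMeasure (fun n => ?_) (hg'.measurable (measurableSet_singleton 0))
    filter_upwards [key n, ae_freq_slice hgg' n] with ξ h1 h2
    rw [← h2, h1]
  filter_upwards [hgg', this] with k h1 h2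
  rw [h1, h2]; rfl

theorem inner_toLp_eq {α : Type*} [MeasurableSpace α] {μ : Measure α} {f g : α → ℂ}
    (hf : MemLp f 2 μ) (hg : MemLp g 2 μ) :
    inner ℂ (hf.toLp f) (hg.toLp g) = ∫ x, conj (f x) * g x ∂μ := by
  rw [L2.inner_def]
  refine integral_congr_ae ?_
  filter_upwards [hf.coeFn_toLp, hg.coeFn_toLp] with x h1 h2
  rw [h1, h2, RCLike.inner_apply, mul_comm]

/-- The range of an isometry on a complete space is complete, so it is everything once its
orthogonal complement is trivial; the complement is trivial because it annihilates all transforms of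
L¹ ∩ L² functions. -/
theorem ftIsometry_surjective : Function.Surjective ftIsometry := by
  have hc : IsComplete (LinearMap.range ftIsometry.toLinearMap : Set (Lp ℂ 2 νF)) := by
    have := ftIsometry.isometry.isUniformInducing.isComplete_range
    convert! this
  have : CompleteSpace (LinearMap.range ftIsometry.toLinearMap) := hc.completeSpace_coe
  have : LinearMap.range ftIsometry.toLinearMap = ⊤ := by
    rw [← Submodule.orthogonal_eq_bot_iff, Submodule.eq_bot_iff]
    intro g hg
    have hg' : ∀ f : Slab → ℂ, Integrable f → MemLp f 2 → ∫ k, FT f k * conj (g k) ∂νF = 0 := by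
      intro f h1 h2
      have h3 := (Submodule.mem_orthogonal' _ _).1 hg _
        (LinearMap.mem_range_self ftIsometry.toLinearMap (intSqToL2 ⟨f, h1, h2⟩))
      have h4 : inner ℂ g (intSqFT ⟨f, h1, h2⟩) = 0 := by
        rw [← ftIsometry_toL2]; exact h3
      rw [← Lp.toLp_coeFn g (Lp.memLp g)] at h4
      have h5 := (inner_toLp_eq (Lp.memLp g) (memLp_FT h1 h2)).symm.trans h4
      rw [← h5]; congr 1; ext k; ring
    have h6 := ae_eq_zero_of_integral_FT_mul (Lp.memLp g).star hg'
    rw [Lp.eq_zero_iff_ae_eq_zero]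
    filter_upwards [h6] with k hk
    simpa using hk
  intro g
  have hg : g ∈ LinearMap.range ftIsometry.toLinearMap := this ▸ Submodule.mem_top
  exact hg

/-- The unitary Fourier transform. -/
def ftL2 : Lp ℂ 2 (volume : Measure Slab) ≃ₗᵢ[ℂ] Lp ℂ 2 νF :=
  LinearIsometryEquiv.ofSurjective ftIsometry ftIsometry_surjective

open Classical in
/-- The Fourier transform of a square integrable function. -/
def F2 (f : Slab → ℂ) : Freq → ℂ := if h : MemLp f 2 then ftL2 (h.toLp f) else 0

open Classical in
/-- The inverse Fourier transform of a square integrable function. -/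
def F2inv (g : Freq → ℂ) : Slab → ℂ := if h : MemLp g 2 νF then ftL2.symm (h.toLp g) else 0

theorem memLp_F2 (f : Slab → ℂ) : MemLp (F2 f) 2 νF := by
  unfold F2; split_ifs
  · exact Lp.memLp _
  · exact MemLp.zero

theorem memLp_F2inv (g : Freq → ℂ) : MemLp (F2inv g) 2 := by
  unfold F2inv; split_ifs
  · exact Lp.memLp _
  · exact MemLp.zero

theorem toLp_F2 {f : Slab → ℂ} (h : MemLp f 2) : (memLp_F2 f).toLp (F2 f) = ftL2 (h.toLp f) := by
  rw [← Lp.toLp_coeFn (ftL2 (h.toLp f)) (Lp.memLp _)]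
  congr 1; simp [F2, h]

theorem F2_congr {f g : Slab → ℂ} (h : f =ᵐ[volume] g) : F2 f = F2 g := by
  unfold F2
  by_cases hf : MemLp f 2
  · have hg := (memLp_congr_ae h).1 hf
    rw [dif_pos hf, dif_pos hg, MemLp.toLp_congr hf hg h]
  · have hg : ¬ MemLp g 2 := fun hg => hf ((memLp_congr_ae h).2 hg)
    rw [dif_neg hf, dif_neg hg]

theorem F2_ae_eq {f : Slab → ℂ} (h1 : Integrable f) (h2 : MemLp f 2) : F2 f =ᵐ[νF] FT f := by
  have : (memLp_F2 f).toLp (F2 f) = (memLp_FT h1 h2).toLp (FT f) := by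
    rw [toLp_F2 h2]; exact ftIsometry_toL2 ⟨f, h1, h2⟩
  exact (MemLp.toLp_eq_toLp_iff _ _).1 this

theorem F2_F2inv {g : Freq → ℂ} (h : MemLp g 2 νF) : F2 (F2inv g) =ᵐ[νF] g := by
  refine (MemLp.toLp_eq_toLp_iff (memLp_F2 _) h).1 ?_
  rw [toLp_F2 (memLp_F2inv g)]
  have : (memLp_F2inv g).toLp (F2inv g) = ftL2.symm (h.toLp g) := by
    rw [← Lp.toLp_coeFn (ftL2.symm (h.toLp g)) (Lp.memLp _)]
    congr 1; simp [F2inv, h]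
  rw [this, LinearIsometryEquiv.apply_symm_apply]

theorem integral_conj_mul_F2 {f g : Slab → ℂ} (hf : MemLp f 2) (hg : MemLp g 2) :
    ∫ k, conj (F2 f k) * F2 g k ∂νF = ∫ x, conj (f x) * g x := by
  rw [← inner_toLp_eq (memLp_F2 f) (memLp_F2 g), ← inner_toLp_eq hf hg, toLp_F2 hf, toLp_F2 hg,
    LinearIsometryEquiv.inner_map_map]

theorem lintegral_F2 {f : Slab → ℂ} (hf : MemLp f 2) :
    ∫⁻ k, ‖F2 f k‖ₑ ^ 2 ∂νF = ∫⁻ x, ‖f x‖ₑ ^ 2 := by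
  have h := congrArg (fun t => ‖t‖) (toLp_F2 hf)
  simp only [LinearIsometryEquiv.norm_map, Lp.norm_toLp] at h
  rw [ENNReal.toReal_eq_toReal_iff' (memLp_F2 f).2.ne hf.2.ne] at h
  rw [← eLpNorm_two_sq, ← eLpNorm_two_sq, h]

theorem ae_eq_of_F2 {f g : Slab → ℂ} (hf : MemLp f 2) (hg : MemLp g 2) (h : F2 f =ᵐ[νF] F2 g) :
    f =ᵐ[volume] g := by
  refine (MemLp.toLp_eq_toLp_iff hf hg).1 (ftL2.injective ?_)
  rw [← toLp_F2 hf, ← toLp_F2 hg]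
  exact MemLp.toLp_congr _ _ h

theorem F2_add {f g : Slab → ℂ} (hf : MemLp f 2) (hg : MemLp g 2) :
    F2 (fun x => f x + g x) =ᵐ[νF] fun k => F2 f k + F2 g k := by
  have h := toLp_F2 (hf.add hg)
  rw [MemLp.toLp_add hf hg, map_add, ← toLp_F2 hf, ← toLp_F2 hg, ← MemLp.toLp_add] at h
  exact (MemLp.toLp_eq_toLp_iff _ _).1 h

theorem F2_const_mul (c : ℂ) {f : Slab → ℂ} (hf : MemLp f 2) :
    F2 (fun x => c * f x) =ᵐ[νF] fun k => c * F2 f k := by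
  have h := toLp_F2 (hf.const_smul c)
  rw [MemLp.toLp_const_smul c hf, map_smul, ← toLp_F2 hf, ← MemLp.toLp_const_smul] at h
  exact (MemLp.toLp_eq_toLp_iff _ _).1 h

/-! ### Fourier inversion for integrable transforms. -/

/-- The inverse Fourier transform of an integrable function. -/
def IFT (g : Freq → ℂ) (x : Slab) : ℂ :=
  (1 / (2 * Real.pi) : ℂ) * ∫ k, conj (character k x) * g k ∂νF

theorem integrable_conj_character_mul {g : Freq → ℂ} (hg : Integrable g νF) (x : Slab) :
    Integrable (fun k => conj (character k x) * g k) νF :=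
  hg.bdd_mul (Complex.continuous_conj.comp (continuous_character_left x)).aestronglyMeasurable
    (c := 1) (Filter.Eventually.of_forall fun k => by simp)

theorem continuous_IFT {g : Freq → ℂ} (hg : Integrable g νF) : Continuous (IFT g) := by
  refine continuous_const.mul (continuous_of_dominated (bound := fun k => ‖g k‖) ?_ ?_ hg.norm ?_)
  · exact fun x => (integrable_conj_character_mul hg x).aestronglyMeasurable
  · exact fun k => Filter.Eventually.of_forall fun x => by simp
  · exact Filter.Eventually.of_forall fun k =>
      (Complex.continuous_conj.comp (continuous_character_right k)).mul continuous_const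

theorem integral_conj_FT_mul {f : Slab → ℂ} {g : Freq → ℂ} (hf : Integrable f)
    (hg : Integrable g νF) :
    ∫ k, conj (FT f k) * g k ∂νF = ∫ x, conj (f x) * IFT g x := by
  have hmeas : Continuous fun p : Freq × Slab => conj (character p.1 p.2) :=
    Complex.continuous_conj.comp continuous_character
  have hint : Integrable (fun p : Freq × Slab =>
      conj (character p.1 p.2) * (g p.1 * conj (f p.2))) (dualMeasure.prod volume) := by
    have hcf : Integrable (fun x => conj (f x)) := by
      simpa using! (Complex.conjCLE.toContinuousLinearMap.integrable_comp hf)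
    exact (hg.mul_prod hcf).bdd_mul (c := 1)
      hmeas.aestronglyMeasurable (Filter.Eventually.of_forall fun p => by simp)
  have hswap := integral_integral_swap (f := fun k x =>
    conj (character k x) * (g k * conj (f x))) hint
  have e1 : ∀ k, conj (FT f k) * g k
      = (1 / (2 * Real.pi) : ℂ) * ∫ x, conj (character k x) * (g k * conj (f x)) := by
    intro k
    rw [FT, map_mul, ← integral_conj, mul_assoc, ← integral_mul_const]
    have : conj (1 / (2 * Real.pi) : ℂ) = (1 / (2 * Real.pi) : ℂ) := by simp [map_ofNat]
    rw [this]
    refine congrArg _ (integral_congr_ae (Filter.Eventually.of_forall fun x => ?_))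
    simp only [map_mul]; ring
  have e2 : ∀ x, conj (f x) * IFT g x
      = (1 / (2 * Real.pi) : ℂ) * ∫ k, conj (character k x) * (g k * conj (f x)) ∂νF := by
    intro x
    rw [IFT, mul_left_comm, ← integral_const_mul (conj (f x))]
    refine congrArg _ (integral_congr_ae (Filter.Eventually.of_forall fun k => ?_))
    ring
  simp_rw [e1, e2]
  rw [integral_const_mul, integral_const_mul, hswap]

/-- Pair both candidates with indicators of sets of finite measure: one pairing is unitarity of the
L² transform, the other is Fubini, and both reduce to the same integral over frequencies. -/
theorem F2inv_ae_eq {g : Freq → ℂ} (h1 : Integrable g νF) (h2 : MemLp g 2 νF) :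
    F2inv g =ᵐ[volume] IFT g := by
  have hloc : ∀ s : Set Slab, MeasurableSet s → volume s < ⊤ → IntegrableOn (F2inv g) s := by
    intro s hs hsf
    have : IsFiniteMeasure ((volume : Measure Slab).restrict s) := ⟨by simpa using hsf⟩
    exact ((memLp_F2inv g).restrict s).integrable (by norm_num)
  have hb : ∀ x, ‖IFT g x‖ ≤ (2 * Real.pi)⁻¹ * ∫ k, ‖g k‖ ∂νF := by
    intro x
    rw [IFT, norm_mul]
    refine mul_le_mul (by simp [abs_of_pos Real.pi_pos]) ?_ (norm_nonneg _) (by positivity)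
    exact (norm_integral_le_integral_norm _).trans (le_of_eq (by simp))
  refine ae_eq_of_forall_setIntegral_eq_of_sigmaFinite hloc ?_ fun s hs hsf => ?_
  · intro s hs hsf
    exact Measure.integrableOn_of_bounded hsf.ne (continuous_IFT h1).aestronglyMeasurable
      (Filter.Eventually.of_forall hb)
  · set f : Slab → ℂ := s.indicator 1 with hf
    have hf1 : Integrable f := (integrable_indicator_iff hs).2 (integrableOn_const hsf.ne)
    have hf2 : MemLp f 2 := memLp_indicator_const 2 hs 1 (Or.inr hsf.ne)
    have h3 := integral_conj_mul_F2 hf2 (memLp_F2inv g)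
    have h4 : ∫ k, conj (F2 f k) * F2 (F2inv g) k ∂νF = ∫ k, conj (FT f k) * g k ∂νF := by
      refine integral_congr_ae ?_
      filter_upwards [F2_ae_eq hf1 hf2, F2_F2inv h2] with k a b
      rw [a, b]
    rw [h4, integral_conj_FT_mul hf1 h1] at h3
    have h5 : ∀ u : Slab → ℂ, ∫ x, conj (f x) * u x = ∫ x in s, u x := by
      intro u
      rw [← integral_indicator hs]
      congr 1; ext x
      by_cases hx : x ∈ s <;> simp [hf, hx]
    rw [h5, h5] at h3
    exact h3.symm

/-! ### Smooth functions and test functions -/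

/-- The covering map `ℝ³ → T₁`. -/
def cover (p : ℝ × ℝ × ℝ) : Slab := ((p.1 : UnitAddCircle), p.2)

theorem isOpenQuotientMap_cover : IsOpenQuotientMap cover :=
  (QuotientAddGroup.isOpenQuotientMap_mk (N := AddSubgroup.zmultiples (1 : ℝ))).prodMap
    IsOpenQuotientMap.id

theorem cover_surjective : Function.Surjective cover := isOpenQuotientMap_cover.surjective

theorem cover_add (p q : ℝ × ℝ × ℝ) : cover (p + q) = cover p + cover q := by
  simp [cover]

/-- The standard basis of `ℝ³`. -/
def unitVec (i : Fin 3) : ℝ × ℝ × ℝ := ![(1, 0, 0), (0, 1, 0), (0, 0, 1)] i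

theorem axis_eq_cover (i : Fin 3) (s : ℝ) : axis i s = cover (s • unitVec i) := by
  fin_cases i <;> simp [axis, cover, unitVec]

theorem axis_zero (i : Fin 3) : axis i 0 = 0 := by
  rw [axis_eq_cover]; simp [cover]

theorem axis_add (i : Fin 3) (s t : ℝ) : axis i (s + t) = axis i s + axis i t := by
  simp only [axis_eq_cover, add_smul, cover_add]

theorem continuous_axis (i : Fin 3) : Continuous (axis i) := by
  have : axis i = fun s => cover (s • unitVec i) := funext (axis_eq_cover i)
  rw [this]
  exact isOpenQuotientMap_cover.continuous.comp (by fun_prop)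

/-- Smooth real functions on the slab. -/
def IsSmooth (h : Slab → ℝ) : Prop := ContDiff ℝ ∞ fun p => h (cover p)

namespace IsSmooth

variable {h h' : Slab → ℝ}

theorem continuous (hh : IsSmooth h) : Continuous h :=
  isOpenQuotientMap_cover.continuous_comp_iff.1 (ContDiff.continuous hh)

theorem mul (hh : IsSmooth h) (hh' : IsSmooth h') : IsSmooth fun x => h x * h' x :=
  ContDiff.mul hh hh'

theorem inv (hh : IsSmooth h) (h0 : ∀ x, h x ≠ 0) : IsSmooth fun x => (h x)⁻¹ :=
  ContDiff.inv hh fun p => h0 (cover p)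

theorem const (c : ℝ) : IsSmooth fun _ => c := contDiff_const

theorem comp_snd {v : ℝ × ℝ → ℝ} (hv : ContDiff ℝ ∞ v) : IsSmooth fun x => v x.2 :=
  hv.comp contDiff_snd

theorem translate (hh : IsSmooth h) (a : Slab) : IsSmooth fun x => h (x + a) := by
  obtain ⟨q, rfl⟩ := cover_surjective a
  have : (fun p => h (cover p + cover q)) = (fun p => h (cover p)) ∘ fun p => p + q := by
    ext p; simp [cover_add]
  unfold IsSmooth
  rw [this]
  exact ContDiff.comp hh (contDiff_id.add contDiff_const)

theorem hasDerivAt_fderiv (hh : IsSmooth h) (i : Fin 3) (p : ℝ × ℝ × ℝ) :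
    HasDerivAt (fun s : ℝ => h (cover p + axis i s))
      (fderiv ℝ (fun p => h (cover p)) p (unitVec i)) 0 := by
  have h1 : HasFDerivAt (fun p => h (cover p)) (fderiv ℝ (fun p => h (cover p)) p) p :=
    (ContDiff.differentiable hh (by simp) p).hasFDerivAt
  have h2 : HasDerivAt (fun s : ℝ => p + s • unitVec i) (unitVec i) 0 := by
    simpa using ((hasDerivAt_id (0 : ℝ)).smul_const (unitVec i)).const_add p
  have h3 : HasFDerivAt (fun p => h (cover p)) (fderiv ℝ (fun p => h (cover p)) p)
      (p + (0 : ℝ) • unitVec i) := by simpa using h1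
  have h4 := h3.comp_hasDerivAt (0 : ℝ) h2
  refine h4.congr_of_eventuallyEq (Filter.Eventually.of_forall fun s => ?_)
  simp [axis_eq_cover, cover_add]

theorem pderiv_cover (hh : IsSmooth h) (i : Fin 3) (p : ℝ × ℝ × ℝ) :
    pderiv i h (cover p) = fderiv ℝ (fun p => h (cover p)) p (unitVec i) :=
  (hh.hasDerivAt_fderiv i p).deriv

theorem hasDerivAt_zero (hh : IsSmooth h) (i : Fin 3) (x : Slab) :
    HasDerivAt (fun s : ℝ => h (x + axis i s)) (pderiv i h x) 0 := by
  obtain ⟨p, rfl⟩ := cover_surjective x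
  rw [hh.pderiv_cover]; exact hh.hasDerivAt_fderiv i p

theorem hasDerivAt (hh : IsSmooth h) (i : Fin 3) (x : Slab) (s : ℝ) :
    HasDerivAt (fun s : ℝ => h (x + axis i s)) (pderiv i h (x + axis i s)) s := by
  have h1 := hh.hasDerivAt_zero i (x + axis i s)
  have h2 : HasDerivAt (fun t : ℝ => t - s) 1 s := by simpa using (hasDerivAt_id s).sub_const s
  have h1' : HasDerivAt (fun t : ℝ => h (x + axis i s + axis i t)) (pderiv i h (x + axis i s))
    (s - s) := by simpa using h1
  have h3 := HasDerivAt.comp (h₂ := fun t : ℝ => h (x + axis i s + axis i t)) (h := fun t => t - s) s h1' h2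
  rw [mul_one] at h3
  refine h3.congr_of_eventuallyEq (Filter.Eventually.of_forall fun t => ?_)
  simp only [Function.comp, add_assoc, ← axis_add]
  congr 3; ring

theorem smooth_pderiv (hh : IsSmooth h) (i : Fin 3) : IsSmooth (pderiv i h) := by
  unfold IsSmooth
  have : (fun p => pderiv i h (cover p))
      = fun p => fderiv ℝ (fun p => h (cover p)) p (unitVec i) :=
    funext fun p => hh.pderiv_cover i p
  rw [this]
  exact ((ContDiff.fderiv_right hh (m := ∞) (by simp)).clm_apply contDiff_const)

theorem pderiv_mul (hh : IsSmooth h) (hh' : IsSmooth h') (i : Fin 3) (x : Slab) :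
    pderiv i (fun x => h x * h' x) x
      = pderiv i h x * h' x + h x * pderiv i h' x := by
  have := ((hh.hasDerivAt_zero i x).mul (hh'.hasDerivAt_zero i x)).deriv
  simpa [axis_zero] using! this

end IsSmooth

theorem pderiv_translate (h : Slab → ℝ) (a : Slab) (i : Fin 3) (x : Slab) :
    pderiv i (fun x => h (x + a)) x = pderiv i h (x + a) := by
  simp only [pderiv]
  congr 1; ext s; rw [add_right_comm]

namespace IsTest

variable {η : Slab → ℝ}

theorem isSmooth (hη : IsTest η) : IsSmooth η := hη.1

theorem continuous (hη : IsTest η) : Continuous η := hη.isSmooth.continuous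

theorem test_pderiv (hη : IsTest η) (i : Fin 3) : IsTest (pderiv i η) := by
  refine ⟨hη.isSmooth.smooth_pderiv i, hη.2.mono' fun x hx => ?_⟩
  by_contra hn
  apply hx
  have h1 : η =ᶠ[𝓝 x] 0 := notMem_tsupport_iff_eventuallyEq.1 hn
  have h2 : Filter.Tendsto (fun s : ℝ => x + axis i s) (𝓝 0) (𝓝 x) := by
    have : Continuous fun s : ℝ => x + axis i s := continuous_const.add (continuous_axis i)
    simpa [axis_zero] using this.tendsto 0
  have h3 : (fun s : ℝ => η (x + axis i s)) =ᶠ[𝓝 0] fun _ => (0 : ℝ) := h2.eventually h1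
  rw [pderiv, h3.deriv_eq]; simp

theorem mul_smooth (hη : IsTest η) {h : Slab → ℝ} (hh : IsSmooth h) :
    IsTest fun x => η x * h x :=
  ⟨hη.isSmooth.mul hh, hη.2.mul_right⟩

theorem translate (hη : IsTest η) (a : Slab) : IsTest fun x => η (x + a) :=
  ⟨hη.isSmooth.translate a, hη.2.comp_homeomorph (Homeomorph.addRight a)⟩

theorem memLp (hη : IsTest η) (p : ℝ≥0∞) : MemLp η p :=
  hη.continuous.memLp_of_hasCompactSupport hη.2

theorem integrable (hη : IsTest η) : Integrable η :=
  hη.continuous.integrable_of_hasCompactSupport hη.2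

theorem exists_bound (hη : IsTest η) : ∃ C, ∀ x, ‖η x‖ ≤ C :=
  hη.2.exists_bound_of_continuous hη.continuous

theorem integrable_smul {E : Type*} [NormedAddCommGroup E] [NormedSpace ℝ E] (hη : IsTest η)
    {f : Slab → E} (hf : LocallyIntegrable f) : Integrable fun x => η x • f x :=
  hf.integrable_smul_left_of_hasCompactSupport hη.continuous hη.2

/-- The integral of η(x + s eᵢ) does not depend on s. Integrating the derivative over s ∈ [0, 1] and
exchanging integrals gives the claim, uniformly for the periodic and the unbounded directions. -/
theorem integral_pderiv (hη : IsTest η) (i : Fin 3) :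
    ∫ x, pderiv i η x = 0 := by
  set g := pderiv i η with hg
  have hgt : IsTest g := hη.test_pderiv i
  have hcont : Continuous fun q : ℝ × Slab => g (q.2 + axis i q.1) :=
    hgt.continuous.comp (continuous_snd.add ((continuous_axis i).comp continuous_fst))
  have hint : Integrable (fun q : ℝ × Slab => g (q.2 + axis i q.1))
      ((volume.restrict (Set.Ioc (0 : ℝ) 1)).prod volume) := by
    rw [integrable_prod_iff hcont.aestronglyMeasurable]
    refine ⟨Filter.Eventually.of_forall fun s => (hgt.translate (axis i s)).integrable, ?_⟩
    have : ∀ s, ∫ x, ‖g (x + axis i s)‖ = ∫ x, ‖g x‖ := fun s =>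
      integral_add_right_eq_self (fun x => ‖g x‖) (axis i s)
    simp only [this]
    exact integrable_const _
  have hsw := integral_integral_swap (f := fun s x => g (x + axis i s)) hint
  have e1 : ∀ s, ∫ x, g (x + axis i s) = ∫ x, g x := fun s =>
    integral_add_right_eq_self g (axis i s)
  have e2 : ∀ x, ∫ s in Set.Ioc (0 : ℝ) 1, g (x + axis i s) = η (x + axis i 1) - η x := by
    intro x
    rw [← intervalIntegral.integral_of_le zero_le_one]
    rw [intervalIntegral.integral_eq_sub_of_hasDerivAt
      (fun s _ => hη.isSmooth.hasDerivAt i x s)]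
    · simp [axis_zero]
    · exact (hgt.continuous.comp (continuous_const.add (continuous_axis i))).intervalIntegrable _ _
  simp only [e1, e2] at hsw
  rw [integral_sub (hη.translate _).integrable hη.integrable,
    integral_add_right_eq_self η (axis i 1), sub_self] at hsw
  simpa using hsw

end IsTest

/-! ### Calculus of weak derivatives -/

section WeakCalculus

variable {E F : Type*} [NormedAddCommGroup E] [NormedSpace ℝ E] [NormedAddCommGroup F]
  [NormedSpace ℝ F] {i : Fin 3}

theorem IsSmooth.hasWeakDeriv {h : Slab → ℝ} (hh : IsSmooth h) (i : Fin 3) :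
    HasWeakDeriv i h (pderiv i h) := by
  refine ⟨hh.continuous.locallyIntegrable, (hh.smooth_pderiv i).continuous.locallyIntegrable,
    fun η hη => ?_⟩
  have h1 := (hη.mul_smooth hh).integral_pderiv i
  have h2 : ∀ x, pderiv i (fun x => η x * h x) x = pderiv i η x • h x + η x • pderiv i h x :=
    fun x => hη.isSmooth.pderiv_mul hh i x
  simp only [h2] at h1
  rw [integral_add ((hη.test_pderiv i).integrable_smul hh.continuous.locallyIntegrable)
    (hη.integrable_smul (hh.smooth_pderiv i).continuous.locallyIntegrable)] at h1
  exact eq_neg_of_add_eq_zero_left h1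

theorem HasWeakDeriv.smul_smooth {f g : Slab → E} (hf : HasWeakDeriv i f g) {h : Slab → ℝ}
    (hh : IsSmooth h) :
    HasWeakDeriv i (fun x => h x • f x) (fun x => pderiv i h x • f x + h x • g x) := by
  have l1 : LocallyIntegrable fun x => pderiv i h x • f x :=
    hf.1.continuous_smul (hh.smooth_pderiv i).continuous
  have l2 : LocallyIntegrable fun x => h x • g x := hf.2.1.continuous_smul hh.continuous
  have l3 : LocallyIntegrable fun x => h x • f x := hf.1.continuous_smul hh.continuous
  refine ⟨l3, l1.add l2, fun η hη => ?_⟩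
  have h1 := hf.2.2 _ (hη.mul_smooth hh)
  have h2 : ∀ x, pderiv i (fun x => η x * h x) x = pderiv i η x * h x + η x * pderiv i h x :=
    fun x => hη.isSmooth.pderiv_mul hh i x
  simp only [h2, add_smul, mul_smul, smul_add] at h1 ⊢
  rw [integral_add ((hη.test_pderiv i).integrable_smul l3) (hη.integrable_smul l1)] at h1
  rw [integral_add (hη.integrable_smul l1) (hη.integrable_smul l2), neg_add_rev]
  rw [← h1]; abel

theorem HasWeakDeriv.add {f g f' g' : Slab → E} (hf : HasWeakDeriv i f g)
    (hf' : HasWeakDeriv i f' g') :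
    HasWeakDeriv i (fun x => f x + f' x) (fun x => g x + g' x) := by
  refine ⟨hf.1.add hf'.1, hf.2.1.add hf'.2.1, fun η hη => ?_⟩
  simp only [smul_add]
  rw [integral_add ((hη.test_pderiv i).integrable_smul hf.1) ((hη.test_pderiv i).integrable_smul hf'.1),
    integral_add (hη.integrable_smul hf.2.1) (hη.integrable_smul hf'.2.1), hf.2.2 η hη,
    hf'.2.2 η hη, neg_add]

theorem locallyIntegrable_clm_comp (L : E →L[ℝ] F) {f : Slab → E} (hf : LocallyIntegrable f) :
    LocallyIntegrable fun x => L (f x) := fun x => by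
  obtain ⟨s, hs, h⟩ := hf x
  exact ⟨s, hs, L.integrable_comp h⟩

theorem HasWeakDeriv.clm_comp [CompleteSpace E] [CompleteSpace F] {f g : Slab → E}
    (hf : HasWeakDeriv i f g) (L : E →L[ℝ] F) :
    HasWeakDeriv i (fun x => L (f x)) (fun x => L (g x)) := by
  refine ⟨locallyIntegrable_clm_comp L hf.1, locallyIntegrable_clm_comp L hf.2.1,
    fun η hη => ?_⟩
  simp only [← map_smul]
  rw [L.integral_comp_comm ((hη.test_pderiv i).integrable_smul hf.1),
    L.integral_comp_comm (hη.integrable_smul hf.2.1), hf.2.2 η hη, map_neg]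

theorem HasWeakDeriv.congr {f g f' g' : Slab → E} (hf : HasWeakDeriv i f g)
    (h1 : f =ᵐ[volume] f') (h2 : g =ᵐ[volume] g') : HasWeakDeriv i f' g' := by
  refine ⟨hf.1.congr h1, hf.2.1.congr h2, fun η hη => ?_⟩
  have e1 : ∫ x, pderiv i η x • f' x = ∫ x, pderiv i η x • f x :=
    integral_congr_ae (by filter_upwards [h1] with x hx; rw [hx])
  have e2 : ∫ x, η x • g' x = ∫ x, η x • g x :=
    integral_congr_ae (by filter_upwards [h2] with x hx; rw [hx])
  rw [e1, e2, hf.2.2 η hη]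

theorem HasWeakDeriv.translate {f g : Slab → E} (hf : HasWeakDeriv i f g) (a : Slab) :
    HasWeakDeriv i (fun x => f (x + a)) (fun x => g (x + a)) := by
  have hl : ∀ {u : Slab → E}, LocallyIntegrable u → LocallyIntegrable fun x => u (x + a) := by
    intro u hu x
    obtain ⟨s, hs, h⟩ := hu (x + a)
    refine ⟨(fun x => x + a) ⁻¹' s,
      (continuous_id.add continuous_const).continuousAt.preimage_mem_nhds hs, ?_⟩
    exact ((measurePreserving_add_right volume a).integrableOn_comp_preimage
      (MeasurableEquiv.addRight a).measurableEmbedding).2 h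
  refine ⟨hl hf.1, hl hf.2.1, fun η hη => ?_⟩
  have h1 := hf.2.2 _ (hη.translate (-a))
  have e1 := integral_add_right_eq_self (μ := (volume : Measure Slab))
    (fun x => pderiv i (fun x => η (x + -a)) x • f x) a
  have e2 := integral_add_right_eq_self (μ := (volume : Measure Slab))
    (fun x => η (x + -a) • g x) a
  simp only [pderiv_translate, add_neg_cancel_right] at e1 e2 h1
  rw [e1, e2, h1]

end WeakCalculus

/-! ### Uniqueness of distributional derivatives -/

/-- Trigonometric polynomials are dense in C(𝕋), and c ↦ ∫ c g is bounded for the sup norm. -/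
theorem integral_continuousMap_mul_eq_zero {g : UnitAddCircle → ℂ} (hg : Integrable g)
    (h : ∀ n : ℤ, ∫ t, fourier n t * g t = 0) (c : C(UnitAddCircle, ℂ)) :
    ∫ t, c t * g t = 0 := by
  have hint : ∀ c : C(UnitAddCircle, ℂ), Integrable fun t => c t * g t := fun c =>
    hg.bdd_mul c.continuous.aestronglyMeasurable (c := ‖c‖)
      (Filter.Eventually.of_forall fun t => c.norm_coe_le_norm t)
  let L : C(UnitAddCircle, ℂ) →ₗ[ℂ] ℂ :=
    { toFun := fun c => ∫ t, c t * g t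
      map_add' := fun a b => by
        simp only [ContinuousMap.add_apply, add_mul]
        exact integral_add (hint a) (hint b)
      map_smul' := fun r a => by
        simp only [ContinuousMap.smul_apply, smul_eq_mul, mul_assoc, RingHom.id_apply]
        exact integral_const_mul r _ }
  let L' : C(UnitAddCircle, ℂ) →L[ℂ] ℂ := L.mkContinuous (∫ t, ‖g t‖) fun c => by
    refine (norm_integral_le_integral_norm _).trans ?_
    rw [mul_comm, ← integral_const_mul]
    refine integral_mono (hint c).norm (hg.norm.const_mul _) fun t => ?_
    simp only [norm_mul]
    gcongr
    exact c.norm_coe_le_norm t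
  have h1 : Submodule.span ℂ (Set.range (@fourier 1)) ≤ L'.ker := by
    rw [Submodule.span_le]
    rintro _ ⟨n, rfl⟩
    exact h n
  have h2 := Submodule.topologicalClosure_minimal _ h1 L'.isClosed_ker
  rw [span_fourier_closure_eq_top] at h2
  exact h2 (Submodule.mem_top (x := c))

/-- Indicators of closed sets are bounded pointwise limits of continuous functions, so the integral
of g over every closed set vanishes. -/
theorem ae_eq_zero_of_integral_fourier_mul {g : UnitAddCircle → ℂ} (hg : Integrable g)
    (h : ∀ n : ℤ, ∫ t, fourier n t * g t = 0) : g =ᵐ[volume] 0 := by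
  refine ae_eq_zero_of_forall_setIntegral_isClosed_eq_zero hg fun s hs => ?_
  have hpos : ∀ n : ℕ, (0 : ℝ) < 1 / (n + 1) := fun n => Nat.one_div_pos_of_nat
  let c : ℕ → C(UnitAddCircle, ℂ) := fun n =>
    ⟨fun t => ((thickenedIndicator (hpos n) s t : ℝ) : ℂ), by fun_prop⟩
  have h0 : ∀ n, ∫ t, c n t * g t = 0 := fun n => integral_continuousMap_mul_eq_zero hg h (c n)
  have hlim : Filter.Tendsto (fun n => ∫ t, c n t * g t) Filter.atTop (𝓝 (∫ t in s, g t)) := by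
    rw [← integral_indicator hs.measurableSet]
    refine tendsto_integral_of_dominated_convergence (fun t => ‖g t‖) ?_ hg.norm ?_ ?_
    · exact fun n => (c n).continuous.aestronglyMeasurable.mul hg.1
    · refine fun n => Filter.Eventually.of_forall fun t => ?_
      rw [norm_mul]
      have : ‖c n t‖ ≤ 1 := by
        simp only [c, ContinuousMap.coe_mk, Complex.norm_real, Real.norm_eq_abs, NNReal.abs_eq]
        exact_mod_cast thickenedIndicator_le_one (hpos n) s t
      exact mul_le_of_le_one_left (norm_nonneg _) this
    · refine Filter.Eventually.of_forall fun t => ?_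
      have h1 := tendsto_pi_nhds.1 (thickenedIndicator_tendsto_indicator_closure hpos
        tendsto_one_div_add_atTop_nhds_zero_nat s) t
      rw [hs.closure_eq] at h1
      have h2 : Filter.Tendsto (fun n => c n t) Filter.atTop
          (𝓝 (((s.indicator (fun _ => (1 : NNReal)) t : NNReal) : ℝ) : ℂ)) :=
        (Complex.continuous_ofReal.tendsto _).comp
          ((NNReal.continuous_coe.tendsto _).comp h1)
      have h3 := h2.mul_const (g t)
      convert! h3 using 2
      by_cases ht : t ∈ s <;> simp [ht]
  simp only [h0] at hlim
  exact (tendsto_nhds_unique hlim tendsto_const_nhds)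

theorem contDiff_character_cover (k : Freq) : ContDiff ℝ ∞ fun p => character k (cover p) := by
  simp only [character, cover, fourier_coe_apply]
  have h1 : ContDiff ℝ ∞ fun p : ℝ × ℝ × ℝ => (p.1 : ℂ) :=
    Complex.ofRealCLM.contDiff.comp contDiff_fst
  have h2 : ContDiff ℝ ∞ fun p : ℝ × ℝ × ℝ => ((k.2.1 * p.2.1 + k.2.2 * p.2.2 : ℝ) : ℂ) :=
    Complex.ofRealCLM.contDiff.comp ((contDiff_const.mul contDiff_snd.fst).add
      (contDiff_const.mul contDiff_snd.snd))
  exact ContDiff.mul (ContDiff.cexp ((contDiff_const.mul h1).div_const _))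
    (ContDiff.cexp (contDiff_const.mul h2))

theorem isSmooth_character_re (k : Freq) : IsSmooth fun x => (character k x).re :=
  Complex.reCLM.contDiff.comp (contDiff_character_cover k)

theorem isSmooth_character_im (k : Freq) : IsSmooth fun x => (character k x).im :=
  Complex.imCLM.contDiff.comp (contDiff_character_cover k)

theorem isTest_comp_snd {v : ℝ × ℝ → ℝ} (hv : ContDiff ℝ ∞ v) (hc : HasCompactSupport v) :
    IsTest fun x => v x.2 := by
  refine ⟨IsSmooth.comp_snd hv, HasCompactSupport.intro (isCompact_univ.prod hc.isCompact)
    fun x hx => ?_⟩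
  by_contra h
  exact hx ⟨Set.mem_univ _, subset_tsupport _ h⟩

theorem character_circle (n : ℤ) (x : Slab) : character (n, 0) x = fourier n x.1 := by
  simp [character]

/-- The du Bois-Reymond lemma on the slab. -/
theorem ae_eq_zero_of_integral_test_smul {F : Slab → ℂ} (hF : LocallyIntegrable F)
    (h : ∀ η : Slab → ℝ, IsTest η → ∫ x, η x • F x = 0) : F =ᵐ[volume] 0 := by
  -- The cutoff `v` makes `v • F` integrable. Each of its circle coefficients, as a function on the
  -- plane, is killed by all plane test functions `w`: the real and imaginary parts of `w` times a
  -- character are slab test functions up to the factor `v`. Uniqueness of Fourier coefficients on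
  -- fibres finishes.
  have key : ∀ v : ℝ × ℝ → ℝ, ContDiff ℝ ∞ v → HasCompactSupport v →
      ∀ᵐ x : Slab, v x.2 • F x = 0 := by
    intro v hv hvc
    set G : Slab → ℂ := fun x => v x.2 • F x with hG
    have hGi : Integrable G := (isTest_comp_snd hv hvc).integrable_smul hF
    have h1 : ∀ n : ℤ, ∀ᵐ y, slice G n y = 0 := by
      intro n
      refine ae_eq_zero_of_integral_contDiff_smul_eq_zero
        (integrable_slice hGi n).locallyIntegrable fun w hw hwc => ?_
      have ht := isTest_comp_snd (hw.mul hv) (hvc.mul_left (f := w))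
      have hre := ht.mul_smooth (isSmooth_character_re (n, 0))
      have him := ht.mul_smooth (isSmooth_character_im (n, 0))
      have e1 : ∀ x : Slab, (fourier n x.1 : ℂ) * (w x.2 • G x)
          = ((w x.2 * v x.2) * (character (n, 0) x).re) • F x
            + Complex.I * (((w x.2 * v x.2) * (character (n, 0) x).im) • F x) := by
        intro x
        rw [character_circle, hG]
        conv_lhs => rw [← Complex.re_add_im (fourier n x.1 : ℂ)]
        simp only [Complex.real_smul]; push_cast; ring
      have e2 : ∫ x : Slab, (fourier n x.1 : ℂ) * (w x.2 • G x) = 0 := by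
        simp only [e1]
        rw [integral_add (hre.integrable_smul hF) ((him.integrable_smul hF).const_mul _),
          integral_const_mul, h _ hre, h _ him]
        simp
      have hwG : Integrable fun x : Slab => w x.2 • G x :=
        (isTest_comp_snd hw hwc).integrable_smul hGi.locallyIntegrable
      have e3 := integral_prod_symm (μ := (volume : Measure UnitAddCircle))
        (ν := (volume : Measure (ℝ × ℝ))) _ (integrable_fourier_fst_mul hwG n)
      rw [← e2]
      refine Eq.trans ?_ e3.symm
      refine integral_congr_ae (Filter.Eventually.of_forall fun y => ?_)
      simp only [slice]
      rw [← integral_smul]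
      refine integral_congr_ae (Filter.Eventually.of_forall fun t => ?_)
      simp only [Complex.real_smul]; ring
    have h2 : ∀ᵐ y : ℝ × ℝ, ∫ t : UnitAddCircle, ‖G (t, y)‖ = 0 := by
      have h3 : ∀ᵐ y : ℝ × ℝ, Integrable fun t : UnitAddCircle => G (t, y) := hGi.prod_left_ae
      filter_upwards [ae_all_iff.2 h1, h3] with y hy1 hy2
      have := ae_eq_zero_of_integral_fourier_mul hy2 hy1
      rw [integral_congr_ae (g := fun _ => (0 : ℝ)) (by
        filter_upwards [this] with t ht
        rw [ht]; simp)]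
      simp
    have h3 : ∫ x, ‖G x‖ = 0 := by
      refine (integral_prod_symm (μ := (volume : Measure UnitAddCircle))
        (ν := (volume : Measure (ℝ × ℝ))) _ hGi.norm).trans ?_
      rw [integral_congr_ae h2]; simp
    rw [integral_eq_zero_iff_of_nonneg (fun x => norm_nonneg _) hGi.norm] at h3
    filter_upwards [h3] with x hx
    exact norm_eq_zero.1 hx
  -- Bumps equal to 1 on balls that exhaust the plane remove the cutoff.
  let b : ℕ → ContDiffBump (0 : ℝ × ℝ) := fun N => ⟨N + 1, N + 2, by positivity, by linarith⟩
  have := ae_all_iff.2 fun N => key (b N) (b N).contDiff (b N).hasCompactSupport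
  filter_upwards [this] with x hx
  obtain ⟨N, hN⟩ := exists_nat_ge ‖x.2‖
  have h1 : b N x.2 = 1 := (b N).one_of_mem_closedBall (by
    rw [mem_closedBall_zero_iff]
    exact hN.trans (by simp [b]))
  simpa [h1] using hx N

theorem ae_eq_zero_of_integral_test_smul_real {F : Slab → ℝ} (hF : LocallyIntegrable F)
    (h : ∀ η : Slab → ℝ, IsTest η → ∫ x, η x • F x = 0) : F =ᵐ[volume] 0 := by
  have := ae_eq_zero_of_integral_test_smul (F := fun x => (F x : ℂ))
    (locallyIntegrable_clm_comp Complex.ofRealCLM hF) fun η hη => by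
      have h1 : ∀ x, η x • (F x : ℂ) = ((η x • F x : ℝ) : ℂ) := fun x => by simp
      simp only [h1]
      rw [integral_complex_ofReal, h η hη]; simp
  filter_upwards [this] with x hx
  exact Complex.ofReal_eq_zero.1 hx

theorem HasWeakDeriv.unique {i : Fin 3} {f g g' : Slab → ℂ} (h : HasWeakDeriv i f g)
    (h' : HasWeakDeriv i f g') : g =ᵐ[volume] g' := by
  have := ae_eq_zero_of_integral_test_smul (F := fun x => g x - g' x) (h.2.1.sub h'.2.1)
    fun η hη => by
      simp only [smul_sub]
      rw [integral_sub (hη.integrable_smul h.2.1) (hη.integrable_smul h'.2.1)]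
      rw [← neg_eq_iff_eq_neg.2 (h.2.2 η hη), ← neg_eq_iff_eq_neg.2 (h'.2.2 η hη), sub_self]
  filter_upwards [this] with x hx
  exact sub_eq_zero.1 hx

theorem HasWeakDeriv.unique_real {i : Fin 3} {f g g' : Slab → ℝ} (h : HasWeakDeriv i f g)
    (h' : HasWeakDeriv i f g') : g =ᵐ[volume] g' := by
  have := ae_eq_zero_of_integral_test_smul_real (F := fun x => g x - g' x) (h.2.1.sub h'.2.1)
    fun η hη => by
      simp only [smul_sub]
      rw [integral_sub (hη.integrable_smul h.2.1) (hη.integrable_smul h'.2.1)]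
      rw [← neg_eq_iff_eq_neg.2 (h.2.2 η hη), ← neg_eq_iff_eq_neg.2 (h'.2.2 η hη), sub_self]
  filter_upwards [this] with x hx
  exact sub_eq_zero.1 hx

theorem hasWeakDeriv_weakDeriv {E : Type*} [NormedAddCommGroup E] [NormedSpace ℝ E] {i : Fin 3}
    {f : Slab → E} (h : ∃ g, HasWeakDeriv i f g) : HasWeakDeriv i f (weakDeriv i f) := by
  rw [weakDeriv, dif_pos h]; exact h.choose_spec

theorem HasWeakDeriv.weakDeriv_ae_eq {i : Fin 3} {f g : Slab → ℂ} (h : HasWeakDeriv i f g) :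
    weakDeriv i f =ᵐ[volume] g := (hasWeakDeriv_weakDeriv ⟨g, h⟩).unique h

theorem HasWeakDeriv.weakDeriv_ae_eq_real {i : Fin 3} {f g : Slab → ℝ} (h : HasWeakDeriv i f g) :
    weakDeriv i f =ᵐ[volume] g := (hasWeakDeriv_weakDeriv ⟨g, h⟩).unique_real h

/-! ### Weak derivatives and the Fourier transform -/

theorem hasDerivAt_character_axis (k : Freq) (i : Fin 3) (x : Slab) :
    HasDerivAt (fun s : ℝ => character k (x + axis i s))
      (Complex.I * wave i k * character k x) 0 := by
  simp only [character_add, character_axis]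
  have h1 : HasDerivAt (fun s : ℝ => Complex.I * ((wave i k * s : ℝ) : ℂ))
      (Complex.I * wave i k) 0 := by
    have := ((hasDerivAt_id (0 : ℝ)).const_mul (wave i k)).ofReal_comp.const_mul Complex.I
    simpa using this
  have h2 := h1.cexp.const_mul (character k x)
  simp only [mul_zero, Complex.ofReal_zero, Complex.exp_zero, one_mul] at h2
  rwa [mul_comm (character k x)] at h2

theorem hasWeakDeriv_character (k : Freq) (i : Fin 3) :
    HasWeakDeriv i (character k) fun x => Complex.I * wave i k * character k x := by
  have hre := ((isSmooth_character_re k).hasWeakDeriv i).clm_comp Complex.ofRealCLM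
  have him := ((isSmooth_character_im k).hasWeakDeriv i).clm_comp
    (Complex.I • Complex.ofRealCLM)
  have h1 : ∀ x, pderiv i (fun x => (character k x).re) x
      = (Complex.I * wave i k * character k x).re := fun x =>
    ((Complex.reCLM.hasFDerivAt.comp_hasDerivAt _ (hasDerivAt_character_axis k i x))).deriv
  have h2 : ∀ x, pderiv i (fun x => (character k x).im) x
      = (Complex.I * wave i k * character k x).im := fun x =>
    ((Complex.imCLM.hasFDerivAt.comp_hasDerivAt _ (hasDerivAt_character_axis k i x))).deriv
  have h3 := hre.add him
  refine h3.congr (Filter.Eventually.of_forall fun x => ?_) (Filter.Eventually.of_forall fun x => ?_)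
  · simp only [Complex.ofRealCLM_apply, _root_.smul_apply, smul_eq_mul]
    rw [mul_comm Complex.I, Complex.re_add_im]
  · simp only [Complex.ofRealCLM_apply, _root_.smul_apply, smul_eq_mul, h1, h2]
    refine Eq.trans ?_ (Complex.re_add_im _)
    ring

/-- The Fourier transform of a real integrable function. -/
abbrev FTr (f : Slab → ℝ) : Freq → ℂ := FT fun x => (f x : ℂ)

/-- This is the weak derivative of the character tested against η; no separate integration by parts
is required. -/
theorem FTr_pderiv {η : Slab → ℝ} (hη : IsTest η) (i : Fin 3) (k : Freq) :
    FTr (pderiv i η) k = -(Complex.I * wave i k) * FTr η k := by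
  have h := (hasWeakDeriv_character k i).2.2 η hη
  simp only [FT]
  rw [mul_left_comm, neg_mul, ← integral_const_mul (Complex.I * wave i k)]
  refine congrArg _ (Eq.trans ?_ (h.trans ?_))
  · refine integral_congr_ae (Filter.Eventually.of_forall fun x => ?_)
    simp [mul_comm]
  · rw [neg_inj]
    refine integral_congr_ae (Filter.Eventually.of_forall fun x => ?_)
    simp only [Complex.real_smul]; ring

theorem IsTest.integrable_ofReal {η : Slab → ℝ} (hη : IsTest η) :
    Integrable fun x => (η x : ℂ) := hη.integrable.ofReal

theorem IsTest.memLp_ofReal {η : Slab → ℝ} (hη : IsTest η) :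
    MemLp (fun x => (η x : ℂ)) 2 := (hη.memLp 2).ofReal

theorem integral_test_smul {η : Slab → ℝ} (hη : IsTest η) {f : Slab → ℂ} (hf : MemLp f 2) :
    ∫ x, η x • f x = ∫ k, conj (FTr η k) * F2 f k ∂νF := by
  have h := integral_conj_mul_F2 hη.memLp_ofReal hf
  have e1 : ∫ x, conj ((η x : ℂ)) * f x = ∫ x, η x • f x := by
    simp [Complex.real_smul]
  rw [← e1, ← h]
  refine integral_congr_ae ?_
  filter_upwards [F2_ae_eq hη.integrable_ofReal hη.memLp_ofReal] with k hk
  rw [hk]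

/-- The bracket `(1 + |k|²)^{1/2}`. -/
def bracket (k : Freq) : ℝ := Real.sqrt (1 + waveSq k)

theorem bracket_pos (k : Freq) : 0 < bracket k :=
  Real.sqrt_pos.2 (by linarith [waveSq_nonneg k])

theorem bracket_sq (k : Freq) : bracket k ^ 2 = 1 + waveSq k :=
  Real.sq_sqrt (by linarith [waveSq_nonneg k])

theorem continuous_bracket : Continuous bracket :=
  Real.continuous_sqrt.comp (continuous_const.add continuous_waveSq)

theorem continuous_bracket_inv : Continuous fun k => (bracket k : ℂ)⁻¹ :=
  (Complex.continuous_ofReal.comp continuous_bracket).inv₀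
    fun k => Complex.ofReal_ne_zero.2 (bracket_pos k).ne'

theorem sq_wave_le (j : Fin 3) (k : Freq) : wave j k ^ 2 ≤ waveSq k := by
  rw [waveSq_eq_sum]
  exact Finset.single_le_sum (f := fun j => wave j k ^ 2) (fun i _ => sq_nonneg _)
    (Finset.mem_univ j)

theorem abs_wave_le_bracket (j : Fin 3) (k : Freq) : |wave j k| ≤ bracket k := by
  refine abs_le_of_sq_le_sq ?_ (bracket_pos k).le
  rw [bracket_sq]; linarith [sq_wave_le j k]

theorem bracket_le (k : Freq) : bracket k ≤ 1 + ∑ j, |wave j k| := by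
  have h0 : ∀ j, 0 ≤ |wave j k| := fun j => abs_nonneg _
  refine Real.sqrt_le_iff.2 ⟨by positivity, ?_⟩
  rw [waveSq_eq_sum]
  simp only [Fin.sum_univ_three]
  have := h0 0; have := h0 1; have := h0 2
  nlinarith [mul_nonneg (h0 0) (h0 1), mul_nonneg (h0 0) (h0 2), mul_nonneg (h0 1) (h0 2),
    sq_abs (wave 0 k), sq_abs (wave 1 k), sq_abs (wave 2 k)]

theorem IsTest.norm_bracket_mul_FTr_le {η : Slab → ℝ} (hη : IsTest η) (k : Freq) :
    ‖(bracket k : ℂ) * FTr η k‖ ≤ ‖FTr η k‖ + ∑ j, ‖FTr (pderiv j η) k‖ := by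
  rw [norm_mul, Complex.norm_real, Real.norm_of_nonneg (bracket_pos k).le]
  refine (mul_le_mul_of_nonneg_right (bracket_le k) (norm_nonneg _)).trans (le_of_eq ?_)
  rw [add_mul, one_mul, Finset.sum_mul]
  congr 1
  refine Finset.sum_congr rfl fun j _ => ?_
  rw [FTr_pderiv hη, norm_mul, norm_neg, norm_mul]
  simp

theorem IsTest.memLp_FTr {η : Slab → ℝ} (hη : IsTest η) : MemLp (FTr η) 2 νF :=
  memLp_FT hη.integrable_ofReal hη.memLp_ofReal

theorem IsTest.continuous_FTr {η : Slab → ℝ} (hη : IsTest η) : Continuous (FTr η) :=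
  continuous_FT hη.integrable_ofReal

theorem IsTest.memLp_bracket_mul_FTr {η : Slab → ℝ} (hη : IsTest η) :
    MemLp (fun k => (bracket k : ℂ) * FTr η k) 2 νF := by
  have h1 : MemLp (fun k => ‖FTr η k‖ + ∑ j, ‖FTr (pderiv j η) k‖) 2 νF :=
    hη.memLp_FTr.norm.add (memLp_finsetSum _ fun j _ => (hη.test_pderiv j).memLp_FTr.norm)
  refine h1.mono ((Complex.continuous_ofReal.comp continuous_bracket).mul
    hη.continuous_FTr).aestronglyMeasurable (Filter.Eventually.of_forall fun k => ?_)
  exact (hη.norm_bracket_mul_FTr_le k).trans (Real.le_norm_self _)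

theorem IsTest.exists_bound_bracket_mul_FTr {η : Slab → ℝ} (hη : IsTest η) :
    ∃ C, ∀ k, ‖(bracket k : ℂ) * FTr η k‖ ≤ C := by
  refine ⟨(2 * Real.pi)⁻¹ * (∫ x, ‖(η x : ℂ)‖) +
    ∑ j, (2 * Real.pi)⁻¹ * ∫ x, ‖(pderiv j η x : ℂ)‖, fun k => ?_⟩
  refine (hη.norm_bracket_mul_FTr_le k).trans ?_
  gcongr <;> exact norm_FT_le _ _

/-- On the support of the bump the phase has modulus at most 1, so its cosine is at least 1/2 and
the real part of the integral is positive. -/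
theorem planeFT_bump_ne_zero (b : ContDiffBump (0 : ℝ × ℝ)) {ξ : ℝ × ℝ}
    (h : 2 * ‖ξ‖ * b.rOut ≤ 1) : planeFT (fun y => (b y : ℂ)) ξ ≠ 0 := by
  have hbi : Integrable (b : ℝ × ℝ → ℝ) := b.continuous.integrable_of_hasCompactSupport
    b.hasCompactSupport
  rw [planeFT]
  refine mul_ne_zero (by simp [Real.pi_ne_zero]) fun h0 => ?_
  have hcexp : Continuous fun y : ℝ × ℝ =>
      Complex.exp (Complex.I * ((ξ.1 * y.1 + ξ.2 * y.2 : ℝ) : ℂ)) := by fun_prop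
  have hi : Integrable fun y : ℝ × ℝ =>
      Complex.exp (Complex.I * ((ξ.1 * y.1 + ξ.2 * y.2 : ℝ) : ℂ)) * (b y : ℂ) :=
    hbi.ofReal.bdd_mul hcexp.aestronglyMeasurable (c := 1)
      (Filter.Eventually.of_forall fun y => (norm_exp_I _).le)
  have h1 := congrArg Complex.re h0
  have e1 := integral_re hi
  simp only [RCLike.re_to_complex] at e1
  rw [← e1] at h1
  have e2 : ∀ y : ℝ × ℝ,
      (Complex.exp (Complex.I * ((ξ.1 * y.1 + ξ.2 * y.2 : ℝ) : ℂ)) * (b y : ℂ)).re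
        = Real.cos (ξ.1 * y.1 + ξ.2 * y.2) * b y := by
    intro y
    rw [mul_comm Complex.I, Complex.re_mul_ofReal, Complex.exp_ofReal_mul_I_re]
  simp only [e2] at h1
  have hcos : ∀ y : ℝ × ℝ, b y ≠ 0 → 1 / 2 ≤ Real.cos (ξ.1 * y.1 + ξ.2 * y.2) := by
    intro y hy
    have hy1 : ‖y‖ < b.rOut := by
      have : y ∈ Function.support b := hy
      rw [b.support_eq, mem_ball_zero_iff] at this
      exact this
    have hs : |ξ.1 * y.1 + ξ.2 * y.2| ≤ 1 := by
      have a1 : |ξ.1| ≤ ‖ξ‖ := norm_fst_le ξ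
      have a2 : |ξ.2| ≤ ‖ξ‖ := norm_snd_le ξ
      have a3 : |y.1| ≤ ‖y‖ := norm_fst_le y
      have a4 : |y.2| ≤ ‖y‖ := norm_snd_le y
      calc |ξ.1 * y.1 + ξ.2 * y.2| ≤ |ξ.1| * |y.1| + |ξ.2| * |y.2| := by
            rw [← abs_mul, ← abs_mul]; exact abs_add_le _ _
        _ ≤ ‖ξ‖ * ‖y‖ + ‖ξ‖ * ‖y‖ := by gcongr
        _ ≤ ‖ξ‖ * b.rOut + ‖ξ‖ * b.rOut := by gcongr
        _ ≤ 1 := by linarith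
    have := Real.one_sub_sq_div_two_le_cos (x := ξ.1 * y.1 + ξ.2 * y.2)
    have h2 : (ξ.1 * y.1 + ξ.2 * y.2) ^ 2 ≤ 1 := by
      rw [← sq_abs]; exact pow_le_one₀ (abs_nonneg _) hs
    linarith
  have hpos : 0 < ∫ y, (1 / 2 : ℝ) * b y := by
    rw [integral_const_mul]
    exact mul_pos (by norm_num) (b.integral_pos)
  have hle : ∫ y, (1 / 2 : ℝ) * b y ≤ ∫ y : ℝ × ℝ, Real.cos (ξ.1 * y.1 + ξ.2 * y.2) * b y := by
    refine integral_mono (hbi.const_mul _) ?_ fun y => ?_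
    · have := hi.re
      simpa only [RCLike.re_to_complex, e2] using this
    · by_cases hy : b y = 0
      · simp [hy]
      · exact mul_le_mul_of_nonneg_right (hcos y hy) b.nonneg
  rw [h1] at hle
  simp only [Complex.zero_re] at hle
  linarith

/-- A countable family of test functions whose Fourier transforms have no common zero. -/
theorem exists_test_family : ∃ η : ℤ × ℕ → Slab → ℝ, (∀ i, IsTest (η i)) ∧
    ∀ k, ∃ i, FTr (η i) k ≠ 0 := by
  -- The outer radius 1/(2(N+1)) keeps the phase below 1 for all frequencies with ‖ξ‖ ≤ N.
  let b : ℕ → ContDiffBump (0 : ℝ × ℝ) := fun N =>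
    ⟨1 / (4 * (N + 1)), 1 / (2 * (N + 1)), by positivity, by gcongr; norm_num⟩
  refine ⟨fun i x => b i.2 x.2 * (character (i.1, 0) x).re, fun i =>
    (isTest_comp_snd (b i.2).contDiff (b i.2).hasCompactSupport).mul_smooth
      (isSmooth_character_re _), fun k => ?_⟩
  obtain ⟨N, hN⟩ := exists_nat_ge ‖k.2‖
  refine ⟨(k.1, N), ?_⟩
  have hb : planeFT (fun y => (b N y : ℂ)) k.2 ≠ 0 := by
    refine planeFT_bump_ne_zero (b N) ?_
    have h1 : (b N).rOut = 1 / (2 * (N + 1)) := rfl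
    rw [h1, mul_one_div, div_le_one (by positivity)]
    linarith
  have hbt : IsTest fun x : Slab => b N x.2 :=
    isTest_comp_snd (b N).contDiff (b N).hasCompactSupport
  have hi : ∀ n : ℤ, Integrable fun x : Slab => (fourier n x.1 : ℂ) * (b N x.2 : ℂ) := fun n =>
    integrable_fourier_fst_mul hbt.integrable_ofReal n
  -- Taking the real part of a character couples the modes n and -n. Their contributions carry the
  -- same sign, so they cannot cancel, and for n = 0 they add up.
  have e1 : (fun x : Slab => ((b N x.2 * (character (k.1, 0) x).re : ℝ) : ℂ))
      = fun x : Slab => (1 / 2 : ℂ) * ((fourier (-k.1) x.1 : ℂ) * (b N x.2 : ℂ)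
          + (fourier (-(-k.1)) x.1 : ℂ) * (b N x.2 : ℂ)) := by
    ext x
    rw [character_circle, neg_neg, fourier_neg]
    push_cast
    rw [Complex.re_eq_add_conj]; ring
  simp only [FTr]
  rw [e1, FT_const_mul, FT_add (hi _) (hi _)]
  obtain ⟨n, ξ⟩ := k
  rw [FT_circle_mul n (fun y => (b N y : ℂ)), FT_circle_mul (-n) (fun y => (b N y : ℂ))]
  simp only [if_true]
  refine mul_ne_zero (by norm_num) ?_
  split_ifs with h
  · rw [← two_mul]; exact mul_ne_zero two_ne_zero hb
  · simpa using hb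

/-- A function of moderate growth on the dual group which annihilates the Fourier transforms of all
test functions vanishes. -/
theorem ae_eq_zero_of_integral_conj_FTr_mul {H : Freq → ℂ}
    (hH : MemLp (fun k => (bracket k : ℂ)⁻¹ * H k) 2 νF)
    (h : ∀ η : Slab → ℝ, IsTest η → ∫ k, conj (FTr η k) * H k ∂νF = 0) : H =ᵐ[νF] 0 := by
  have hne : ∀ k, (bracket k : ℂ) ≠ 0 := fun k => by exact_mod_cast (bracket_pos k).ne'
  have key : ∀ η : Slab → ℝ, IsTest η → ∀ᵐ k ∂νF, conj (FTr η k) * H k = 0 := by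
    intro η hη
    set Q : Freq → ℂ := fun k => conj (FTr η k) * H k with hQ
    -- One factor `bracket` is shifted from `H` to the test function, whose transform absorbs it.
    -- This places `Q` in L¹ ∩ L², where inversion is available.
    have hQe : Q = fun k => conj ((bracket k : ℂ) * FTr η k) * ((bracket k : ℂ)⁻¹ * H k) := by
      ext k
      simp only [hQ, map_mul, Complex.conj_ofReal]
      field_simp [hne k]
    have hc : Continuous fun k => conj ((bracket k : ℂ) * FTr η k) :=
      Complex.continuous_conj.comp
        ((Complex.continuous_ofReal.comp continuous_bracket).mul hη.continuous_FTr)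
    have hQ1 : Integrable Q νF := by
      rw [hQe]
      exact MemLp.integrable_mul (p := 2) (q := 2) hη.memLp_bracket_mul_FTr.star hH
    have hQ2 : MemLp Q 2 νF := by
      obtain ⟨C, hC⟩ := hη.exists_bound_bracket_mul_FTr
      rw [hQe]
      refine (hH.norm.const_mul C).mono (hc.aestronglyMeasurable.mul hH.1)
        (Filter.Eventually.of_forall fun k => ?_)
      rw [norm_mul, RCLike.norm_conj]
      refine (mul_le_mul_of_nonneg_right (hC k) (norm_nonneg _)).trans ?_
      exact Real.le_norm_self _
    -- Translating η multiplies its transform by a character, so the hypothesis for all translates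
    -- says that the inverse transform of `Q` vanishes at every point.
    have hI : IFT Q = 0 := by
      ext a
      have h1 := h _ (hη.translate (-a))
      have h2 : ∀ k, FTr (fun x => η (x + -a)) k = character k a * FTr η k := by
        intro k
        have h3 := FT_translate (fun x => (η x : ℂ)) (-a) k
        refine h3.trans ?_
        congr 1
        have h4 := character_add k a (-a)
        rw [add_neg_cancel] at h4
        have h5 : character k 0 = 1 := by simp [character]
        have h6 : character k a * conj (character k a) = 1 := by
          rw [Complex.mul_conj, Complex.normSq_eq_norm_sq, norm_character]; simp
        have h7 : character k a ≠ 0 := by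
          rw [← norm_ne_zero_iff]; simp
        have h8 : character k (-a) = conj (character k a) :=
          mul_left_cancel₀ h7 (by rw [← h4, h5, h6])
        rw [h8, Complex.conj_conj]
      rw [IFT]
      simp only [h2, map_mul] at h1
      have h3 : ∫ k, conj (character k a) * Q k ∂νF = 0 := by
        rw [← h1]
        refine integral_congr_ae (Filter.Eventually.of_forall fun k => ?_)
        simp only [hQ]; ring
      rw [h3]; simp
    have h0 : F2inv Q =ᵐ[volume] fun _ => 0 := by
      rw [← Pi.zero_def, ← hI]; exact F2inv_ae_eq hQ1 hQ2
    have h4 := F2_F2inv hQ2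
    rw [F2_congr h0] at h4
    have h5 : F2 (fun _ : Slab => (0 : ℂ)) =ᵐ[νF] FT (fun _ => 0) :=
      F2_ae_eq (integrable_zero _ _ _) MemLp.zero'
    filter_upwards [h4, h5] with k h6 h7
    have h8 : Q k = 0 := by rw [← h6, h7]; simp [FT]
    exact h8
  obtain ⟨η, hη, hne⟩ := exists_test_family
  filter_upwards [ae_all_iff.2 fun i => key (η i) (hη i)] with k hk
  obtain ⟨i, hi⟩ := hne k
  have := hk i
  rw [mul_eq_zero, map_eq_zero] at this
  exact this.resolve_left hi

theorem memLp_bdd_mul {α : Type*} [MeasurableSpace α] {μ : Measure α} {g f : α → ℂ}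
    (hf : MemLp f 2 μ) (hg : AEStronglyMeasurable g μ) {C : ℝ} (hC : ∀ x, ‖g x‖ ≤ C) :
    MemLp (fun x => g x * f x) 2 μ := by
  refine (hf.norm.const_mul C).mono (hg.mul hf.1) (Filter.Eventually.of_forall fun x => ?_)
  rw [norm_mul]
  exact (mul_le_mul_of_nonneg_right (hC x) (norm_nonneg _)).trans (Real.le_norm_self _)

theorem continuous_wave_ofReal (j : Fin 3) : Continuous fun k => (wave j k : ℂ) :=
  Complex.continuous_ofReal.comp (continuous_wave j)

/-- The Fourier transform of a divergence in the sense of distributions. -/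
theorem F2_weak_divergence {F : Fin 3 → Slab → ℂ} (hF : ∀ j, MemLp (F j) 2) {g : Slab → ℂ}
    (hg : MemLp g 2)
    (h : ∀ η : Slab → ℝ, IsTest η → ∑ j, ∫ x, pderiv j η x • F j x = -∫ x, η x • g x) :
    F2 g =ᵐ[νF] fun k => ∑ j, -(Complex.I * wave j k) * F2 (F j) k := by
  have hbr : ∀ (j : Fin 3), MemLp (fun k => (bracket k : ℂ)⁻¹ * (Complex.I * wave j k)
      * F2 (F j) k) 2 νF := by
    intro j
    refine memLp_bdd_mul (memLp_F2 _) (C := 1) ?_ fun k => ?_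
    · exact (continuous_bracket_inv.mul (continuous_const.mul (continuous_wave_ofReal j))).aestronglyMeasurable
    · rw [norm_mul, norm_inv, norm_mul]
      simp only [Complex.norm_I, one_mul, Complex.norm_real, Real.norm_eq_abs]
      rw [abs_of_pos (bracket_pos k), inv_mul_le_one₀ (bracket_pos k)]
      exact abs_wave_le_bracket j k
  have hb1 : MemLp (fun k => (bracket k : ℂ)⁻¹ * F2 g k) 2 νF := by
    refine memLp_bdd_mul (memLp_F2 _) (C := 1) ?_ fun k => ?_
    · exact continuous_bracket_inv.aestronglyMeasurable
    · rw [norm_inv, Complex.norm_real, Real.norm_of_nonneg (bracket_pos k).le]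
      refine inv_le_one_of_one_le₀ ?_
      rw [bracket, Real.one_le_sqrt]; linarith [waveSq_nonneg k]
  -- The factors `wave j` destroy square integrability, but they cost only one power of `bracket`,
  -- which the uniqueness lemma tolerates.
  have key : (fun k => F2 g k + ∑ j, (Complex.I * wave j k) * F2 (F j) k) =ᵐ[νF] 0 := by
    refine ae_eq_zero_of_integral_conj_FTr_mul ?_ fun η hη => ?_
    · have := hb1.add (memLp_finsetSum Finset.univ fun j _ => hbr j)
      refine (memLp_congr_ae (Filter.Eventually.of_forall fun k => ?_)).1 this
      simp only [Pi.add_apply, mul_add, Finset.mul_sum]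
      congr 1
      refine Finset.sum_congr rfl fun j _ => by ring
    · have h1 := h η hη
      have e1 : ∀ k, conj (FTr η k) * (F2 g k + ∑ j, (Complex.I * wave j k) * F2 (F j) k)
          = conj (FTr η k) * F2 g k + ∑ j, conj (FTr (pderiv j η) k) * F2 (F j) k := by
        intro k
        rw [mul_add, Finset.mul_sum]
        congr 1
        refine Finset.sum_congr rfl fun j _ => ?_
        rw [FTr_pderiv hη]
        simp only [map_mul, map_neg, Complex.conj_I, Complex.conj_ofReal]; ring
      have i1 : Integrable (fun k => conj (FTr η k) * F2 g k) νF :=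
        MemLp.integrable_mul (p := 2) (q := 2) hη.memLp_FTr.star (memLp_F2 g)
      have i2 : ∀ j, Integrable (fun k => conj (FTr (pderiv j η) k) * F2 (F j) k) νF := fun j =>
        MemLp.integrable_mul (p := 2) (q := 2) (hη.test_pderiv j).memLp_FTr.star (memLp_F2 _)
      simp only [e1]
      rw [integral_add i1 (integrable_finsetSum _ fun j _ => i2 j),
        integral_finsetSum _ fun j _ => i2 j, ← integral_test_smul hη hg]
      simp only [← integral_test_smul (hη.test_pderiv _) (hF _)]
      rw [h1]; ring
  filter_upwards [key] with k hk
  simp only [Pi.zero_apply] at hk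
  rw [eq_neg_of_add_eq_zero_left hk, ← Finset.sum_neg_distrib]
  refine Finset.sum_congr rfl fun j _ => by ring

theorem HasWeakDeriv.F2_ae_eq {i : Fin 3} {f g : Slab → ℂ} (h : HasWeakDeriv i f g)
    (hf : MemLp f 2) (hg : MemLp g 2) :
    F2 g =ᵐ[νF] fun k => -(Complex.I * wave i k) * F2 f k := by
  have hz : F2 (fun _ : Slab => (0 : ℂ)) =ᵐ[νF] FT (fun _ => 0) :=
    CrystalSlab.F2_ae_eq (integrable_zero _ _ _) MemLp.zero'
  have h1 := F2_weak_divergence (F := fun j => if j = i then f else fun _ => 0)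
    (fun j => by split_ifs; exacts [hf, MemLp.zero']) hg fun η hη => by
      rw [Finset.sum_eq_single i]
      · simpa using h.2.2 η hη
      · intro j _ hj; simp [hj]
      · simp
  filter_upwards [h1, hz] with k hk hzk
  rw [hk, Finset.sum_eq_single i]
  · simp
  · intro j _ hj; simp only [hj, if_false]; rw [hzk]; simp [FT]
  · simp

theorem hasWeakDeriv_of_F2 {f g : Slab → ℂ} (i : Fin 3) (hf : MemLp f 2) (hg : MemLp g 2)
    (h : F2 g =ᵐ[νF] fun k => -(Complex.I * wave i k) * F2 f k) : HasWeakDeriv i f g := by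
  refine ⟨hf.locallyIntegrable (by norm_num), hg.locallyIntegrable (by norm_num),
    fun η hη => ?_⟩
  rw [integral_test_smul (hη.test_pderiv i) hf, integral_test_smul hη hg, ← integral_neg]
  refine integral_congr_ae ?_
  filter_upwards [h] with k hk
  rw [hk, FTr_pderiv hη]
  simp only [map_mul, map_neg, Complex.conj_I, Complex.conj_ofReal]; ring

/-! ### Frequency truncation -/

section L2

variable {α : Type*} [MeasurableSpace α] {μ : Measure α}

theorem ofReal_integral_norm_sq {f : α → ℂ} (hf : MemLp f 2 μ) :
    ENNReal.ofReal (∫ x, ‖f x‖ ^ 2 ∂μ) = ∫⁻ x, ‖f x‖ₑ ^ 2 ∂μ := by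
  rw [ofReal_integral_eq_lintegral_ofReal (hf.integrable_norm_pow two_ne_zero)
    (Filter.Eventually.of_forall fun x => by positivity)]
  refine lintegral_congr fun x => ?_
  rw [ENNReal.ofReal_pow (norm_nonneg _), ofReal_norm]

theorem integral_norm_sq_eq_toReal {f : α → ℂ} (hf : MemLp f 2 μ) :
    ∫ x, ‖f x‖ ^ 2 ∂μ = (∫⁻ x, ‖f x‖ₑ ^ 2 ∂μ).toReal := by
  rw [← ofReal_integral_norm_sq hf, ENNReal.toReal_ofReal (integral_nonneg fun x => by positivity)]

theorem integral_norm_mul_norm_le {f g : α → ℂ} (hf : MemLp f 2 μ) (hg : MemLp g 2 μ) :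
    ∫ x, ‖f x‖ * ‖g x‖ ∂μ
      ≤ Real.sqrt (∫ x, ‖f x‖ ^ 2 ∂μ) * Real.sqrt (∫ x, ‖g x‖ ^ 2 ∂μ) := by
  have h := integral_mul_le_Lp_mul_Lq_of_nonneg (μ := μ) (p := 2) (q := 2)
    Real.HolderConjugate.two_two (f := fun x => ‖f x‖) (g := fun x => ‖g x‖)
    (Filter.Eventually.of_forall fun x => norm_nonneg _)
    (Filter.Eventually.of_forall fun x => norm_nonneg _)
    (by simpa using hf.norm) (by simpa using hg.norm)
  simpa [Real.sqrt_eq_rpow] using h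

end L2

theorem integral_norm_sq_F2 {f : Slab → ℂ} (hf : MemLp f 2) :
    ∫ k, ‖F2 f k‖ ^ 2 ∂νF = ∫ x, ‖f x‖ ^ 2 := by
  rw [integral_norm_sq_eq_toReal (memLp_F2 f), integral_norm_sq_eq_toReal hf, lintegral_F2 hf]

theorem measurable_F2 (f : Slab → ℂ) : Measurable (F2 f) := by
  unfold F2; split_ifs
  · exact (Lp.stronglyMeasurable _).measurable
  · exact measurable_const

/-- The multiplier `(1 + |k|²)^{-1/2}`, cut off to `|k| ≤ R`. -/
def lowMult (R : ℝ) (k : Freq) : ℂ :=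
  {k | waveSq k ≤ R ^ 2}.indicator (fun k => (bracket k : ℂ)⁻¹) k

theorem measurableSet_low (R : ℝ) : MeasurableSet {k | waveSq k ≤ R ^ 2} :=
  (isClosed_le continuous_waveSq continuous_const).measurableSet

theorem measurable_lowMult (R : ℝ) : Measurable (lowMult R) :=
  continuous_bracket_inv.measurable.indicator (measurableSet_low R)

theorem volume_sup_closedBall {R : ℝ} (hR : 0 ≤ R) :
    volume (Metric.closedBall (0 : ℝ × ℝ) R) = ENNReal.ofReal (4 * R ^ 2) := by
  have h := (closedBall_prod_same (0 : ℝ) (0 : ℝ) R).symm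
  have h' : (0 : ℝ × ℝ) = (0, 0) := rfl
  rw [h', h, Measure.volume_eq_prod, Measure.prod_prod, Real.volume_closedBall,
    ← ENNReal.ofReal_mul (by positivity)]
  congr 1; ring

theorem norm_sq_le_of_prod (ξ : ℝ × ℝ) : ‖ξ‖ ^ 2 ≤ ξ.1 ^ 2 + ξ.2 ^ 2 := by
  rw [Prod.norm_def]
  rcases max_cases ‖ξ.1‖ ‖ξ.2‖ with ⟨h, -⟩ | ⟨h, -⟩ <;> rw [h, Real.norm_eq_abs, sq_abs] <;>
    nlinarith [sq_nonneg ξ.1, sq_nonneg ξ.2]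

theorem sq_intCast_le_waveSq (n : ℤ) (ξ : ℝ × ℝ) :
    (n : ℝ) ^ 2 + (ξ.1 ^ 2 + ξ.2 ^ 2) ≤ waveSq (n, ξ) := by
  simp only [waveSq]
  have : (1 : ℝ) ≤ (2 * Real.pi) ^ 2 := by nlinarith [Real.pi_gt_three]
  nlinarith [sq_nonneg (n : ℝ)]

theorem summable_one_add_sq_inv : Summable fun n : ℤ => ((1 : ℝ) + (n : ℝ) ^ 2)⁻¹ := by
  have h := (Real.summable_one_div_int_pow (p := 2)).2 one_lt_two
  refine Summable.of_norm_bounded_eventually h ?_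
  have : ∀ᶠ n : ℤ in Filter.cofinite, n ≠ 0 := by
    simpa using (Set.finite_singleton (0 : ℤ)).eventually_cofinite_notMem
  filter_upwards [this] with n hn
  rw [Real.norm_of_nonneg (by positivity), one_div]
  gcongr
  linarith

/-- The n-th slice contributes at most (1 + n²)⁻¹ times the area 4R² of a square, and these are
summable. The quadratic rate is not sharp for large R, but it is all that the L⁴ embedding uses. -/
theorem exists_lintegral_lowMult_le : ∃ C : ℝ, 0 < C ∧ ∀ R : ℝ, 0 ≤ R →
    ∫⁻ k, ‖lowMult R k‖ₑ ^ 2 ∂νF ≤ ENNReal.ofReal (C * R ^ 2) := by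
  refine ⟨∑' n : ℤ, 4 * ((1 : ℝ) + (n : ℝ) ^ 2)⁻¹, ?_, fun R hR => ?_⟩
  · exact (summable_one_add_sq_inv.mul_left 4).tsum_pos (fun n => by positivity) 0 (by norm_num)
  have hm : AEMeasurable (fun k => ‖lowMult R k‖ₑ ^ 2) νF :=
    ((measurable_lowMult R).enorm.pow_const 2).aemeasurable
  rw [lintegral_dualMeasure hm]
  have hb : ∀ n : ℤ, ∫⁻ ξ : ℝ × ℝ, ‖lowMult R (n, ξ)‖ₑ ^ 2
      ≤ ENNReal.ofReal (4 * ((1 : ℝ) + (n : ℝ) ^ 2)⁻¹ * R ^ 2) := by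
    intro n
    have h1 : ∀ ξ : ℝ × ℝ, ‖lowMult R (n, ξ)‖ₑ ^ 2
        ≤ (Metric.closedBall (0 : ℝ × ℝ) R).indicator
          (fun _ => ENNReal.ofReal (((1 : ℝ) + (n : ℝ) ^ 2)⁻¹)) ξ := by
      intro ξ
      have hw := sq_intCast_le_waveSq n ξ
      unfold lowMult
      by_cases hk : waveSq (n, ξ) ≤ R ^ 2
      · have hmem : ξ ∈ Metric.closedBall (0 : ℝ × ℝ) R := by
          rw [mem_closedBall_zero_iff]
          refine abs_le_of_sq_le_sq' ?_ hR |>.2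
          nlinarith [norm_sq_le_of_prod ξ, sq_nonneg (n : ℝ)]
        rw [Set.indicator_of_mem (by exact hk), Set.indicator_of_mem hmem, ← ofReal_norm,
          ← ENNReal.ofReal_pow (norm_nonneg _)]
        refine ENNReal.ofReal_le_ofReal ?_
        rw [norm_inv, inv_pow, Complex.norm_real, Real.norm_eq_abs, sq_abs, bracket_sq]
        refine inv_anti₀ (by positivity) ?_
        nlinarith [sq_nonneg ξ.1, sq_nonneg ξ.2]
      · rw [Set.indicator_of_notMem (by exact hk)]
        simp
    refine (lintegral_mono h1).trans ?_
    rw [lintegral_indicator_const measurableSet_closedBall, volume_sup_closedBall hR,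
      ← ENNReal.ofReal_mul (by positivity)]
    exact ENNReal.ofReal_le_ofReal (le_of_eq (by ring))
  refine (ENNReal.tsum_le_tsum hb).trans (le_of_eq ?_)
  rw [← ENNReal.ofReal_tsum_of_nonneg (fun n => by positivity)
    ((summable_one_add_sq_inv.mul_left 4).mul_right _), tsum_mul_right]

theorem memLp_lowMult (R : ℝ) : MemLp (lowMult R) 2 νF := by
  obtain ⟨C, -, hC⟩ := exists_lintegral_lowMult_le
  refine memLp_two_of_lintegral (measurable_lowMult R).aestronglyMeasurable ?_
  have h : lowMult R = lowMult |R| := by unfold lowMult; simp [sq_abs]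
  rw [h]
  exact ((hC _ (abs_nonneg R)).trans_lt ENNReal.ofReal_lt_top).ne

theorem exists_sqrt_integral_lowMult_le : ∃ C : ℝ, 0 < C ∧ ∀ R : ℝ, 0 ≤ R →
    Real.sqrt (∫ k, ‖lowMult R k‖ ^ 2 ∂νF) ≤ C * R := by
  obtain ⟨C, hC0, hC⟩ := exists_lintegral_lowMult_le
  refine ⟨Real.sqrt C, Real.sqrt_pos.2 hC0, fun R hR => ?_⟩
  rw [Real.sqrt_le_iff]
  refine ⟨by positivity, ?_⟩
  rw [mul_pow, Real.sq_sqrt hC0.le]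
  have := hC R hR
  rw [← ofReal_integral_norm_sq (memLp_lowMult R)] at this
  exact (ENNReal.ofReal_le_ofReal_iff (by positivity)).1 this

theorem norm_lowMult_le (R : ℝ) (k : Freq) : ‖lowMult R k‖ ≤ 1 := by
  unfold lowMult
  refine (norm_indicator_le_norm_self _ _).trans ?_
  rw [norm_inv, Complex.norm_real, Real.norm_of_nonneg (bracket_pos k).le]
  refine inv_le_one_of_one_le₀ ?_
  rw [bracket, Real.one_le_sqrt]; linarith [waveSq_nonneg k]

/-- The low frequency part, for a function with Fourier transform `(1 + |k|²)^{-1/2} G`. -/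
def lowPart (R : ℝ) (G : Freq → ℂ) : Slab → ℂ := IFT fun k => lowMult R k * G k

theorem integrable_lowMult_mul (R : ℝ) {G : Freq → ℂ} (hG : MemLp G 2 νF) :
    Integrable (fun k => lowMult R k * G k) νF :=
  MemLp.integrable_mul (p := 2) (q := 2) (memLp_lowMult R) hG

theorem memLp_lowMult_mul (R : ℝ) {G : Freq → ℂ} (hG : MemLp G 2 νF) :
    MemLp (fun k => lowMult R k * G k) 2 νF :=
  memLp_bdd_mul hG (measurable_lowMult R).aestronglyMeasurable (norm_lowMult_le R)

theorem lowPart_ae_eq (R : ℝ) {G : Freq → ℂ} (hG : MemLp G 2 νF) :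
    F2inv (fun k => lowMult R k * G k) =ᵐ[volume] lowPart R G :=
  F2inv_ae_eq (integrable_lowMult_mul R hG) (memLp_lowMult_mul R hG)

theorem memLp_lowPart (R : ℝ) {G : Freq → ℂ} (hG : MemLp G 2 νF) : MemLp (lowPart R G) 2 :=
  (memLp_congr_ae (lowPart_ae_eq R hG)).1 (memLp_F2inv _)

theorem F2_lowPart (R : ℝ) {G : Freq → ℂ} (hG : MemLp G 2 νF) :
    F2 (lowPart R G) =ᵐ[νF] fun k => lowMult R k * G k := by
  rw [← F2_congr (lowPart_ae_eq R hG)]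
  exact F2_F2inv (memLp_lowMult_mul R hG)

theorem norm_lowPart_le (R : ℝ) {G : Freq → ℂ} (hG : MemLp G 2 νF) (x : Slab) :
    ‖lowPart R G x‖ ≤
      Real.sqrt (∫ k, ‖lowMult R k‖ ^ 2 ∂νF) * Real.sqrt (∫ k, ‖G k‖ ^ 2 ∂νF) := by
  rw [lowPart, IFT, norm_mul]
  have h1 : ‖(1 / (2 * Real.pi) : ℂ)‖ ≤ 1 := by
    rw [norm_div, norm_one, norm_mul, Complex.norm_real, Real.norm_of_nonneg Real.pi_pos.le,
      Complex.norm_ofNat]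
    rw [div_le_one (by positivity)]
    have := Real.pi_gt_three
    linarith
  refine (mul_le_of_le_one_left (norm_nonneg _) h1).trans ?_
  refine (norm_integral_le_integral_norm _).trans ?_
  refine le_trans (le_of_eq ?_) (integral_norm_mul_norm_le (memLp_lowMult R) hG)
  simp

/-- `F2 f - lowMult * G` is supported on high frequencies. -/
theorem lintegral_sub_lowPart (R : ℝ) {f : Slab → ℂ} (hf : MemLp f 2) {G : Freq → ℂ}
    (hG : MemLp G 2 νF) (hfG : F2 f =ᵐ[νF] fun k => (bracket k : ℂ)⁻¹ * G k) :
    ∫⁻ x, ‖f x - lowPart R G x‖ₑ ^ 2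
      = ∫⁻ k in {k | R ^ 2 < waveSq k}, ‖F2 f k‖ₑ ^ 2 ∂νF := by
  have hl := memLp_lowPart R hG
  rw [← lintegral_F2 (f := fun x => f x - lowPart R G x) (hf.sub hl)]
  have hs : MeasurableSet {k | R ^ 2 < waveSq k} :=
    (isOpen_lt continuous_const continuous_waveSq).measurableSet
  rw [← lintegral_indicator hs]
  refine lintegral_congr_ae ?_
  have h1 : F2 (fun x => f x - lowPart R G x) =ᵐ[νF] fun k => F2 f k + -1 * F2 (lowPart R G) k := by
    have a := F2_add hf (hl.const_smul (-1 : ℂ))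
    have b := F2_const_mul (-1) hl
    have c : (fun x => f x - lowPart R G x) = fun x => f x + ((-1 : ℂ) • lowPart R G) x := by
      ext x; simp [sub_eq_add_neg]
    rw [c]
    filter_upwards [a, b] with k ha hb
    rw [ha, ← hb]; rfl
  filter_upwards [h1, F2_lowPart R hG, hfG] with k a b c
  rw [a, b, c]
  by_cases hk : R ^ 2 < waveSq k
  · rw [Set.indicator_of_mem (by exact hk), lowMult,
      Set.indicator_of_notMem (by simpa using hk), c]
    simp
  · rw [Set.indicator_of_notMem (by exact hk), lowMult,
      Set.indicator_of_mem (by simpa using hk)]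
    simp

/-- The Sobolev embedding `H¹ ⊂ L⁴` on the slab. -/
theorem memLp_four {f : Slab → ℂ} (hf : MemLp f 2) {G : Freq → ℂ}
    (hG : MemLp G 2 νF) (hfG : F2 f =ᵐ[νF] fun k => (bracket k : ℂ)⁻¹ * G k) :
    MemLp f 4 := by
  obtain ⟨C, hC0, hC⟩ := exists_sqrt_integral_lowMult_le
  set K : ℝ := C * (Real.sqrt (∫ k, ‖G k‖ ^ 2 ∂νF) + 1) with hK
  have hK0 : 0 < K := by positivity
  have hlow : ∀ R : ℝ, 0 ≤ R → ∀ x, ‖lowPart R G x‖ ≤ K * R := by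
    intro R hR x
    refine (norm_lowPart_le R hG x).trans ?_
    calc _ ≤ (C * R) * (Real.sqrt (∫ k, ‖G k‖ ^ 2 ∂νF) + 1) := by
          gcongr
          · exact hC R hR
          · linarith
      _ = K * R := by rw [hK]; ring
  -- Cutting at R = t/(2K) makes the low part at most t/2 everywhere. Hence |f| > t forces the high
  -- part above t/2, and Chebyshev together with Plancherel bounds the measure of that set.
  have hmeas : ∀ t : ℝ, 0 < t → volume {x | t < ‖f x‖} ≤
      ENNReal.ofReal (4 / t ^ 2) *
        ∫⁻ k in {k | (t / (2 * K)) ^ 2 < waveSq k}, ‖F2 f k‖ₑ ^ 2 ∂νF := by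
    intro t ht
    set R := t / (2 * K) with hR
    have hR0 : 0 ≤ R := by positivity
    rw [← lintegral_sub_lowPart R hf hG hfG]
    have hm : AEMeasurable (fun x => ‖f x - lowPart R G x‖ₑ ^ 2) volume :=
      ((hf.1.sub (memLp_lowPart R hG).1).enorm).pow_const 2
    have h1 := mul_meas_ge_le_lintegral₀ hm (ENNReal.ofReal (t ^ 2 / 4))
    have h2 : {x | t < ‖f x‖} ⊆ {x | ENNReal.ofReal (t ^ 2 / 4) ≤ ‖f x - lowPart R G x‖ₑ ^ 2} := by
      intro x hx
      simp only [Set.mem_ofPred_eq] at hx ⊢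
      rw [← ofReal_norm, ← ENNReal.ofReal_pow (norm_nonneg _)]
      refine ENNReal.ofReal_le_ofReal ?_
      have h3 := hlow R hR0 x
      have h4 : K * R = t / 2 := by rw [hR]; field_simp
      have h5 := norm_sub_norm_le (f x) (lowPart R G x)
      have h6 : t / 2 ≤ ‖f x - lowPart R G x‖ := by linarith
      nlinarith
    calc volume {x | t < ‖f x‖}
        ≤ volume {x | ENNReal.ofReal (t ^ 2 / 4) ≤ ‖f x - lowPart R G x‖ₑ ^ 2} := measure_mono h2
      _ = ENNReal.ofReal (4 / t ^ 2) * (ENNReal.ofReal (t ^ 2 / 4) *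
          volume {x | ENNReal.ofReal (t ^ 2 / 4) ≤ ‖f x - lowPart R G x‖ₑ ^ 2}) := by
          rw [← mul_assoc, ← ENNReal.ofReal_mul (by positivity)]
          have : 4 / t ^ 2 * (t ^ 2 / 4) = 1 := by field_simp
          rw [this]; simp
      _ ≤ _ := by gcongr
  have hlc := lintegral_rpow_eq_lintegral_meas_lt_mul (μ := (volume : Measure Slab))
    (f := fun x => ‖f x‖) (Filter.Eventually.of_forall fun x => norm_nonneg _)
    hf.1.norm.aemeasurable (p := 4) (by norm_num)
  set S : Set (ℝ × Freq) := {p | (p.1 / (2 * K)) ^ 2 < waveSq p.2} with hS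
  have hSm : MeasurableSet S :=
    (isOpen_lt (by fun_prop) (continuous_waveSq.comp continuous_snd)).measurableSet
  set Φ : ℝ → Freq → ℝ≥0∞ := fun t k => S.indicator
    (fun p => ENNReal.ofReal (4 * p.1) * ‖F2 f p.2‖ₑ ^ 2) (t, k) with hΦ
  have hΦm : Measurable (Function.uncurry Φ) := by
    refine Measurable.indicator ?_ hSm
    exact (ENNReal.measurable_ofReal.comp (measurable_fst.const_mul 4)).mul
      (((measurable_F2 f).comp measurable_snd).enorm.pow_const 2)
  have hb1 : ∫⁻ t in Set.Ioi (0 : ℝ), volume {x | t < ‖f x‖} * ENNReal.ofReal (t ^ ((4 : ℝ) - 1))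
      ≤ ∫⁻ t in Set.Ioi (0 : ℝ), ∫⁻ k, Φ t k ∂νF := by
    refine setLIntegral_mono' measurableSet_Ioi fun t ht => ?_
    have ht0 : (0 : ℝ) < t := ht
    have hs : MeasurableSet {k | (t / (2 * K)) ^ 2 < waveSq k} :=
      (isOpen_lt continuous_const continuous_waveSq).measurableSet
    calc volume {x | t < ‖f x‖} * ENNReal.ofReal (t ^ ((4 : ℝ) - 1))
        ≤ (ENNReal.ofReal (4 / t ^ 2) *
          ∫⁻ k in {k | (t / (2 * K)) ^ 2 < waveSq k}, ‖F2 f k‖ₑ ^ 2 ∂νF)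
            * ENNReal.ofReal (t ^ ((4 : ℝ) - 1)) := by gcongr; exact hmeas t ht0
      _ = ENNReal.ofReal (4 * t) *
          ∫⁻ k in {k | (t / (2 * K)) ^ 2 < waveSq k}, ‖F2 f k‖ₑ ^ 2 ∂νF := by
          rw [mul_right_comm, ← ENNReal.ofReal_mul (by positivity)]
          congr 2
          have : t ^ ((4 : ℝ) - 1) = t ^ 3 := by
            rw [← Real.rpow_natCast]; norm_num
          rw [this]; field_simp
      _ = ∫⁻ k, Φ t k ∂νF := by
          rw [← lintegral_const_mul _ ((measurable_F2 f).enorm.pow_const 2),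
            ← lintegral_indicator hs]
          rfl
  -- After Tonelli, a fixed frequency k is seen only by levels t < 2K|k|. Its weight is at most 4T·T
  -- = 16K²|k|² with T = 2K|k|, which the factor `bracket⁻²` in |f̂|² absorbs.
  have hb2 : ∫⁻ t in Set.Ioi (0 : ℝ), ∫⁻ k, Φ t k ∂νF
      ≤ ENNReal.ofReal (16 * K ^ 2) * ∫⁻ k, ‖G k‖ₑ ^ 2 ∂νF := by
    rw [lintegral_lintegral_swap hΦm.aemeasurable]
    rw [← lintegral_const_mul' _ _ ENNReal.ofReal_ne_top]
    refine lintegral_mono_ae ?_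
    filter_upwards [hfG] with k hk
    set T : ℝ := 2 * K * Real.sqrt (waveSq k) with hT
    have hT0 : 0 ≤ T := by positivity
    have h1 : ∀ t ∈ Set.Ioi (0 : ℝ), Φ t k ≤ (Set.Ioc (0 : ℝ) T).indicator
        (fun _ => ENNReal.ofReal (4 * T) * ‖F2 f k‖ₑ ^ 2) t := by
      intro t ht
      have ht0 : (0 : ℝ) < t := ht
      simp only [hΦ]
      by_cases hmem : (t, k) ∈ S
      · have hmem' : (t / (2 * K)) ^ 2 < waveSq k := hmem
        have h2 : t / (2 * K) < Real.sqrt (waveSq k) := Real.lt_sqrt_of_sq_lt hmem'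
        have h3 : t < T := by
          rw [div_lt_iff₀ (by positivity)] at h2
          rw [hT]; linarith
        rw [Set.indicator_of_mem hmem, Set.indicator_of_mem (by exact ⟨ht0, h3.le⟩)]
        gcongr
      · rw [Set.indicator_of_notMem hmem]; exact zero_le
    refine (setLIntegral_mono' measurableSet_Ioi h1).trans ?_
    refine (setLIntegral_le_lintegral _ _).trans ?_
    rw [lintegral_indicator_const measurableSet_Ioc, Real.volume_Ioc, sub_zero, mul_right_comm,
      ← ENNReal.ofReal_mul (by positivity), hk]
    have h4 : ‖(bracket k : ℂ)⁻¹ * G k‖ₑ ^ 2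
        = ENNReal.ofReal ((bracket k ^ 2)⁻¹) * ‖G k‖ₑ ^ 2 := by
      rw [enorm_mul, mul_pow]
      congr 1
      rw [← ofReal_norm, ← ENNReal.ofReal_pow (norm_nonneg _), norm_inv, Complex.norm_real,
        inv_pow, Real.norm_eq_abs, sq_abs]
    rw [h4, ← mul_assoc, ← ENNReal.ofReal_mul (by positivity)]
    refine mul_le_mul' (ENNReal.ofReal_le_ofReal ?_) le_rfl
    have h5 : Real.sqrt (waveSq k) ^ 2 = waveSq k := Real.sq_sqrt (waveSq_nonneg k)
    have h6 : 4 * T * T = 16 * K ^ 2 * waveSq k := by rw [← h5, hT]; ring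
    rw [h6, bracket_sq]
    have h7 := waveSq_nonneg k
    rw [← div_eq_mul_inv, div_le_iff₀ (by linarith)]
    nlinarith [sq_nonneg K]
  have hfin : ∫⁻ x, ENNReal.ofReal (‖f x‖ ^ (4 : ℝ)) < ⊤ := by
    rw [hlc]
    refine ENNReal.mul_lt_top ENNReal.ofReal_lt_top ((hb1.trans hb2).trans_lt ?_)
    exact ENNReal.mul_lt_top ENNReal.ofReal_lt_top (lintegral_enorm_sq_lt_top hG)
  refine ⟨hf.1, ?_⟩
  rw [eLpNorm_lt_top_iff_lintegral_rpow_enorm_lt_top (by norm_num) (by norm_num)]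
  refine lt_of_le_of_lt (le_of_eq ?_) hfin
  refine lintegral_congr fun x => ?_
  rw [← ENNReal.ofReal_rpow_of_nonneg (norm_nonneg _) (by norm_num), ofReal_norm]
  norm_num

/-! ### Local compactness -/

/-- Bound ||u|² - |a|²| by |u - a| (|u| + |a|) and apply Cauchy–Schwarz. -/
theorem abs_integral_mul_sub_le {θ : Slab → ℝ} (hθ : Continuous θ) {C : ℝ} (hC : ∀ x, ‖θ x‖ ≤ C)
    {u a : Slab → ℂ} (hu : MemLp u 2) (ha : MemLp a 2) :
    |(∫ x, θ x * ‖u x‖ ^ 2) - ∫ x, θ x * ‖a x‖ ^ 2| ≤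
      C * (Real.sqrt (∫ x, ‖u x - a x‖ ^ 2) *
        (Real.sqrt (∫ x, ‖u x‖ ^ 2) + Real.sqrt (∫ x, ‖a x‖ ^ 2))) := by
  have hint : ∀ {v : Slab → ℂ}, MemLp v 2 → Integrable fun x => θ x * ‖v x‖ ^ 2 := fun hv =>
    (hv.integrable_norm_pow two_ne_zero).bdd_mul hθ.aestronglyMeasurable
      (Filter.Eventually.of_forall hC)
  have hd : MemLp (fun x => u x - a x) 2 := hu.sub ha
  have i1 : Integrable fun x => ‖u x - a x‖ * ‖u x‖ :=
    MemLp.integrable_mul (p := 2) (q := 2) hd.norm hu.norm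
  have i2 : Integrable fun x => ‖u x - a x‖ * ‖a x‖ :=
    MemLp.integrable_mul (p := 2) (q := 2) hd.norm ha.norm
  have hC0 : 0 ≤ C := (norm_nonneg _).trans (hC 0)
  rw [← integral_sub (hint hu) (hint ha), ← Real.norm_eq_abs]
  refine (norm_integral_le_integral_norm _).trans ?_
  calc ∫ x, ‖θ x * ‖u x‖ ^ 2 - θ x * ‖a x‖ ^ 2‖
      ≤ ∫ x, C * (‖u x - a x‖ * ‖u x‖ + ‖u x - a x‖ * ‖a x‖) := by
        refine integral_mono ((hint hu).sub (hint ha)).norm ((i1.add i2).const_mul C) fun x => ?_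
        simp only
        rw [← mul_sub, norm_mul, ← mul_add]
        refine mul_le_mul (hC x) ?_ (norm_nonneg _) hC0
        rw [sq_sub_sq, norm_mul, mul_comm]
        refine mul_le_mul (abs_norm_sub_norm_le _ _) ?_ (norm_nonneg _) (norm_nonneg _)
        rw [Real.norm_of_nonneg (by positivity)]
    _ = C * ((∫ x, ‖u x - a x‖ * ‖u x‖) + ∫ x, ‖u x - a x‖ * ‖a x‖) := by
        rw [integral_const_mul, integral_add i1 i2]
    _ ≤ _ := by
        rw [mul_add (Real.sqrt _)]
        exact mul_le_mul_of_nonneg_left (add_le_add (integral_norm_mul_norm_le hd hu)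
          (integral_norm_mul_norm_le hd ha)) hC0

theorem integral_norm_sq_le_of_mult {f : Slab → ℂ} (hf : MemLp f 2) {m G : Freq → ℂ}
    (hG : MemLp G 2 νF) (hm : ∀ k, ‖m k‖ ≤ 1) (hfG : F2 f =ᵐ[νF] fun k => m k * G k) :
    ∫ x, ‖f x‖ ^ 2 ≤ ∫ k, ‖G k‖ ^ 2 ∂νF := by
  rw [← integral_norm_sq_F2 hf]
  refine integral_mono_ae ((memLp_F2 f).integrable_norm_pow two_ne_zero)
    (hG.integrable_norm_pow two_ne_zero) ?_
  filter_upwards [hfG] with k hk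
  rw [hk, norm_mul, mul_pow]
  exact mul_le_of_le_one_left (by positivity) (pow_le_one₀ (norm_nonneg _) (hm k))

theorem norm_bracket_inv_le (k : Freq) : ‖(bracket k : ℂ)⁻¹‖ ≤ 1 := by
  rw [norm_inv, Complex.norm_real, Real.norm_of_nonneg (bracket_pos k).le]
  refine inv_le_one_of_one_le₀ ?_
  rw [bracket, Real.one_le_sqrt]; linarith [waveSq_nonneg k]

theorem integral_sub_lowPart_le {R : ℝ} (hR : 0 < R) {f : Slab → ℂ} (hf : MemLp f 2)
    {G : Freq → ℂ} (hG : MemLp G 2 νF) (hfG : F2 f =ᵐ[νF] fun k => (bracket k : ℂ)⁻¹ * G k) :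
    ∫ x, ‖f x - lowPart R G x‖ ^ 2 ≤ (R ^ 2)⁻¹ * ∫ k, ‖G k‖ ^ 2 ∂νF := by
  have hd : MemLp (fun x => f x - lowPart R G x) 2 := hf.sub (memLp_lowPart R hG)
  rw [← ENNReal.ofReal_le_ofReal_iff (mul_nonneg (by positivity)
    (integral_nonneg fun k => by positivity)), ofReal_integral_norm_sq hd,
    ENNReal.ofReal_mul (by positivity), ofReal_integral_norm_sq hG,
    lintegral_sub_lowPart R hf hG hfG]
  have hs : MeasurableSet {k | R ^ 2 < waveSq k} :=
    (isOpen_lt continuous_const continuous_waveSq).measurableSet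
  rw [← lintegral_const_mul' _ _ ENNReal.ofReal_ne_top]
  refine (lintegral_mono_ae ?_).trans (setLIntegral_le_lintegral {k | R ^ 2 < waveSq k} _)
  filter_upwards [ae_restrict_of_ae hfG, ae_restrict_mem hs] with k hk hkR
  rw [hk, enorm_mul, mul_pow]
  gcongr
  rw [← ofReal_norm, ← ENNReal.ofReal_pow (norm_nonneg _), norm_inv, Complex.norm_real,
    inv_pow, Real.norm_eq_abs, sq_abs, bracket_sq]
  refine ENNReal.ofReal_le_ofReal (inv_anti₀ (by positivity) ?_)
  have : R ^ 2 < waveSq k := hkR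
  linarith

/-- Weak convergence in `H¹` implies convergence of local integrals of the squared modulus. -/
theorem tendsto_integral_mul_norm_sq {θ : Slab → ℝ} (hθ : IsTest θ) {u : ℕ → Slab → ℂ}
    {v : Slab → ℂ} (hu : ∀ n, MemLp (u n) 2) (hv : MemLp v 2) {G : ℕ → Freq → ℂ} {g : Freq → ℂ}
    (hG : ∀ n, MemLp (G n) 2 νF) (hg : MemLp g 2 νF) {M : ℝ} (hM0 : 0 ≤ M)
    (hM : ∀ n, ∫ k, ‖G n k‖ ^ 2 ∂νF ≤ M ^ 2) (hgM : ∫ k, ‖g k‖ ^ 2 ∂νF ≤ M ^ 2)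
    (huG : ∀ n, F2 (u n) =ᵐ[νF] fun k => (bracket k : ℂ)⁻¹ * G n k)
    (hvg : F2 v =ᵐ[νF] fun k => (bracket k : ℂ)⁻¹ * g k)
    (hw : ∀ w : Freq → ℂ, MemLp w 2 νF → Filter.Tendsto (fun n => ∫ k, w k * G n k ∂νF)
      Filter.atTop (𝓝 (∫ k, w k * g k ∂νF))) :
    Filter.Tendsto (fun n => ∫ x, θ x * ‖u n x‖ ^ 2) Filter.atTop
      (𝓝 (∫ x, θ x * ‖v x‖ ^ 2)) := by
  obtain ⟨C, hC⟩ := hθ.exists_bound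
  have hC0 : 0 ≤ C := (norm_nonneg _).trans (hC 0)
  have hsq : ∀ {G : Freq → ℂ}, ∫ k, ‖G k‖ ^ 2 ∂νF ≤ M ^ 2 →
      Real.sqrt (∫ k, ‖G k‖ ^ 2 ∂νF) ≤ M := fun h => Real.sqrt_le_iff.2 ⟨hM0, h⟩
  -- The truncation error is of order 1/R, uniformly along the sequence and also for the limit.
  have hcut : ∀ {f : Slab → ℂ} {G : Freq → ℂ} (R : ℝ), 0 < R → MemLp f 2 → MemLp G 2 νF →
      ∫ k, ‖G k‖ ^ 2 ∂νF ≤ M ^ 2 → (F2 f =ᵐ[νF] fun k => (bracket k : ℂ)⁻¹ * G k) →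
      |(∫ x, θ x * ‖f x‖ ^ 2) - ∫ x, θ x * ‖lowPart R G x‖ ^ 2| ≤ C * (M / R * (M + M)) := by
    intro f G R hR hf hG hGM hfG
    refine (abs_integral_mul_sub_le hθ.continuous hC hf (memLp_lowPart R hG)).trans ?_
    gcongr
    · refine Real.sqrt_le_iff.2 ⟨by positivity, ?_⟩
      refine (integral_sub_lowPart_le hR hf hG hfG).trans ?_
      rw [div_pow, div_eq_inv_mul]; gcongr
    · refine Real.sqrt_le_iff.2 ⟨hM0, ?_⟩
      exact (integral_norm_sq_le_of_mult hf hG norm_bracket_inv_le hfG).trans hGM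
    · refine Real.sqrt_le_iff.2 ⟨hM0, ?_⟩
      exact (integral_norm_sq_le_of_mult (memLp_lowPart R hG) hG (norm_lowMult_le R)
        (F2_lowPart R hG)).trans hGM
  -- At fixed R, the value of the low part at x is a pairing of `G n` with a fixed L² function. Weak
  -- convergence therefore gives pointwise convergence, and the uniform bound `B` permits dominated
  -- convergence on the support of θ.
  have hlow : ∀ R : ℝ, Filter.Tendsto (fun n => ∫ x, θ x * ‖lowPart R (G n) x‖ ^ 2) Filter.atTop
      (𝓝 (∫ x, θ x * ‖lowPart R g x‖ ^ 2)) := by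
    intro R
    set B : ℝ := Real.sqrt (∫ k, ‖lowMult R k‖ ^ 2 ∂νF) * M with hB
    refine tendsto_integral_of_dominated_convergence (fun x => ‖θ x‖ * B ^ 2) ?_
      (hθ.integrable.norm.mul_const _) ?_ ?_
    · exact fun n => hθ.continuous.aestronglyMeasurable.mul
        ((memLp_lowPart R (hG n)).1.norm.pow 2)
    · refine fun n => Filter.Eventually.of_forall fun x => ?_
      rw [norm_mul, norm_pow, norm_norm]
      gcongr
      refine (norm_lowPart_le R (hG n) x).trans ?_
      rw [hB]; gcongr; exact hsq (hM n)
    · refine Filter.Eventually.of_forall fun x => ?_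
      refine Filter.Tendsto.const_mul _ (Filter.Tendsto.pow (Filter.Tendsto.norm ?_) 2)
      have hm : MemLp (fun k => conj (character k x) * lowMult R k) 2 νF :=
        memLp_bdd_mul (memLp_lowMult R)
          (Complex.continuous_conj.comp (continuous_character_left x)).aestronglyMeasurable
          (C := 1) fun k => by simp
      have := (hw _ hm).const_mul (1 / (2 * Real.pi) : ℂ)
      simpa only [lowPart, IFT, mul_assoc] using this
  rw [Metric.tendsto_atTop]
  intro ε hε
  set R : ℝ := (4 * (C * (M * (M + M))) + 1) / ε with hR
  have hR0 : 0 < R := by positivity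
  have hRε : C * (M / R * (M + M)) ≤ ε / 4 := by
    have : C * (M / R * (M + M)) = C * (M * (M + M)) / R := by ring
    rw [this, div_le_iff₀ hR0, hR, mul_div_assoc']
    rw [le_div_iff₀ hε]; nlinarith
  obtain ⟨N, hN⟩ := Metric.tendsto_atTop.1 (hlow R) (ε / 4) (by positivity)
  refine ⟨N, fun n hn => ?_⟩
  have h1 := hcut R hR0 (hu n) (hG n) (hM n) (huG n)
  have h2 := hcut R hR0 hv hg hgM hvg
  have h3 := hN n hn
  rw [Real.dist_eq] at h3 ⊢
  rw [abs_le] at h1 h2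
  rw [abs_lt] at h3 ⊢
  constructor <;> linarith

/-! ### The Coulomb norm -/

theorem waveSq_ne_zero_ae : ∀ᵐ k ∂νF, waveSq k ≠ 0 := by
  refine ae_dualMeasure (fun n => ?_)
    (isOpen_ne_fun continuous_waveSq continuous_const).measurableSet
  have : ∀ᵐ ξ : ℝ × ℝ, ξ ≠ 0 := by
    rw [ae_iff]; simp
  filter_upwards [this] with ξ hξ h
  apply hξ
  have h1 : (2 * Real.pi * (n : ℝ)) ^ 2 + (ξ.1 ^ 2 + ξ.2 ^ 2) = 0 := h
  have h2 : ξ.1 = 0 := by nlinarith [sq_nonneg (2 * Real.pi * (n : ℝ)), sq_nonneg ξ.1, sq_nonneg ξ.2]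
  have h3 : ξ.2 = 0 := by nlinarith [sq_nonneg (2 * Real.pi * (n : ℝ)), sq_nonneg ξ.1, sq_nonneg ξ.2]
  exact Prod.ext h2 h3

/-- The Fourier transform of `Λ r = (-Δ)^{-1/2} r`. -/
def lam (r : Slab → ℝ) (k : Freq) : ℂ := FTr r k / (Real.sqrt (waveSq k) : ℂ)

theorem measurable_FTr {r : Slab → ℝ} (h1 : Integrable r) : Measurable (FTr r) :=
  (continuous_FT h1.ofReal).measurable

theorem measurable_sqrt_waveSq : Measurable fun k => (Real.sqrt (waveSq k) : ℂ) :=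
  (Complex.continuous_ofReal.comp (Real.continuous_sqrt.comp continuous_waveSq)).measurable

theorem measurable_lam {r : Slab → ℝ} (h1 : Integrable r) : Measurable (lam r) :=
  (measurable_FTr h1).div measurable_sqrt_waveSq

theorem norm_lam_sq (r : Slab → ℝ) (k : Freq) : ‖lam r k‖ ^ 2 = ‖FTr r k‖ ^ 2 / waveSq k := by
  rw [lam, norm_div, div_pow, Complex.norm_real, Real.norm_eq_abs, sq_abs,
    Real.sq_sqrt (waveSq_nonneg k)]

theorem coulombNormSq_eq {r : Slab → ℝ} (h1 : Integrable r) :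
    coulombNormSq r = ∫⁻ k, ‖lam r k‖ₑ ^ 2 ∂νF := by
  rw [lintegral_dualMeasure ((measurable_lam h1).enorm.pow_const 2).aemeasurable, coulombNormSq]
  refine tsum_congr fun n => lintegral_congr fun ξ => ?_
  rw [← ofReal_norm, ← ENNReal.ofReal_pow (norm_nonneg _), norm_lam_sq]
  rfl

/-- Charge densities in `L¹ ∩ L²` of finite Coulomb energy. -/
structure IsCharge (r : Slab → ℝ) : Prop where
  integrable : Integrable r
  memLp : MemLp r 2
  finite : coulombNormSq r ≠ ⊤

namespace IsCharge

variable {r r' : Slab → ℝ}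

theorem memLp_lam (h : IsCharge r) : MemLp (lam r) 2 νF := by
  refine memLp_two_of_lintegral (measurable_lam h.integrable).aestronglyMeasurable ?_
  rw [← coulombNormSq_eq h.integrable]; exact h.finite

theorem of_memLp_lam (h1 : Integrable r) (h2 : MemLp r 2) (h3 : MemLp (lam r) 2 νF) :
    IsCharge r :=
  ⟨h1, h2, by rw [coulombNormSq_eq h1]; exact (lintegral_enorm_sq_lt_top h3).ne⟩

theorem coulombNormSq_eq_ofReal (h : IsCharge r) :
    coulombNormSq r = ENNReal.ofReal (∫ k, ‖lam r k‖ ^ 2 ∂νF) := by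
  rw [coulombNormSq_eq h.integrable, ofReal_integral_norm_sq h.memLp_lam]

theorem memLp_FTr (h : IsCharge r) : MemLp (FTr r) 2 νF := memLp_FT h.integrable.ofReal h.memLp.ofReal

theorem FTr_add (h1 : Integrable r) (h2 : Integrable r') (k : Freq) :
    FTr (fun x => r x + r' x) k = FTr r k + FTr r' k := by
  have := FT_add h1.ofReal h2.ofReal k
  simpa [FTr] using this

theorem FTr_const_mul (c : ℝ) (r : Slab → ℝ) (k : Freq) :
    FTr (fun x => c * r x) k = c * FTr r k := by
  have := FT_const_mul c (fun x => (r x : ℂ)) k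
  simpa [FTr] using this

theorem lam_add (h1 : Integrable r) (h2 : Integrable r') (k : Freq) :
    lam (fun x => r x + r' x) k = lam r k + lam r' k := by
  rw [lam, FTr_add h1 h2, add_div]; rfl

theorem lam_const_mul (c : ℝ) (r : Slab → ℝ) (k : Freq) :
    lam (fun x => c * r x) k = c * lam r k := by
  rw [lam, FTr_const_mul, mul_div_assoc]; rfl

theorem add (h : IsCharge r) (h' : IsCharge r') : IsCharge fun x => r x + r' x := by
  refine of_memLp_lam (h.integrable.add h'.integrable) (h.memLp.add h'.memLp) ?_
  refine (memLp_congr_ae (Filter.Eventually.of_forall fun k => ?_)).1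
    (h.memLp_lam.add h'.memLp_lam)
  exact (lam_add h.integrable h'.integrable k).symm

theorem const_mul (c : ℝ) (h : IsCharge r) : IsCharge fun x => c * r x := by
  refine of_memLp_lam (h.integrable.const_mul c) (h.memLp.const_mul c) ?_
  refine (memLp_congr_ae (Filter.Eventually.of_forall fun k => ?_)).1
    (h.memLp_lam.const_mul (c : ℂ))
  exact (lam_const_mul c r k).symm

theorem congr (h : IsCharge r) (hr : r =ᵐ[volume] r') : IsCharge r' := by
  refine of_memLp_lam (h.integrable.congr hr) ((memLp_congr_ae hr).1 h.memLp) ?_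
  have : lam r' = lam r := by
    ext k
    rw [lam, lam, FTr, FTr, FT_congr (f := fun x => (r x : ℂ)) (g := fun x => (r' x : ℂ))
      (by filter_upwards [hr] with x hx; rw [hx])]
  rw [this]; exact h.memLp_lam

end IsCharge

/-- A charge density is of finite Coulomb energy if it is so at small wave vectors. -/
theorem isCharge_of_memLp_disc {r : Slab → ℝ} (h1 : Integrable r) (h2 : MemLp r 2)
    (h3 : MemLp (fun ξ : ℝ × ℝ => FTr r (0, ξ) / (Real.sqrt (ξ.1 ^ 2 + ξ.2 ^ 2) : ℂ)) 2
      (volume.restrict {ξ : ℝ × ℝ | ξ.1 ^ 2 + ξ.2 ^ 2 ≤ 1})) : IsCharge r := by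
  refine ⟨h1, h2, ?_⟩
  have hfin := lintegral_FT h1.ofReal h2.ofReal (f := fun x => (r x : ℂ))
  have hne : ∫⁻ k, ‖FTr r k‖ₑ ^ 2 ∂νF ≠ ⊤ := by
    rw [hfin]; exact (lintegral_enorm_sq_lt_top h2.ofReal).ne
  have hm : Measurable fun k => ‖FTr r k‖ₑ ^ 2 := (measurable_FTr h1).enorm.pow_const 2
  rw [lintegral_dualMeasure hm.aemeasurable] at hne
  set Dsc : Set (ℝ × ℝ) := {ξ : ℝ × ℝ | ξ.1 ^ 2 + ξ.2 ^ 2 ≤ 1} with hD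
  have hDm : MeasurableSet Dsc :=
    (isClosed_le (by fun_prop) continuous_const).measurableSet
  set I0 := ∫⁻ ξ in Dsc, ‖FTr r (0, ξ) / (Real.sqrt (ξ.1 ^ 2 + ξ.2 ^ 2) : ℂ)‖ₑ ^ 2 with hI0
  have hI0f : I0 ≠ ⊤ := (lintegral_enorm_sq_lt_top h3).ne
  have hsl : ∀ n : ℤ, Measurable fun ξ : ℝ × ℝ => ‖FTr r (n, ξ)‖ₑ ^ 2 := fun n =>
    hm.comp measurable_prodMk_left
  have hb : ∀ n : ℤ, ∫⁻ ξ : ℝ × ℝ, ‖lam r (n, ξ)‖ₑ ^ 2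
      ≤ (∫⁻ ξ : ℝ × ℝ, ‖FTr r (n, ξ)‖ₑ ^ 2) + if n = 0 then I0 else 0 := by
    intro n
    -- Where |k| ≥ 1, division by |k|² only helps. This covers all slices n ≠ 0 and the outside of
    -- the disc in the slice n = 0.
    have hone : ∀ ξ : ℝ × ℝ, 1 ≤ waveSq (n, ξ) → ‖lam r (n, ξ)‖ₑ ^ 2 ≤ ‖FTr r (n, ξ)‖ₑ ^ 2 := by
      intro ξ hξ
      rw [← ofReal_norm, ← ofReal_norm, ← ENNReal.ofReal_pow (norm_nonneg _),
        ← ENNReal.ofReal_pow (norm_nonneg _), norm_lam_sq]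
      exact ENNReal.ofReal_le_ofReal (div_le_self (by positivity) hξ)
    by_cases hn : n = 0
    · subst hn
      rw [if_pos rfl, hI0, ← lintegral_indicator hDm, ← lintegral_add_left (hsl 0)]
      refine lintegral_mono fun ξ => ?_
      by_cases hξ : ξ ∈ Dsc
      · rw [Set.indicator_of_mem hξ]
        refine le_trans (le_of_eq ?_) le_add_self
        simp [lam, waveSq]
      · rw [Set.indicator_of_notMem hξ, add_zero]
        refine hone ξ ?_
        have : ¬ (ξ.1 ^ 2 + ξ.2 ^ 2 ≤ 1) := hξ
        simp only [waveSq]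
        nlinarith [sq_nonneg (2 * Real.pi * ((0 : ℤ) : ℝ))]
    · rw [if_neg hn, add_zero]
      refine lintegral_mono fun ξ => hone ξ ?_
      have h4 := sq_intCast_le_waveSq n ξ
      have h5 : (1 : ℝ) ≤ (n : ℝ) ^ 2 := by
        have : (1 : ℤ) ≤ n ^ 2 := by
          have := sq_pos_of_ne_zero hn; omega
        exact_mod_cast this
      nlinarith [sq_nonneg ξ.1, sq_nonneg ξ.2]
  rw [coulombNormSq_eq h1,
    lintegral_dualMeasure ((measurable_lam h1).enorm.pow_const 2).aemeasurable]
  refine ((ENNReal.tsum_le_tsum hb).trans_lt ?_).ne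
  rw [ENNReal.tsum_add, tsum_ite_eq]
  exact ENNReal.add_lt_top.2 ⟨hne.lt_top, hI0f.lt_top⟩

/-- From |e^{iθ} - 1| ≤ |θ|: a first moment makes the transform Lipschitz at the origin, which is
what compensates the singular weight 1/|ξ|. -/
theorem norm_FTr_sub_le {r : Slab → ℝ} (h1 : Integrable r)
    (h3 : Integrable fun x => (|x.2.1| + |x.2.2|) * r x) (ξ : ℝ × ℝ) :
    ‖FTr r (0, ξ) - FTr r (0, 0)‖
      ≤ (∫ x, ‖(|x.2.1| + |x.2.2|) * r x‖) * Real.sqrt (ξ.1 ^ 2 + ξ.2 ^ 2) := by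
  have hr : Integrable fun x => (r x : ℂ) := h1.ofReal
  simp only [FTr, FT]
  rw [← mul_sub, ← integral_sub (integrable_character_mul hr _) (integrable_character_mul hr _),
    norm_mul]
  have hpi : ‖(1 / (2 * Real.pi) : ℂ)‖ ≤ 1 := by
    rw [norm_div, norm_one, norm_mul, Complex.norm_real, Real.norm_of_nonneg Real.pi_pos.le,
      Complex.norm_ofNat, div_le_one (by positivity)]
    linarith [Real.pi_gt_three]
  refine (mul_le_of_le_one_left (norm_nonneg _) hpi).trans ?_
  refine (norm_integral_le_integral_norm _).trans ?_
  rw [← integral_mul_const]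
  refine integral_mono ((integrable_character_mul hr _).sub (integrable_character_mul hr _)).norm
    (h3.norm.mul_const _) fun x => ?_
  have e0 : character (0, (0 : ℝ × ℝ)) x = 1 := by simp [character]
  have e1 : character (0, ξ) x = Complex.exp (Complex.I * ((ξ.1 * x.2.1 + ξ.2 * x.2.2 : ℝ) : ℂ)) := by
    simp [character]
  simp only [e0, ← sub_mul]
  rw [e1, norm_mul, norm_mul, Complex.norm_real, mul_right_comm]
  refine mul_le_mul_of_nonneg_right ?_ (norm_nonneg _)
  refine Real.norm_exp_I_mul_ofReal_sub_one_le.trans ?_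
  have a1 : |ξ.1| ≤ Real.sqrt (ξ.1 ^ 2 + ξ.2 ^ 2) :=
    Real.abs_le_sqrt (by nlinarith [sq_nonneg ξ.2])
  have a2 : |ξ.2| ≤ Real.sqrt (ξ.1 ^ 2 + ξ.2 ^ 2) :=
    Real.abs_le_sqrt (by nlinarith [sq_nonneg ξ.1])
  rw [Real.norm_eq_abs, Real.norm_of_nonneg (by positivity)]
  calc |ξ.1 * x.2.1 + ξ.2 * x.2.2| ≤ |ξ.1| * |x.2.1| + |ξ.2| * |x.2.2| := by
        rw [← abs_mul, ← abs_mul]; exact abs_add_le _ _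
    _ ≤ Real.sqrt (ξ.1 ^ 2 + ξ.2 ^ 2) * |x.2.1| + Real.sqrt (ξ.1 ^ 2 + ξ.2 ^ 2) * |x.2.2| := by
        gcongr
    _ = _ := by ring

theorem FTr_zero (r : Slab → ℝ) :
    FTr r (0, 0) = (((∫ x, r x) / (2 * Real.pi) : ℝ) : ℂ) := by
  have e0 : ∀ x, character (0, (0 : ℝ × ℝ)) x = 1 := by simp [character]
  simp only [FTr, FT, e0, one_mul]
  rw [integral_complex_ofReal]
  push_cast; ring

theorem memLp_disc_of_bound {F : ℝ × ℝ → ℂ} (hF : Measurable F) {C : ℝ}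
    (hC : ∀ ξ : ℝ × ℝ, ‖F ξ‖ ≤ C * Real.sqrt (ξ.1 ^ 2 + ξ.2 ^ 2)) :
    MemLp (fun ξ : ℝ × ℝ => F ξ / (Real.sqrt (ξ.1 ^ 2 + ξ.2 ^ 2) : ℂ)) 2
      (volume.restrict {ξ : ℝ × ℝ | ξ.1 ^ 2 + ξ.2 ^ 2 ≤ 1}) := by
  have hfin : volume {ξ : ℝ × ℝ | ξ.1 ^ 2 + ξ.2 ^ 2 ≤ 1} < ⊤ := by
    refine (measure_mono (t := Metric.closedBall (0 : ℝ × ℝ) 1) fun ξ hξ => ?_).trans_lt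
      (isCompact_closedBall (0 : ℝ × ℝ) 1).measure_lt_top
    rw [mem_closedBall_zero_iff]
    have h1 : ξ.1 ^ 2 + ξ.2 ^ 2 ≤ 1 := hξ
    nlinarith [norm_sq_le_of_prod ξ, norm_nonneg ξ]
  have : IsFiniteMeasure (volume.restrict {ξ : ℝ × ℝ | ξ.1 ^ 2 + ξ.2 ^ 2 ≤ 1}) :=
    ⟨by simpa using hfin⟩
  refine MemLp.of_bound (C := |C|) ?_ (Filter.Eventually.of_forall fun ξ => ?_)
  · refine (hF.div ?_).aestronglyMeasurable
    exact Complex.measurable_ofReal.comp (by fun_prop)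
  · rw [norm_div, Complex.norm_real, Real.norm_of_nonneg (Real.sqrt_nonneg _)]
    refine div_le_of_le_mul₀ (Real.sqrt_nonneg _) (abs_nonneg _) ?_
    exact (hC ξ).trans (mul_le_mul_of_nonneg_right (le_abs_self C) (Real.sqrt_nonneg _))

/-- Neutral charge densities with a first moment have finite Coulomb energy. -/
theorem isCharge_of_moment {r : Slab → ℝ} (h1 : Integrable r) (h2 : MemLp r 2)
    (h3 : Integrable fun x => (|x.2.1| + |x.2.2|) * r x) (h0 : ∫ x, r x = 0) : IsCharge r := by
  refine isCharge_of_memLp_disc h1 h2 (memLp_disc_of_bound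
    (C := ∫ x, ‖(|x.2.1| + |x.2.2|) * r x‖) ((measurable_FTr h1).comp measurable_prodMk_left) fun ξ => ?_)
  have h4 := norm_FTr_sub_le h1 h3 ξ
  rw [FTr_zero, h0] at h4
  simpa using h4

/-- In polar coordinates of the plane the integral becomes ∫ dy / y near 0, which diverges. -/
theorem not_integrableOn_ball_inv_sq {δ : ℝ} (hδ : 0 < δ) :
    ¬ IntegrableOn (fun ξ : ℝ × ℝ => (‖ξ‖ ^ 2)⁻¹) (Metric.ball 0 δ) := by
  have h := integrable_fun_norm_addHaar (volume : Measure (ℝ × ℝ))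
    (f := (Set.Iio δ).indicator fun y : ℝ => (y ^ 2)⁻¹)
  have e1 : (fun ξ : ℝ × ℝ => (Set.Iio δ).indicator (fun y : ℝ => (y ^ 2)⁻¹) ‖ξ‖)
      = (Metric.ball 0 δ).indicator fun ξ : ℝ × ℝ => (‖ξ‖ ^ 2)⁻¹ := by
    ext ξ
    by_cases hξ : ‖ξ‖ < δ
    · rw [Set.indicator_of_mem (by exact hξ), Set.indicator_of_mem (by simpa using hξ)]
    · rw [Set.indicator_of_notMem (by exact hξ), Set.indicator_of_notMem (by simpa using hξ)]
  rw [e1, integrable_indicator_iff measurableSet_ball] at h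
  rw [h]
  intro hi
  have h2 : IntegrableOn (fun y : ℝ => y⁻¹) (Set.Ioc 0 (δ / 2)) := by
    refine (hi.mono_set Set.Ioc_subset_Ioi_self).congr_fun (fun y hy => ?_) measurableSet_Ioc
    have h3 : y ∈ Set.Iio δ := lt_of_le_of_lt hy.2 (by linarith)
    have : y ≠ 0 := hy.1.ne'
    simp only [Module.finrank_prod, Module.finrank_self]
    rw [Set.indicator_of_mem h3]
    simp; field_simp
  have h3 : IntervalIntegrable (fun y : ℝ => y⁻¹) volume 0 (δ / 2) := by
    rwa [intervalIntegrable_iff_integrableOn_Ioc_of_le (by positivity)]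
  rw [intervalIntegrable_inv_iff] at h3
  rcases h3 with h3 | h3
  · linarith
  · exact h3 Set.left_mem_uIcc

/-- Finite Coulomb energy implies neutrality. -/
theorem IsCharge.integral_eq_zero {r : Slab → ℝ} (h : IsCharge r) : ∫ x, r x = 0 := by
  by_contra hne
  have hc : FTr r (0, 0) ≠ 0 := by
    rw [FTr_zero]
    exact Complex.ofReal_ne_zero.2 (div_ne_zero hne (by positivity))
  set c := ‖FTr r (0, 0)‖ with hcdef
  have hc0 : 0 < c := norm_pos_iff.2 hc
  have hcont : Continuous fun ξ : ℝ × ℝ => ‖FTr r (0, ξ)‖ :=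
    ((continuous_FT h.integrable.ofReal).comp (by fun_prop)).norm
  -- By continuity the transform stays above c/2 near the origin, so |lam r|² dominates c²/(8‖ξ‖²)
  -- there, contradicting its integrability.
  have hev : ∀ᶠ ξ in 𝓝 (0 : ℝ × ℝ), c / 2 < ‖FTr r (0, ξ)‖ :=
    hcont.continuousAt.eventually (lt_mem_nhds (by show c / 2 < c; linarith))
  obtain ⟨δ, hδ, hball⟩ := Metric.eventually_nhds_iff_ball.1 hev
  apply not_integrableOn_ball_inv_sq hδ
  have hi : Integrable fun ξ : ℝ × ℝ => ‖lam r (0, ξ)‖ ^ 2 :=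
    (memLp_freq_slice h.memLp_lam 0).integrable_norm_pow two_ne_zero
  refine Integrable.mono' ((hi.const_mul (8 / c ^ 2)).integrableOn (s := Metric.ball 0 δ)) ?_ ?_
  · exact (measurable_norm.pow_const 2).inv.aestronglyMeasurable
  · filter_upwards [ae_restrict_mem measurableSet_ball] with ξ hξ
    have h1 := hball ξ hξ
    rw [norm_lam_sq, Real.norm_of_nonneg (by positivity)]
    have h2 : waveSq (0, ξ) = ξ.1 ^ 2 + ξ.2 ^ 2 := by simp [waveSq]
    rw [h2]
    by_cases h0 : ξ = 0
    · subst h0; simp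
    have hn0 : 0 < ‖ξ‖ := norm_pos_iff.2 h0
    have h3 := norm_sq_le_of_prod ξ
    have a1 : |ξ.1| ≤ ‖ξ‖ := norm_fst_le ξ
    have a2 : |ξ.2| ≤ ‖ξ‖ := norm_snd_le ξ
    have h4 : ξ.1 ^ 2 + ξ.2 ^ 2 ≤ 2 * ‖ξ‖ ^ 2 := by
      have b1 : ξ.1 ^ 2 ≤ ‖ξ‖ ^ 2 := by rw [← sq_abs]; gcongr
      have b2 : ξ.2 ^ 2 ≤ ‖ξ‖ ^ 2 := by rw [← sq_abs]; gcongr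
      linarith
    have h5 : 0 < ξ.1 ^ 2 + ξ.2 ^ 2 := lt_of_lt_of_le (by positivity) h3
    have h6 : c ^ 2 / 4 ≤ ‖FTr r (0, ξ)‖ ^ 2 := by nlinarith
    calc (‖ξ‖ ^ 2)⁻¹ ≤ 2 / (ξ.1 ^ 2 + ξ.2 ^ 2) := by
          rw [inv_eq_one_div, div_le_div_iff₀ (by positivity) h5]; linarith
      _ = 8 / c ^ 2 * ((c ^ 2 / 4) / (ξ.1 ^ 2 + ξ.2 ^ 2)) := by field_simp; norm_num
      _ ≤ _ := by gcongr

/-! ### The potential of a charge density -/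

/-- Split the exponent 2 as 3/4 + 5/4: the first part decays like |n|^{-3/2}, summable over ℤ, and
the second like ‖ξ‖^{-5/2}, integrable at infinity in the plane. -/
theorem lintegral_one_add_waveSq_inv_sq :
    ∫⁻ k, ENNReal.ofReal (((1 + waveSq k)⁻¹) ^ 2) ∂νF < ⊤ := by
  have hm : Measurable fun k => ENNReal.ofReal (((1 + waveSq k)⁻¹) ^ 2) :=
    ((measurable_const.add continuous_waveSq.measurable).inv.pow_const 2).ennreal_ofReal
  rw [lintegral_dualMeasure hm.aemeasurable]
  have hi : Integrable fun ξ : ℝ × ℝ => ((1 : ℝ) + ‖ξ‖ ^ 2) ^ (-(5 / 2 : ℝ) / 2) :=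
    integrable_rpow_neg_one_add_norm_sq (by simp; norm_num)
  set J := ∫⁻ ξ : ℝ × ℝ, ENNReal.ofReal (((1 : ℝ) + ‖ξ‖ ^ 2) ^ (-(5 / 2 : ℝ) / 2)) with hJ
  have hJf : J ≠ ⊤ := hi.lintegral_lt_top.ne
  have hb : ∀ n : ℤ, ∫⁻ ξ : ℝ × ℝ, ENNReal.ofReal (((1 + waveSq (n, ξ))⁻¹) ^ 2)
      ≤ ENNReal.ofReal ((1 + (n : ℝ) ^ 2) ^ (-(3 / 4) : ℝ)) * J := by
    intro n
    rw [hJ, ← lintegral_const_mul' _ _ ENNReal.ofReal_ne_top]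
    refine lintegral_mono fun ξ => ?_
    rw [← ENNReal.ofReal_mul (by positivity)]
    refine ENNReal.ofReal_le_ofReal ?_
    have h1 := sq_intCast_le_waveSq n ξ
    have h2 := norm_sq_le_of_prod ξ
    have hw := waveSq_nonneg (n, ξ)
    have e1 : ((1 + waveSq (n, ξ))⁻¹) ^ 2
        = (1 + waveSq (n, ξ)) ^ (-(3 / 4) : ℝ) * (1 + waveSq (n, ξ)) ^ (-(5 / 2 : ℝ) / 2) := by
      rw [← Real.rpow_add (by positivity), inv_pow, ← Real.rpow_natCast, ← Real.rpow_neg (by positivity)]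
      norm_num
    rw [e1]
    refine mul_le_mul ?_ ?_ (by positivity) (by positivity)
    · exact Real.rpow_le_rpow_of_nonpos (by positivity)
        (by nlinarith [sq_nonneg ξ.1, sq_nonneg ξ.2]) (by norm_num)
    · exact Real.rpow_le_rpow_of_nonpos (by positivity)
        (by nlinarith [sq_nonneg (n : ℝ)]) (by norm_num)
  refine (ENNReal.tsum_le_tsum hb).trans_lt ?_
  rw [ENNReal.tsum_mul_right]
  refine ENNReal.mul_lt_top ?_ hJf.lt_top
  have hs : Summable fun n : ℤ => (1 + (n : ℝ) ^ 2) ^ (-(3 / 4) : ℝ) := by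
    have h0 : Summable fun n : ℤ => |(n : ℝ)| ^ (-(3 / 2 : ℝ)) :=
      Real.summable_abs_int_rpow (by norm_num)
    refine h0.of_norm_bounded_eventually ?_
    filter_upwards [(Set.finite_singleton (0 : ℤ)).compl_mem_cofinite] with n hn
    have hn0 : n ≠ 0 := by simpa using hn
    have hp : 0 < |(n : ℝ)| := abs_pos.2 (by exact_mod_cast hn0)
    rw [Real.norm_of_nonneg (by positivity)]
    calc (1 + (n : ℝ) ^ 2) ^ (-(3 / 4) : ℝ) ≤ ((n : ℝ) ^ 2) ^ (-(3 / 4) : ℝ) :=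
          Real.rpow_le_rpow_of_nonpos (by rw [← sq_abs]; positivity) (by linarith) (by norm_num)
      _ = |(n : ℝ)| ^ (-(3 / 2 : ℝ)) := by
          rw [← sq_abs, ← Real.rpow_natCast, ← Real.rpow_mul hp.le]; norm_num
  rw [← ENNReal.ofReal_tsum_of_nonneg (fun n => by positivity) hs]
  exact ENNReal.ofReal_lt_top

/-- The unit disc of the plane of wave vectors orthogonal to the lattice. -/
def disc : Set Freq := {k | k.1 = 0 ∧ k.2.1 ^ 2 + k.2.2 ^ 2 ≤ 1}

theorem measurableSet_disc : MeasurableSet disc :=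
  (IsClosed.inter (s₁ := {k : Freq | k.1 = 0}) (s₂ := {k : Freq | k.2.1 ^ 2 + k.2.2 ^ 2 ≤ 1})
    (isClosed_eq continuous_fst continuous_const)
    (isClosed_le (by fun_prop) continuous_const)).measurableSet

theorem integrableOn_closedBall_inv_norm :
    IntegrableOn (fun ξ : ℝ × ℝ => ‖ξ‖⁻¹) (Metric.closedBall 0 1) := by
  have h := integrable_fun_norm_addHaar (volume : Measure (ℝ × ℝ))
    (f := (Set.Iic 1).indicator fun y : ℝ => y⁻¹)
  have e1 : (fun ξ : ℝ × ℝ => (Set.Iic (1 : ℝ)).indicator (fun y : ℝ => y⁻¹) ‖ξ‖)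
      = (Metric.closedBall 0 1).indicator fun ξ : ℝ × ℝ => ‖ξ‖⁻¹ := by
    ext ξ
    by_cases hξ : ‖ξ‖ ≤ 1
    · rw [Set.indicator_of_mem (by exact hξ), Set.indicator_of_mem (by simpa using hξ)]
    · rw [Set.indicator_of_notMem (by exact hξ), Set.indicator_of_notMem (by simpa using hξ)]
  rw [e1, integrable_indicator_iff measurableSet_closedBall] at h
  rw [h]
  have h2 : IntegrableOn ((Set.Iic (1 : ℝ)).indicator fun _ : ℝ => (1 : ℝ)) (Set.Ioi 0) := by
    rw [IntegrableOn, integrable_indicator_iff measurableSet_Iic, IntegrableOn,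
      Measure.restrict_restrict measurableSet_Iic, Set.inter_comm, Set.Ioi_inter_Iic]
    exact integrableOn_const (by simp)
  refine h2.congr_fun (fun y hy => ?_) measurableSet_Ioi
  have hy0 : y ≠ 0 := (Set.mem_Ioi.1 hy).ne'
  by_cases h1 : y ∈ Set.Iic (1 : ℝ)
  · rw [Set.indicator_of_mem h1]
    simp [Set.indicator_of_mem h1, hy0]
  · simp [Set.indicator_of_notMem h1]

/-- The singularity |ξ|⁻¹ is integrable in two dimensions; only the slice n = 0 meets the disc. -/
theorem lintegral_disc_lt_top :
    ∫⁻ k, disc.indicator (fun k => ENNReal.ofReal ((Real.sqrt (waveSq k))⁻¹)) k ∂νF < ⊤ := by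
  have hm : Measurable fun k => ENNReal.ofReal ((Real.sqrt (waveSq k))⁻¹) :=
    (continuous_waveSq.measurable.sqrt.inv).ennreal_ofReal
  rw [lintegral_dualMeasure (hm.indicator measurableSet_disc).aemeasurable,
    tsum_eq_single 0 fun n hn => ?_]
  · have h1 := integrableOn_closedBall_inv_norm.lintegral_lt_top
    rw [← lintegral_indicator measurableSet_closedBall] at h1
    refine (lintegral_mono fun ξ => ?_).trans_lt h1
    by_cases hξ : (0, ξ) ∈ disc
    · have h3 : ‖ξ‖ ≤ 1 := by
        have h4 : ξ.1 ^ 2 + ξ.2 ^ 2 ≤ 1 := hξ.2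
        nlinarith [norm_sq_le_of_prod ξ, norm_nonneg ξ]
      rw [Set.indicator_of_mem hξ, Set.indicator_of_mem (by simpa using h3)]
      refine ENNReal.ofReal_le_ofReal ?_
      have e : waveSq (0, ξ) = ξ.1 ^ 2 + ξ.2 ^ 2 := by simp [waveSq]
      rw [e]
      rcases eq_or_ne ξ 0 with rfl | h0
      · simp
      · exact inv_anti₀ (norm_pos_iff.2 h0) (Real.le_sqrt_of_sq_le (norm_sq_le_of_prod ξ))
    · rw [Set.indicator_of_notMem hξ]; exact zero_le
  · refine (lintegral_congr fun ξ => ?_).trans lintegral_zero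
    exact Set.indicator_of_notMem (fun h => hn h.1) _

/-- A square integrable weight dominating the integral kernel of the potential. -/
def kernelWeight (k : Freq) : ℝ :=
  disc.indicator (fun k => Real.sqrt ((Real.sqrt (waveSq k))⁻¹)) k + 2 * (1 + waveSq k)⁻¹

theorem memLp_kernelWeight : MemLp kernelWeight 2 νF := by
  refine MemLp.add ?_ (MemLp.const_mul ?_ 2)
  · have hm : Measurable (disc.indicator fun k => Real.sqrt ((Real.sqrt (waveSq k))⁻¹)) :=
      (continuous_waveSq.measurable.sqrt.inv.sqrt).indicator measurableSet_disc
    refine memLp_two_of_lintegral hm.aestronglyMeasurable ?_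
    refine ne_of_lt (lt_of_le_of_lt (lintegral_mono fun k => ?_) lintegral_disc_lt_top)
    by_cases hk : k ∈ disc
    · rw [Set.indicator_of_mem hk, Set.indicator_of_mem hk, Real.enorm_eq_ofReal (by positivity),
        ← ENNReal.ofReal_pow (by positivity), Real.sq_sqrt (by positivity)]
    · rw [Set.indicator_of_notMem hk, Set.indicator_of_notMem hk]; simp
  · have hm : Measurable fun k => (1 + waveSq k)⁻¹ :=
      (measurable_const.add continuous_waveSq.measurable).inv
    refine memLp_two_of_lintegral hm.aestronglyMeasurable ?_
    refine ne_of_lt (lt_of_eq_of_lt (lintegral_congr fun k => ?_) lintegral_one_add_waveSq_inv_sq)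
    have := waveSq_nonneg k
    rw [Real.enorm_eq_ofReal (by positivity), ← ENNReal.ofReal_pow (by positivity)]

/-- The Fourier transform of the potential. -/
def potMult (r : Slab → ℝ) (k : Freq) : ℂ := FTr r k / (waveSq k : ℂ)

/-- The indicator function of `disc`. -/
def discInd (k : Freq) : ℂ := disc.indicator 1 k

theorem measurable_discInd : Measurable discInd :=
  (measurable_const (a := (1 : ℂ))).indicator measurableSet_disc

/-- The (complex valued) potential of the charge density `r`, renormalized at small wave
vectors. -/
def cpotential (r : Slab → ℝ) (x : Slab) : ℂ :=
  (1 / (2 * Real.pi) : ℂ) * ∫ k, (conj (character k x) - discInd k) * potMult r k ∂νF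

theorem measurable_potMult {r : Slab → ℝ} (h1 : Integrable r) : Measurable (potMult r) :=
  (measurable_FTr h1).div (Complex.continuous_ofReal.comp continuous_waveSq).measurable

/-- The growth rate of the potential. -/
def growth (x : Slab) : ℝ := (1 + |x.2.1| + |x.2.2|) ^ (1 / 2 : ℝ)

theorem continuous_growth : Continuous growth := by
  unfold growth
  exact (by fun_prop : Continuous fun x : Slab => 1 + |x.2.1| + |x.2.2|).rpow_const
    fun x => Or.inl (by positivity)

theorem one_le_growth (x : Slab) : 1 ≤ growth x :=
  Real.one_le_rpow (by linarith [abs_nonneg x.2.1, abs_nonneg x.2.2]) (by norm_num)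

theorem norm_potMult (r : Slab → ℝ) (k : Freq) :
    ‖potMult r k‖ = ‖lam r k‖ * (Real.sqrt (waveSq k))⁻¹ := by
  rw [potMult, lam, norm_div, norm_div, Complex.norm_real, Complex.norm_real,
    Real.norm_of_nonneg (waveSq_nonneg k), Real.norm_of_nonneg (Real.sqrt_nonneg _)]
  conv_lhs => rw [← Real.mul_self_sqrt (waveSq_nonneg k)]
  rw [div_mul_eq_div_div, div_eq_mul_inv _ (Real.sqrt _)]

/-- Source of the square-root growth. On the disc, |e^{iθ} - 1| is at most 2 and at most |k| (1 +
|x₂| + |x₃|), so its square is at most the product of the two bounds; this gains |k|^{1/2} at the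
price of `growth x`. Dividing by |k| leaves |k|^{-1/2}, the singular part of `kernelWeight`. -/
theorem norm_conj_character_sub_le (k : Freq) (x : Slab) :
    ‖conj (character k x) - discInd k‖ * (Real.sqrt (waveSq k))⁻¹
      ≤ 2 * growth x * (kernelWeight k * bracket k) := by
  have hb : 1 ≤ bracket k := Real.one_le_sqrt.2 (by linarith [waveSq_nonneg k])
  have hw := waveSq_nonneg k
  have hg := one_le_growth x
  set s := Real.sqrt (waveSq k) with hs
  have hs0 : 0 ≤ s := Real.sqrt_nonneg _
  have hss : s ^ 2 = waveSq k := Real.sq_sqrt hw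
  by_cases hk : k ∈ disc
  · have e1 : conj (character k x) - discInd k = conj (character k x - 1) := by
      simp [discInd, Set.indicator_of_mem hk]
    rw [e1, RCLike.norm_conj]
    have hk0 : k.1 = 0 := hk.1
    have e2 : character k x
        = Complex.exp (Complex.I * ((k.2.1 * x.2.1 + k.2.2 * x.2.2 : ℝ) : ℂ)) := by
      simp [character, hk0]
    have n1 : ‖character k x - 1‖ ≤ 2 :=
      (norm_sub_le _ _).trans (by simp; norm_num)
    have n2 : ‖character k x - 1‖ ≤ s * (1 + |x.2.1| + |x.2.2|) := by
      rw [e2]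
      refine Real.norm_exp_I_mul_ofReal_sub_one_le.trans ?_
      have es : waveSq k = k.2.1 ^ 2 + k.2.2 ^ 2 := by simp [waveSq, hk0]
      have a1 : |k.2.1| ≤ s := by
        rw [hs, es]; exact Real.abs_le_sqrt (by nlinarith [sq_nonneg k.2.2])
      have a2 : |k.2.2| ≤ s := by
        rw [hs, es]; exact Real.abs_le_sqrt (by nlinarith [sq_nonneg k.2.1])
      calc ‖k.2.1 * x.2.1 + k.2.2 * x.2.2‖ ≤ |k.2.1| * |x.2.1| + |k.2.2| * |x.2.2| := by
            rw [← abs_mul, ← abs_mul]; exact abs_add_le _ _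
        _ ≤ s * |x.2.1| + s * |x.2.2| := by gcongr
        _ ≤ _ := by nlinarith
    have hgsq : growth x ^ 2 = 1 + |x.2.1| + |x.2.2| := by
      rw [growth, ← Real.sqrt_eq_rpow, Real.sq_sqrt (by positivity)]
    have n3 : ‖character k x - 1‖ ≤ 2 * growth x * Real.sqrt s := by
      refine le_of_sq_le_sq ?_ (by positivity)
      rw [mul_pow, mul_pow, Real.sq_sqrt hs0, hgsq, sq]
      calc ‖character k x - 1‖ * ‖character k x - 1‖ ≤ 2 * (s * (1 + |x.2.1| + |x.2.2|)) := by
            gcongr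
        _ ≤ _ := by nlinarith [mul_nonneg hs0 (by positivity : 0 ≤ 1 + |x.2.1| + |x.2.2|)]
    have e3 : Real.sqrt s * s⁻¹ = Real.sqrt s⁻¹ := by
      rcases hs0.eq_or_lt with h | h
      · rw [← h]; simp
      · rw [Real.sqrt_inv]
        have := Real.sqrt_pos.2 h
        field_simp
        exact Real.sq_sqrt hs0
    calc ‖character k x - 1‖ * s⁻¹ ≤ 2 * growth x * Real.sqrt s * s⁻¹ := by gcongr
      _ = 2 * growth x * Real.sqrt s⁻¹ := by rw [mul_assoc, e3]
      _ ≤ 2 * growth x * (kernelWeight k * bracket k) := by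
          refine mul_le_mul_of_nonneg_left ?_ (by positivity)
          have h1 : Real.sqrt s⁻¹ ≤ kernelWeight k := by
            rw [kernelWeight, Set.indicator_of_mem hk]
            have : 0 ≤ 2 * (1 + waveSq k)⁻¹ := by positivity
            linarith
          exact h1.trans (le_mul_of_one_le_right ((Real.sqrt_nonneg _).trans h1) hb)
  -- Off the disc nothing is subtracted and |k| ≥ 1, so |k|⁻¹ is comparable to `bracket⁻¹`, which is
  -- what the second term of `kernelWeight` times `bracket` provides.
  · have hk1 : 1 ≤ waveSq k := by
      by_cases hk0 : k.1 = 0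
      · by_contra hlt
        refine hk ⟨hk0, ?_⟩
        have es : waveSq k = k.2.1 ^ 2 + k.2.2 ^ 2 := by simp [waveSq, hk0]
        linarith
      · have h4 := sq_intCast_le_waveSq k.1 k.2
        have h5 : (1 : ℝ) ≤ (k.1 : ℝ) ^ 2 := by
          have : (1 : ℤ) ≤ k.1 ^ 2 := by
            have := sq_pos_of_ne_zero hk0; omega
          exact_mod_cast this
        have : waveSq (k.1, k.2) = waveSq k := rfl
        nlinarith [sq_nonneg k.2.1, sq_nonneg k.2.2]
    have e1 : ‖conj (character k x) - discInd k‖ = 1 := by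
      simp [discInd, Set.indicator_of_notMem hk]
    have hs1 : 1 ≤ s := Real.one_le_sqrt.2 hk1
    have e2 : kernelWeight k * bracket k = 2 * (bracket k)⁻¹ := by
      rw [kernelWeight, Set.indicator_of_notMem hk, zero_add, ← bracket_sq]
      have := bracket_pos k
      field_simp
    have hbs : bracket k ≤ 2 * s := by
      refine le_of_sq_le_sq ?_ (by positivity)
      rw [bracket_sq, mul_pow, hss]; linarith
    rw [e1, one_mul, e2]
    have h1 : s⁻¹ ≤ 2 * (bracket k)⁻¹ := by
      have := bracket_pos k
      rw [← div_eq_mul_inv, inv_eq_one_div, div_le_div_iff₀ (by linarith) this]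
      linarith
    have h2 : 0 ≤ 2 * (bracket k)⁻¹ := by have := bracket_pos k; positivity
    nlinarith

/-- Since `bracket` is at most 1 + |k| and |k| · `lam r` has the modulus of r̂, finite Coulomb
energy and r ∈ L² together suffice. -/
theorem IsCharge.memLp_bracket_mul_lam {r : Slab → ℝ} (h : IsCharge r) :
    MemLp (fun k => (bracket k : ℂ) * lam r k) 2 νF := by
  have hm : Measurable fun k => (bracket k : ℂ) * lam r k :=
    (Complex.continuous_ofReal.comp continuous_bracket).measurable.mul (measurable_lam h.integrable)
  refine (h.memLp_lam.norm.add h.memLp_FTr.norm).of_le hm.aestronglyMeasurable ?_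
  filter_upwards [waveSq_ne_zero_ae] with k hk
  have hw := waveSq_nonneg k
  have hs : Real.sqrt (waveSq k) ≠ 0 := (Real.sqrt_pos.2 (lt_of_le_of_ne hw hk.symm)).ne'
  have e1 : ‖FTr r k‖ = Real.sqrt (waveSq k) * ‖lam r k‖ := by
    rw [lam, norm_div, Complex.norm_real, Real.norm_of_nonneg (Real.sqrt_nonneg _)]
    field_simp
  have hb : bracket k ≤ 1 + Real.sqrt (waveSq k) := by
    refine Real.sqrt_le_iff.2 ⟨by positivity, ?_⟩
    nlinarith [Real.sq_sqrt hw, Real.sqrt_nonneg (waveSq k)]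
  rw [norm_mul, Complex.norm_real, Real.norm_of_nonneg (bracket_pos k).le, Pi.add_apply, e1,
    Real.norm_of_nonneg (by positivity)]
  nlinarith [norm_nonneg (lam r k)]

/-- A majorant in which x enters only through `growth`. The growth bound, the continuity of the
potential and Fubini for its pairings all rest on it. -/
theorem IsCharge.exists_dominator {r : Slab → ℝ} (h : IsCharge r) :
    ∃ H : Freq → ℝ, Integrable H νF ∧ (∀ k, 0 ≤ H k) ∧
      ∀ k x, ‖(conj (character k x) - discInd k) * potMult r k‖ ≤ growth x * H k := by
  have hW0 : ∀ k, 0 ≤ kernelWeight k := fun k => by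
    have := waveSq_nonneg k
    exact add_nonneg (Set.indicator_nonneg (fun _ _ => Real.sqrt_nonneg _) _) (by positivity)
  refine ⟨fun k => 2 * (kernelWeight k * ‖(bracket k : ℂ) * lam r k‖),
    (memLp_kernelWeight.integrable_mul h.memLp_bracket_mul_lam.norm).const_mul 2,
    fun k => by have := hW0 k; positivity, fun k x => ?_⟩
  simp only [norm_mul, norm_potMult, Complex.norm_real, Real.norm_of_nonneg (bracket_pos k).le]
  calc _ = ‖conj (character k x) - discInd k‖ * (Real.sqrt (waveSq k))⁻¹ * ‖lam r k‖ := by ring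
    _ ≤ 2 * growth x * (kernelWeight k * bracket k) * ‖lam r k‖ := by
        exact mul_le_mul_of_nonneg_right (norm_conj_character_sub_le k x) (norm_nonneg _)
    _ = _ := by ring

theorem norm_inv_two_pi_le : ‖(1 / (2 * Real.pi) : ℂ)‖ ≤ 1 := by
  rw [norm_div, norm_one, norm_mul, Complex.norm_real, Real.norm_of_nonneg Real.pi_pos.le,
    Complex.norm_ofNat, div_le_one (by positivity)]
  linarith [Real.pi_gt_three]

theorem measurable_kernel {r : Slab → ℝ} (h1 : Integrable r) :
    Measurable fun p : Slab × Freq => (conj (character p.2 p.1) - discInd p.2) * potMult r p.2 := by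
  have h2 : Continuous fun p : Slab × Freq => conj (character p.2 p.1) :=
    Complex.continuous_conj.comp (continuous_character.comp continuous_swap)
  exact (h2.measurable.sub (measurable_discInd.comp measurable_snd)).mul
    ((measurable_potMult h1).comp measurable_snd)

namespace IsCharge

variable {r : Slab → ℝ}

theorem exists_norm_cpotential_le (h : IsCharge r) :
    ∃ C, ∀ x, ‖cpotential r x‖ ≤ C * growth x := by
  obtain ⟨H, hH, hH0, hb⟩ := h.exists_dominator
  refine ⟨∫ k, H k ∂νF, fun x => ?_⟩
  rw [cpotential, norm_mul]
  refine (mul_le_of_le_one_left (norm_nonneg _) norm_inv_two_pi_le).trans ?_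
  refine (norm_integral_le_of_norm_le (hH.const_mul (growth x))
    (Filter.Eventually.of_forall fun k => hb k x)).trans ?_
  rw [integral_const_mul, mul_comm]

theorem continuous_cpotential (h : IsCharge r) : Continuous (cpotential r) := by
  obtain ⟨H, hH, hH0, hb⟩ := h.exists_dominator
  refine continuous_const.mul (continuous_iff_continuousAt.2 fun x₀ => ?_)
  refine continuousAt_of_dominated (bound := fun k => (growth x₀ + 1) * H k)
    (Filter.Eventually.of_forall fun x => ?_) ?_ (hH.const_mul _)
    (Filter.Eventually.of_forall fun k => ?_)
  · exact ((measurable_kernel h.integrable).comp measurable_prodMk_left).aestronglyMeasurable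
  · filter_upwards [continuous_growth.continuousAt.eventually
      (gt_mem_nhds (lt_add_one (growth x₀)))] with x hx
    refine Filter.Eventually.of_forall fun k => (hb k x).trans ?_
    exact mul_le_mul_of_nonneg_right hx.le (hH0 k)
  · refine Continuous.continuousAt ?_
    exact ((Complex.continuous_conj.comp (continuous_character_right k)).sub
      continuous_const).mul continuous_const

/-- The pairing of the potential with a charge density, in Fourier variables. -/
theorem integral_smul_cpotential (h : IsCharge r) {q : Slab → ℝ} (hq : Integrable q)
    (hqg : Integrable fun x => growth x * q x) :
    ∫ x, q x • cpotential r x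
      = ∫ k, (conj (FTr q k) - discInd k * conj (FTr q (0, 0))) * potMult r k ∂νF := by
  obtain ⟨H, hH, hH0, hb⟩ := h.exists_dominator
  have hi : Integrable (fun p : Slab × Freq =>
      (q p.1 : ℂ) * ((conj (character p.2 p.1) - discInd p.2) * potMult r p.2))
      ((volume : Measure Slab).prod νF) := by
    refine (hqg.norm.mul_prod hH).mono' ?_ (Filter.Eventually.of_forall fun p => ?_)
    · exact hq.ofReal.aestronglyMeasurable.comp_fst.mul
        (measurable_kernel h.integrable).aestronglyMeasurable
    · rw [norm_mul, Complex.norm_real, norm_mul (growth p.1),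
        Real.norm_of_nonneg (zero_le_one.trans (one_le_growth p.1)), mul_comm (growth p.1), mul_assoc]
      exact mul_le_mul_of_nonneg_left (hb p.2 p.1) (norm_nonneg _)
  have hcq : Integrable fun x => (q x : ℂ) := hq.ofReal
  calc ∫ x, q x • cpotential r x
      = (1 / (2 * Real.pi) : ℂ) *
        ∫ x, ∫ k, (q x : ℂ) * ((conj (character k x) - discInd k) * potMult r k) ∂νF := by
        rw [← integral_const_mul]
        refine integral_congr_ae (Filter.Eventually.of_forall fun x => ?_)
        simp only [cpotential, Complex.real_smul, integral_const_mul]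
        ring
    _ = (1 / (2 * Real.pi) : ℂ) *
        ∫ k, (∫ x, (q x : ℂ) * ((conj (character k x) - discInd k) * potMult r k)) ∂νF := by
        rw [integral_integral_swap hi]
    _ = _ := by
        rw [← integral_const_mul]
        refine integral_congr_ae (Filter.Eventually.of_forall fun k => ?_)
        simp only
        have e0 : ∀ x, character (0, (0 : ℝ × ℝ)) x = 1 := by simp [character]
        have hc : Integrable fun x => conj (character k x) * (q x : ℂ) := by
          have h1 := Complex.conjCLE.toContinuousLinearMap.integrable_comp
            (integrable_character_mul hcq k)
          refine h1.congr (Filter.Eventually.of_forall fun x => ?_)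
          simp
        have e1 : ∫ x, (q x : ℂ) * ((conj (character k x) - discInd k) * potMult r k)
            = ((∫ x, conj (character k x) * (q x : ℂ)) - discInd k * ∫ x, (q x : ℂ))
              * potMult r k := by
          rw [← integral_const_mul, ← integral_sub hc (hcq.const_mul _), ← integral_mul_const]
          refine integral_congr_ae (Filter.Eventually.of_forall fun x => ?_)
          simp only; ring
        have ec : conj (1 / (2 * Real.pi) : ℂ) = 1 / (2 * Real.pi) := by
          rw [map_div₀, map_one, map_mul, Complex.conj_ofReal, Complex.conj_ofNat]
        have e2 : conj (FTr q k)
            = (1 / (2 * Real.pi) : ℂ) * ∫ x, conj (character k x) * (q x : ℂ) := by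
          rw [FTr, FT, map_mul, ec, ← integral_conj]
          simp
        have e3 : conj (FTr q (0, 0)) = (1 / (2 * Real.pi) : ℂ) * ∫ x, (q x : ℂ) := by
          rw [FTr, FT, map_mul, ec, ← integral_conj]
          simp [e0]
        rw [e1, e2, e3]; ring

end IsCharge

/-- The Fourier transform of the `j`-th derivative of the potential. -/
def fieldMult (r : Slab → ℝ) (j : Fin 3) (k : Freq) : ℂ :=
  -(Complex.I * wave j k) * potMult r k

/-- One factor of the wave vector against |k|⁻² leaves |k|⁻¹, so finite Coulomb energy is exactly
what puts the gradient of the potential in L². -/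
theorem norm_fieldMult_le (r : Slab → ℝ) (j : Fin 3) (k : Freq) :
    ‖fieldMult r j k‖ ≤ ‖lam r k‖ := by
  rw [fieldMult, norm_mul, norm_potMult, norm_neg, norm_mul, Complex.norm_I, one_mul,
    Complex.norm_real, Real.norm_eq_abs, mul_left_comm]
  refine mul_le_of_le_one_right (norm_nonneg _) ?_
  exact mul_inv_le_one_of_le₀ (Real.abs_le_sqrt (sq_wave_le j k)) (Real.sqrt_nonneg _)

theorem measurable_fieldMult {r : Slab → ℝ} (h1 : Integrable r) (j : Fin 3) :
    Measurable (fieldMult r j) :=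
  (continuous_const.mul (continuous_wave_ofReal j)).neg.measurable.mul (measurable_potMult h1)

/-- Two factors of the wave vector cancel |k|⁻², so second derivatives are controlled by the charge
density itself in L². -/
theorem norm_wave_mul_fieldMult_le (r : Slab → ℝ) (i j : Fin 3) (k : Freq) :
    ‖-(Complex.I * wave i k) * fieldMult r j k‖ ≤ ‖FTr r k‖ := by
  have h1 := norm_fieldMult_le r j k
  rw [norm_mul, norm_neg, norm_mul, Complex.norm_I, one_mul, Complex.norm_real, Real.norm_eq_abs]
  have h2 : |wave i k| ≤ Real.sqrt (waveSq k) := Real.abs_le_sqrt (sq_wave_le i k)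
  calc |wave i k| * ‖fieldMult r j k‖ ≤ Real.sqrt (waveSq k) * ‖lam r k‖ := by gcongr
    _ = ‖FTr r k‖ * (Real.sqrt (waveSq k) / Real.sqrt (waveSq k)) := by
        rw [lam, norm_div, Complex.norm_real, Real.norm_of_nonneg (Real.sqrt_nonneg _)]; ring
    _ ≤ _ := mul_le_of_le_one_right (norm_nonneg _) (div_self_le_one _)

/-- The real potential of a charge density. -/
def potential (r : Slab → ℝ) (x : Slab) : ℝ := (cpotential r x).re

/-- The `j`-th partial derivative of the potential. -/
def field (r : Slab → ℝ) (j : Fin 3) (x : Slab) : ℝ := (F2inv (fieldMult r j) x).re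

/-- The second partial derivatives of the potential. -/
def fieldGrad (r : Slab → ℝ) (i j : Fin 3) (x : Slab) : ℝ :=
  (F2inv (fun k => -(Complex.I * wave i k) * fieldMult r j k) x).re

theorem memLp_field (r : Slab → ℝ) (j : Fin 3) : MemLp (field r j) 2 := (memLp_F2inv _).re

theorem memLp_fieldGrad (r : Slab → ℝ) (i j : Fin 3) : MemLp (fieldGrad r i j) 2 :=
  (memLp_F2inv _).re

namespace IsCharge

variable {r : Slab → ℝ}

theorem memLp_fieldMult (h : IsCharge r) (j : Fin 3) : MemLp (fieldMult r j) 2 νF :=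
  h.memLp_lam.of_le (measurable_fieldMult h.integrable j).aestronglyMeasurable
    (Filter.Eventually.of_forall (norm_fieldMult_le r j))

theorem memLp_wave_mul_fieldMult (h : IsCharge r) (i j : Fin 3) :
    MemLp (fun k => -(Complex.I * wave i k) * fieldMult r j k) 2 νF :=
  h.memLp_FTr.of_le ((continuous_const.mul (continuous_wave_ofReal i)).neg.measurable.mul
    (measurable_fieldMult h.integrable j)).aestronglyMeasurable
    (Filter.Eventually.of_forall (norm_wave_mul_fieldMult_le r i j))

/-- The renormalization subtracts a term independent of x. It drops out because the transform of a
derivative of a test function vanishes at zero frequency. -/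
theorem hasWeakDeriv_cpotential (h : IsCharge r) (j : Fin 3) :
    HasWeakDeriv j (cpotential r) (F2inv (fieldMult r j)) := by
  have hg := memLp_F2inv (fieldMult r j)
  refine ⟨h.continuous_cpotential.locallyIntegrable, hg.locallyIntegrable (by norm_num),
    fun η hη => ?_⟩
  have ht := hη.test_pderiv j
  have hgr : Integrable fun x => growth x * pderiv j η x := by
    have := ht.integrable_smul continuous_growth.locallyIntegrable
    simpa [mul_comm] using this
  rw [h.integral_smul_cpotential ht.integrable hgr, integral_test_smul hη hg, ← integral_neg]
  have h0 : FTr (pderiv j η) (0, 0) = 0 := by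
    rw [FTr_pderiv hη]
    have : wave j (0, 0) = 0 := by fin_cases j <;> simp [wave]
    simp [this]
  refine integral_congr_ae ?_
  filter_upwards [F2_F2inv (h.memLp_fieldMult j)] with k hk
  rw [h0, hk, FTr_pderiv hη, fieldMult]
  simp only [map_neg, map_mul, Complex.conj_I, Complex.conj_ofReal, map_zero, mul_zero, sub_zero]
  ring

theorem hasWeakDeriv_F2inv_fieldMult (h : IsCharge r) (i j : Fin 3) :
    HasWeakDeriv i (F2inv (fieldMult r j))
      (F2inv fun k => -(Complex.I * wave i k) * fieldMult r j k) := by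
  refine hasWeakDeriv_of_F2 i (memLp_F2inv _) (memLp_F2inv _) ?_
  filter_upwards [F2_F2inv (h.memLp_fieldMult j), F2_F2inv (h.memLp_wave_mul_fieldMult i j)]
    with k h1 h2
  rw [h1, h2]

theorem hasWeakDeriv_potential (h : IsCharge r) (j : Fin 3) :
    HasWeakDeriv j (potential r) (field r j) :=
  (h.hasWeakDeriv_cpotential j).clm_comp Complex.reCLM

theorem hasWeakDeriv_field (h : IsCharge r) (i j : Fin 3) :
    HasWeakDeriv i (field r j) (fieldGrad r i j) :=
  (h.hasWeakDeriv_F2inv_fieldMult i j).clm_comp Complex.reCLM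

/-- On the Fourier side the squares of the wave components sum to |k|², which cancels the
denominator away from the null set k = 0. -/
theorem sum_fieldGrad (h : IsCharge r) : ∀ᵐ x, -∑ i, fieldGrad r i i x = r x := by
  set g : Fin 3 → Slab → ℂ := fun i => F2inv fun k => -(Complex.I * wave i k) * fieldMult r i k
    with hg
  have hgm : ∀ i, MemLp (g i) 2 := fun i => memLp_F2inv _
  have key : (fun x => g 0 x + (g 1 x + g 2 x)) =ᵐ[volume] fun x => (-1 : ℂ) * (r x : ℂ) := by
    refine ae_eq_of_F2 ((hgm 0).add ((hgm 1).add (hgm 2))) (h.memLp.ofReal.const_mul (-1)) ?_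
    filter_upwards [F2_add (hgm 0) ((hgm 1).add (hgm 2)), F2_add (hgm 1) (hgm 2),
      F2_const_mul (-1) (h.memLp.ofReal (K := ℂ)), F2_ae_eq h.integrable.ofReal h.memLp.ofReal,
      F2_F2inv (h.memLp_wave_mul_fieldMult 0 0), F2_F2inv (h.memLp_wave_mul_fieldMult 1 1),
      F2_F2inv (h.memLp_wave_mul_fieldMult 2 2), waveSq_ne_zero_ae] with k a1 a2 a3 a4 b0 b1 b2 hk
    erw [a1, a2, a3, a4]
    simp only [hg]
    rw [b0, b1, b2]
    have e : (waveSq k : ℂ) = (wave 0 k : ℂ) ^ 2 + (wave 1 k : ℂ) ^ 2 + (wave 2 k : ℂ) ^ 2 := by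
      rw [waveSq_eq_sum, Fin.sum_univ_three]; push_cast; rfl
    have hk' : (waveSq k : ℂ) ≠ 0 := Complex.ofReal_ne_zero.2 hk
    have e2 : FTr r k = waveSq k * potMult r k := by rw [potMult]; field_simp
    have e3 : FT (fun x => (r x : ℂ)) k = waveSq k * potMult r k := e2
    rw [show FT (fun x => (RCLike.ofReal (r x) : ℂ)) k = waveSq k * potMult r k from e3, e]
    simp only [fieldMult]
    linear_combination (potMult r k * ((wave 0 k : ℂ) ^ 2 + (wave 1 k : ℂ) ^ 2 + (wave 2 k : ℂ) ^ 2)) * Complex.I_sq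
  filter_upwards [key] with x hx
  have hx2 := congrArg Complex.re hx
  simp only [Fin.sum_univ_three, fieldGrad]
  simp only [hg, Complex.add_re, neg_one_mul, Complex.neg_re, Complex.ofReal_re] at hx2
  linarith

theorem continuous_potential (h : IsCharge r) : Continuous (potential r) :=
  Complex.continuous_re.comp h.continuous_cpotential

theorem exists_abs_potential_le (h : IsCharge r) : ∃ C, ∀ x, |potential r x| ≤ C * growth x := by
  obtain ⟨C, hC⟩ := h.exists_norm_cpotential_le
  exact ⟨C, fun x => (Complex.abs_re_le_norm _).trans (hC x)⟩

end IsCharge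

/-! ### Local square integrability and membership in `InH2loc`. -/

section Local

variable {E : Type*} [NormedAddCommGroup E]

theorem inL2loc_of_memLp {f : Slab → E} (h : MemLp f 2) : InL2loc f := fun _ _ => h.restrict _

theorem inL2loc_of_continuous {f : Slab → E} (h : Continuous f) : InL2loc f := by
  intro K hK
  have : IsFiniteMeasure (volume.restrict K) := ⟨by simpa using hK.measure_lt_top⟩
  obtain ⟨C, hC⟩ := hK.exists_bound_of_continuousOn h.continuousOn
  exact MemLp.of_bound h.aestronglyMeasurable C (ae_restrict_of_forall_mem hK.measurableSet hC)

theorem InL2loc.congr {f g : Slab → E} (h : InL2loc f) (hfg : f =ᵐ[volume] g) : InL2loc g :=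
  fun K hK => (memLp_congr_ae (ae_restrict_of_ae hfg)).1 (h K hK)

end Local

/-- Iterated `weakDeriv` differentiates a chosen representative, so explicit derivatives have to be
carried across a.e. equalities at each order. -/
theorem inH2loc_of_hasWeakDeriv_real {f : Slab → ℝ} {g : Fin 3 → Slab → ℝ}
    {g2 : Fin 3 → Fin 3 → Slab → ℝ} (hf : InL2loc f) (hg : ∀ i, HasWeakDeriv i f (g i))
    (hg' : ∀ i, InL2loc (g i)) (hg2 : ∀ j i, HasWeakDeriv j (g i) (g2 j i))
    (hg2' : ∀ j i, InL2loc (g2 j i)) :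
    InH2loc f ∧ weakLaplacian f =ᵐ[volume] fun x => ∑ i, g2 i i x := by
  have e1 : ∀ i, weakDeriv i f =ᵐ[volume] g i := fun i => (hg i).weakDeriv_ae_eq_real
  have w2 : ∀ j i, HasWeakDeriv j (weakDeriv i f) (g2 j i) := fun j i =>
    (hg2 j i).congr (e1 i).symm (Filter.EventuallyEq.refl _ _)
  have e2 : ∀ j i, weakDeriv j (weakDeriv i f) =ᵐ[volume] g2 j i := fun j i =>
    (w2 j i).weakDeriv_ae_eq_real
  refine ⟨⟨hf, fun i => ⟨⟨_, hg i⟩, (hg' i).congr (e1 i).symm, fun j =>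
    ⟨⟨_, w2 j i⟩, (hg2' j i).congr (e2 j i).symm⟩⟩⟩, ?_⟩
  filter_upwards [ae_all_iff.2 fun i => e2 i i] with x hx
  simp only [weakLaplacian, hx]

theorem inH2loc_of_hasWeakDeriv {f : Slab → ℂ} {g : Fin 3 → Slab → ℂ}
    {g2 : Fin 3 → Fin 3 → Slab → ℂ} (hf : InL2loc f) (hg : ∀ i, HasWeakDeriv i f (g i))
    (hg' : ∀ i, InL2loc (g i)) (hg2 : ∀ j i, HasWeakDeriv j (g i) (g2 j i))
    (hg2' : ∀ j i, InL2loc (g2 j i)) :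
    InH2loc f ∧ weakLaplacian f =ᵐ[volume] fun x => ∑ i, g2 i i x := by
  have e1 : ∀ i, weakDeriv i f =ᵐ[volume] g i := fun i => (hg i).weakDeriv_ae_eq
  have w2 : ∀ j i, HasWeakDeriv j (weakDeriv i f) (g2 j i) := fun j i =>
    (hg2 j i).congr (e1 i).symm (Filter.EventuallyEq.refl _ _)
  have e2 : ∀ j i, weakDeriv j (weakDeriv i f) =ᵐ[volume] g2 j i := fun j i =>
    (w2 j i).weakDeriv_ae_eq
  refine ⟨⟨hf, fun i => ⟨⟨_, hg i⟩, (hg' i).congr (e1 i).symm, fun j =>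
    ⟨⟨_, w2 j i⟩, (hg2' j i).congr (e2 j i).symm⟩⟩⟩, ?_⟩
  filter_upwards [ae_all_iff.2 fun i => e2 i i] with x hx
  simp only [weakLaplacian, hx]

namespace IsCharge

variable {r : Slab → ℝ}

theorem inH2loc_potential (h : IsCharge r) :
    InH2loc (potential r) ∧ ∀ᵐ x, -weakLaplacian (potential r) x = r x := by
  obtain ⟨h1, h2⟩ := inH2loc_of_hasWeakDeriv_real (inL2loc_of_continuous h.continuous_potential)
    h.hasWeakDeriv_potential (fun i => inL2loc_of_memLp (memLp_field r i)) h.hasWeakDeriv_field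
    (fun j i => inL2loc_of_memLp (memLp_fieldGrad r j i))
  refine ⟨h1, ?_⟩
  filter_upwards [h2, h.sum_fieldGrad] with x a b
  rw [a, b]

/-- The Coulomb product with a neutral charge density that decays. -/
theorem re_integral_lam (h : IsCharge r) {q : Slab → ℝ} (hq : Integrable q)
    (hq0 : ∫ x, q x = 0) (hqg : Integrable fun x => growth x * q x) :
    (∫ k, conj (lam q k) * lam r k ∂νF).re = ∫ x, q x * potential r x := by
  have h1 := h.integral_smul_cpotential hq hqg
  rw [FTr_zero, hq0] at h1
  have h2 : ∫ k, conj (lam q k) * lam r k ∂νF = ∫ x, q x • cpotential r x := by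
    rw [h1]
    refine integral_congr_ae (Filter.Eventually.of_forall fun k => ?_)
    simp only [lam, potMult, map_div₀, Complex.conj_ofReal, zero_div, Complex.ofReal_zero, map_zero,
      mul_zero, sub_zero]
    rw [div_mul_div_comm, ← Complex.ofReal_mul, Real.mul_self_sqrt (waveSq_nonneg k), mul_div_assoc]
  obtain ⟨C, hC⟩ := h.exists_norm_cpotential_le
  have hi : Integrable fun x => q x • cpotential r x := by
    refine (hqg.norm.mul_const C).mono'
      (hq.aestronglyMeasurable.smul h.continuous_cpotential.aestronglyMeasurable)
      (Filter.Eventually.of_forall fun x => ?_)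
    rw [norm_smul, norm_mul, Real.norm_of_nonneg (zero_le_one.trans (one_le_growth x))]
    nlinarith [hC x, norm_nonneg (q x)]
  rw [h2, ← Complex.reCLM_apply, ← ContinuousLinearMap.integral_comp_comm _ hi]
  refine integral_congr_ae (Filter.Eventually.of_forall fun x => ?_)
  simp [potential]

end IsCharge

/-! ### Weak sequential compactness -/

/-- Sequential Banach–Alaoglu in the dual of a separable space, transported by Riesz; the
conjugation only moves the fixed vector to the conjugate-linear slot. -/
theorem exists_weak_limit_hilbert {H : Type*} [NormedAddCommGroup H] [InnerProductSpace ℂ H]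
    [CompleteSpace H] [TopologicalSpace.SeparableSpace H] {x : ℕ → H} {M : ℝ}
    (hx : ∀ n, ‖x n‖ ≤ M) :
    ∃ g : H, ∃ φ : ℕ → ℕ, StrictMono φ ∧
      ∀ w, Filter.Tendsto (fun n => (inner ℂ w (x (φ n)) : ℂ)) Filter.atTop (𝓝 (inner ℂ w g)) := by
  let y : ℕ → WeakDual ℂ H := fun n => StrongDual.toWeakDual (InnerProductSpace.toDual ℂ H (x n))
  obtain ⟨z, -, φ, hφ, hlim⟩ := WeakDual.isSeqCompact_closedBall ℂ H 0 M (x := y) fun n => by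
    show InnerProductSpace.toDual ℂ H (x n) ∈ Metric.closedBall 0 M
    rw [mem_closedBall_zero_iff, LinearIsometryEquiv.norm_map]
    exact hx n
  refine ⟨(InnerProductSpace.toDual ℂ H).symm (WeakDual.toStrongDual z), φ, hφ, fun w => ?_⟩
  have h1 := ((WeakDual.eval_continuous w).tendsto z).comp hlim
  have h2 := (Complex.continuous_conj.tendsto _).comp h1
  have e1 : (inner ℂ w ((InnerProductSpace.toDual ℂ H).symm (WeakDual.toStrongDual z)) : ℂ)
      = conj (z w) := by
    rw [← inner_conj_symm, InnerProductSpace.toDual_symm_apply]; rfl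
  rw [e1]
  refine h2.congr fun n => ?_
  rw [← inner_conj_symm w]; rfl

theorem exists_weak_limit {G : ℕ → Freq → ℂ} (hG : ∀ n, MemLp (G n) 2 νF) {M : ℝ}
    (hM : ∀ n, ∫ k, ‖G n k‖ ^ 2 ∂νF ≤ M) :
    ∃ g : Freq → ℂ, MemLp g 2 νF ∧ ∃ φ : ℕ → ℕ, StrictMono φ ∧ ∀ w : Freq → ℂ, MemLp w 2 νF →
      Filter.Tendsto (fun n => ∫ k, w k * G (φ n) k ∂νF) Filter.atTop (𝓝 (∫ k, w k * g k ∂νF)) := by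
  have hfact : Fact ((2 : ℝ≥0∞) ≠ ⊤) := ⟨by norm_num⟩
  have hb : ∀ n, ‖(hG n).toLp (G n)‖ ≤ Real.sqrt M := by
    intro n
    refine Real.le_sqrt_of_sq_le ?_
    rw [← inner_self_eq_norm_sq (𝕜 := ℂ), inner_toLp_eq (hG n) (hG n)]
    refine le_trans (le_of_eq ?_) (hM n)
    have : ∀ k, conj (G n k) * G n k = ((‖G n k‖ ^ 2 : ℝ) : ℂ) := fun k => by
      rw [mul_comm, Complex.mul_conj, Complex.normSq_eq_norm_sq]
    simp only [this]
    rw [integral_complex_ofReal]; rfl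
  obtain ⟨g, φ, hφ, h⟩ := exists_weak_limit_hilbert hb
  refine ⟨g, Lp.memLp g, φ, hφ, fun w hw => ?_⟩
  have hw' : MemLp (fun k => conj (w k)) 2 νF := hw.star
  have e : ∀ {f : Freq → ℂ} (hf : MemLp f 2 νF),
      (inner ℂ (hw'.toLp _) (hf.toLp f) : ℂ) = ∫ k, w k * f k ∂νF := fun hf => by
    rw [inner_toLp_eq hw' hf]; simp
  have h1 := h (hw'.toLp _)
  simp only [e] at h1
  rwa [← Lp.toLp_coeFn g (Lp.memLp g), e (Lp.memLp g)] at h1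

/-! ### States of finite kinetic energy -/

theorem hasWeakDeriv_fun_weakDeriv {ψ : Slab → ℂ} (h : InH1 ψ) (i : Fin 3) :
    HasWeakDeriv i ψ (weakDeriv i ψ) := hasWeakDeriv_weakDeriv (h.2 i).1

/-- The Dirichlet integral. -/
def dirichlet (ψ : Slab → ℂ) : ℝ := ∑ i : Fin 3, ∫ x, ‖weakDeriv i ψ x‖ ^ 2

theorem measurable_bracket_mul_F2 (ψ : Slab → ℂ) :
    Measurable fun k => (bracket k : ℂ) * F2 ψ k :=
  (Complex.continuous_ofReal.comp continuous_bracket).measurable.mul (measurable_F2 ψ)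

theorem norm_bracket_mul_sq (z : ℂ) (k : Freq) :
    ‖(bracket k : ℂ) * z‖ ^ 2 = ‖z‖ ^ 2 + ∑ i : Fin 3, ‖-(Complex.I * wave i k) * z‖ ^ 2 := by
  have h1 : ∀ i : Fin 3, ‖-(Complex.I * wave i k) * z‖ ^ 2 = wave i k ^ 2 * ‖z‖ ^ 2 := fun i => by
    rw [norm_mul, norm_neg, norm_mul, Complex.norm_I, one_mul, Complex.norm_real, mul_pow,
      Real.norm_eq_abs, sq_abs]
  simp only [h1]
  rw [← Finset.sum_mul, ← waveSq_eq_sum, norm_mul, mul_pow, Complex.norm_real, Real.norm_eq_abs,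
    sq_abs, bracket_sq]
  ring

namespace InH1

variable {ψ : Slab → ℂ}

theorem F2_weakDeriv (h : InH1 ψ) (i : Fin 3) :
    F2 (weakDeriv i ψ) =ᵐ[νF] fun k => -(Complex.I * wave i k) * F2 ψ k :=
  (hasWeakDeriv_fun_weakDeriv h i).F2_ae_eq h.1 (h.2 i).2

theorem ae_norm_bracket_mul_sq (h : InH1 ψ) : ∀ᵐ k ∂νF, ‖(bracket k : ℂ) * F2 ψ k‖ ^ 2
    = ‖F2 ψ k‖ ^ 2 + ∑ i : Fin 3, ‖F2 (weakDeriv i ψ) k‖ ^ 2 := by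
  filter_upwards [ae_all_iff.2 h.F2_weakDeriv] with k hk
  rw [norm_bracket_mul_sq]
  simp only [hk]

theorem integrable_bracket_sq (h : InH1 ψ) :
    Integrable (fun k => ‖(bracket k : ℂ) * F2 ψ k‖ ^ 2) νF := by
  have h1 : Integrable (fun k => ‖F2 ψ k‖ ^ 2 + ∑ i : Fin 3, ‖F2 (weakDeriv i ψ) k‖ ^ 2) νF :=
    ((memLp_F2 ψ).integrable_norm_pow two_ne_zero).add
      (integrable_finsetSum _ fun i _ => (memLp_F2 _).integrable_norm_pow two_ne_zero)
  exact h1.congr (by filter_upwards [h.ae_norm_bracket_mul_sq] with k hk using hk.symm)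

theorem memLp_bracket (h : InH1 ψ) : MemLp (fun k => (bracket k : ℂ) * F2 ψ k) 2 νF := by
  rw [← memLp_norm_iff (measurable_bracket_mul_F2 ψ).aestronglyMeasurable,
    memLp_two_iff_integrable_sq (measurable_bracket_mul_F2 ψ).norm.aestronglyMeasurable]
  exact h.integrable_bracket_sq

/-- Mass plus kinetic energy becomes one Hilbert norm, for which weak compactness and lower
semicontinuity are at hand. -/
theorem integral_bracket_sq (h : InH1 ψ) :
    ∫ k, ‖(bracket k : ℂ) * F2 ψ k‖ ^ 2 ∂νF = (∫ x, ‖ψ x‖ ^ 2) + dirichlet ψ := by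
  rw [integral_congr_ae h.ae_norm_bracket_mul_sq,
    integral_add ((memLp_F2 ψ).integrable_norm_pow two_ne_zero)
      (integrable_finsetSum _ fun i _ => (memLp_F2 _).integrable_norm_pow two_ne_zero),
    integral_finsetSum _ fun i _ => (memLp_F2 _).integrable_norm_pow two_ne_zero,
    integral_norm_sq_F2 h.1, dirichlet]
  congr 1
  exact Finset.sum_congr rfl fun i _ => integral_norm_sq_F2 (h.2 i).2

theorem F2_eq_bracket_inv (ψ : Slab → ℂ) :
    F2 ψ =ᵐ[νF] fun k => (bracket k : ℂ)⁻¹ * ((bracket k : ℂ) * F2 ψ k) :=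
  Filter.Eventually.of_forall fun k => by
    have : (bracket k : ℂ) ≠ 0 := Complex.ofReal_ne_zero.2 (bracket_pos k).ne'
    simp only
    rw [inv_mul_cancel_left₀ this]

theorem of_memLp_bracket (h1 : MemLp ψ 2) (h2 : MemLp (fun k => (bracket k : ℂ) * F2 ψ k) 2 νF) :
    InH1 ψ := by
  have h3 : ∀ i : Fin 3, MemLp (fun k => -(Complex.I * wave i k) * F2 ψ k) 2 νF := fun i => by
    refine h2.of_le ((continuous_const.mul (continuous_wave_ofReal i)).neg.measurable.mul
      (measurable_F2 ψ)).aestronglyMeasurable (Filter.Eventually.of_forall fun k => ?_)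
    rw [norm_mul, norm_mul, norm_neg, norm_mul, Complex.norm_I, one_mul, Complex.norm_real,
      Complex.norm_real, Real.norm_eq_abs, Real.norm_of_nonneg (bracket_pos k).le]
    exact mul_le_mul_of_nonneg_right (abs_wave_le_bracket i k) (norm_nonneg _)
  have h4 : ∀ i, HasWeakDeriv i ψ (F2inv fun k => -(Complex.I * wave i k) * F2 ψ k) := fun i =>
    hasWeakDeriv_of_F2 i h1 (memLp_F2inv _) (F2_F2inv (h3 i))
  exact ⟨h1, fun i => ⟨⟨_, h4 i⟩, (memLp_congr_ae (h4 i).weakDeriv_ae_eq).2 (memLp_F2inv _)⟩⟩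

theorem memLp_four (h : InH1 ψ) : MemLp ψ 4 :=
  CrystalSlab.memLp_four h.1 h.memLp_bracket (F2_eq_bracket_inv ψ)

theorem integrable_norm_sq (h : InH1 ψ) : Integrable fun x => ‖ψ x‖ ^ 2 :=
  h.1.integrable_norm_pow two_ne_zero

theorem memLp_norm_sq (h : InH1 ψ) : MemLp (fun x => ‖ψ x‖ ^ 2) 2 := by
  have h1 := h.memLp_four.norm_rpow_div (2 : ℝ≥0∞)
  have e : (4 : ℝ≥0∞) / 2 = 2 := by
    rw [show (4 : ℝ≥0∞) = 2 * 2 by norm_num]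
    exact ENNReal.mul_div_cancel_right two_ne_zero (by norm_num)
  rw [e] at h1
  simpa using h1

end InH1

variable {e : ℝ} {σ : Slab → ℝ}

theorem ConditionI.integrable (hI : ConditionI σ) : Integrable σ := memLp_one_iff_integrable.1 hI.1

theorem integrable_chargeDensity (hI : ConditionI σ) {ψ : Slab → ℂ} (h : InH1 ψ) :
    Integrable (chargeDensity e σ ψ) := hI.integrable.sub (h.integrable_norm_sq.const_mul e)

theorem memLp_chargeDensity (hI : ConditionI σ) {ψ : Slab → ℂ} (h : InH1 ψ) :
    MemLp (chargeDensity e σ ψ) 2 := hI.2.sub (h.memLp_norm_sq.const_mul e)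

theorem kinetic_eq {ψ : Slab → ℂ} (h : InH1 ψ) {a : ℝ} (ha : 0 ≤ a) :
    ∫⁻ x, ENNReal.ofReal (a * ∑ i : Fin 3, ‖weakDeriv i ψ x‖ ^ 2)
      = ENNReal.ofReal (a * dirichlet ψ) := by
  have hi : Integrable fun x => ∑ i : Fin 3, ‖weakDeriv i ψ x‖ ^ 2 :=
    integrable_finsetSum _ fun i _ => (h.2 i).2.integrable_norm_pow two_ne_zero
  rw [← ofReal_integral_eq_lintegral_ofReal (hi.const_mul a)
    (Filter.Eventually.of_forall fun x => by positivity), integral_const_mul,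
    integral_finsetSum _ fun i _ => (h.2 i).2.integrable_norm_pow two_ne_zero]
  rfl

theorem dirichlet_nonneg (ψ : Slab → ℂ) : 0 ≤ dirichlet ψ :=
  Finset.sum_nonneg fun _ _ => integral_nonneg fun _ => by positivity

/-- The real-valued energy of a state of finite Coulomb energy. -/
def energyReal (ħ m e : ℝ) (σ : Slab → ℝ) (ψ : Slab → ℂ) : ℝ :=
  ħ ^ 2 / (2 * m) * dirichlet ψ + 1 / 2 * ∫ k, ‖lam (chargeDensity e σ ψ) k‖ ^ 2 ∂νF

theorem energyReal_nonneg {ħ m : ℝ} (hm : 0 < m) (ψ : Slab → ℂ) : 0 ≤ energyReal ħ m e σ ψ := by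
  have := dirichlet_nonneg ψ
  have h2 : 0 ≤ ∫ k, ‖lam (chargeDensity e σ ψ) k‖ ^ 2 ∂νF := integral_nonneg fun _ => by positivity
  unfold energyReal; positivity

theorem energy_eq {ħ m : ℝ} (hm : 0 < m) {ψ : Slab → ℂ} (h : InH1 ψ)
    (hc : IsCharge (chargeDensity e σ ψ)) :
    energy ħ m e σ ψ = ENNReal.ofReal (energyReal ħ m e σ ψ) := by
  have h0 := dirichlet_nonneg ψ
  have h2 : 0 ≤ ∫ k, ‖lam (chargeDensity e σ ψ) k‖ ^ 2 ∂νF := integral_nonneg fun _ => by positivity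
  rw [energy, kinetic_eq h (by positivity), hc.coulombNormSq_eq_ofReal, energyReal,
    ENNReal.ofReal_add (by positivity) (by positivity), ENNReal.ofReal_mul (p := 1 / 2) (by norm_num)]
  congr 2
  rw [ENNReal.ofReal_div_of_pos (by norm_num)]; simp

theorem isCharge_of_energy (hI : ConditionI σ) {ħ m : ℝ} {ψ : Slab → ℂ} (h : InH1 ψ)
    (he : energy ħ m e σ ψ ≠ ⊤) : IsCharge (chargeDensity e σ ψ) := by
  refine ⟨integrable_chargeDensity hI h, memLp_chargeDensity hI h, fun hc => he ?_⟩
  rw [energy, hc]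
  simp

/-! ### A reference state -/

theorem inH1_of_test {η : Slab → ℝ} (hη : IsTest η) : InH1 fun x => (η x : ℂ) := by
  have h1 : ∀ i, HasWeakDeriv i (fun x => (η x : ℂ)) fun x => (pderiv i η x : ℂ) := fun i =>
    (hη.isSmooth.hasWeakDeriv i).clm_comp Complex.ofRealCLM
  exact ⟨hη.memLp_ofReal, fun i => ⟨⟨_, h1 i⟩,
    (memLp_congr_ae (h1 i).weakDeriv_ae_eq).2 (hη.test_pderiv i).memLp_ofReal⟩⟩

theorem IsTest.integrable_moment {η : Slab → ℝ} (hη : IsTest η) :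
    Integrable fun x => (|x.2.1| + |x.2.2|) * η x := by
  have h := hη.integrable_smul
    (f := fun x : Slab => |x.2.1| + |x.2.2|) (by fun_prop : Continuous _).locallyIntegrable
  simpa [mul_comm] using h

theorem IsTest.const_mul {η : Slab → ℝ} (hη : IsTest η) (c : ℝ) : IsTest fun x => c * η x := by
  have := hη.mul_smooth (IsSmooth.const c)
  simpa [mul_comm] using this

theorem exists_test_norm_sq {Z : ℝ} (hZ : 0 < Z) :
    ∃ η : Slab → ℝ, IsTest η ∧ ∫ x, η x ^ 2 = Z := by
  let b : ContDiffBump (0 : ℝ × ℝ) := ⟨1, 2, by norm_num, by norm_num⟩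
  have hbt : IsTest fun x : Slab => b x.2 := isTest_comp_snd b.contDiff b.hasCompactSupport
  have hpos : 0 < ∫ x : Slab, b x.2 ^ 2 := by
    refine Continuous.integral_pos_of_hasCompactSupport_nonneg_nonzero (x := 0)
      (hbt.continuous.pow 2) (hbt.2.comp_left (g := fun y : ℝ => y ^ 2) (by simp))
      (fun x => by positivity) ?_
    have : b 0 = 1 := b.one_of_mem_closedBall (by simp [b])
    simp [this]
  refine ⟨fun x => Real.sqrt (Z / ∫ x : Slab, b x.2 ^ 2) * b x.2, hbt.const_mul _, ?_⟩
  simp only [mul_pow]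
  rw [integral_const_mul, Real.sq_sqrt (by positivity), div_mul_cancel₀ _ hpos.ne']

theorem IsTest.sq {η : Slab → ℝ} (hη : IsTest η) : IsTest fun x => η x ^ 2 := by
  simpa [_root_.sq] using hη.mul_smooth hη.isSmooth

/-- Both transforms have the same value eZ/(2π) at ξ = 0. Condition III controls the deviation of σ̂
from it, the first moment of n that of n̂, and the constants cancel in the difference. -/
theorem isCharge_sub_test (hI : ConditionI σ) (hIII : ConditionIII e σ)
    {n : Slab → ℝ} (hn : IsTest n) (hnZ : ∫ x, n x = chargeNumber e σ) :
    IsCharge fun x => σ x - e * n x := by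
  have hint : Integrable fun x => σ x + (-e) * n x := hI.integrable.add (hn.integrable.const_mul _)
  suffices h : IsCharge fun x => σ x + (-e) * n x by
    refine h.congr (Filter.Eventually.of_forall fun x => ?_)
    ring
  refine isCharge_of_memLp_disc hint (hI.2.add ((hn.memLp 2).const_mul _)) ?_
  have h1 := memLp_disc_of_bound (F := fun ξ => FTr n (0, ξ) - FTr n (0, 0))
    (C := ∫ x, ‖(|x.2.1| + |x.2.2|) * n x‖)
    (((measurable_FTr hn.integrable).comp measurable_prodMk_left).sub measurable_const)
    (norm_FTr_sub_le hn.integrable hn.integrable_moment)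
  refine (memLp_congr_ae (Filter.Eventually.of_forall fun ξ => ?_)).1
    (MemLp.add hIII (h1.const_mul (-e : ℂ)))
  simp only [Pi.add_apply]
  rw [IsCharge.FTr_add hI.integrable (hn.integrable.const_mul _), IsCharge.FTr_const_mul, FTr_zero,
    hnZ, fourierT_eq, FTr]
  push_cast
  ring

/-! ### Existence of a minimizer -/

/-- The convex function |·|² lies above its tangent. Integrated, this is linear in the second
argument and so passes to weak limits, giving lower semicontinuity. -/
theorem norm_sq_ge_tangent (a b : ℂ) : ‖a‖ ^ 2 + 2 * (conj a * (b - a)).re ≤ ‖b‖ ^ 2 := by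
  have e1 : ‖b‖ ^ 2 = ‖a‖ ^ 2 + 2 * (conj a * (b - a)).re + ‖b - a‖ ^ 2 := by
    rw [← Complex.normSq_eq_norm_sq, ← Complex.normSq_eq_norm_sq, ← Complex.normSq_eq_norm_sq]
    simp only [Complex.normSq_apply, Complex.mul_re, Complex.conj_re, Complex.conj_im,
      Complex.sub_re, Complex.sub_im]
    ring
  nlinarith [sq_nonneg ‖b - a‖]

theorem integral_norm_sq_ge_tangent {a b : Freq → ℂ} (ha : MemLp a 2 νF) (hb : MemLp b 2 νF) :
    (∫ k, ‖a k‖ ^ 2 ∂νF) +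
      2 * ((∫ k, conj (a k) * b k ∂νF) - ∫ k, conj (a k) * a k ∂νF).re ≤ ∫ k, ‖b k‖ ^ 2 ∂νF := by
  have hs : MemLp (fun k => conj (a k)) 2 νF := ha.star
  have i1 : Integrable (fun k => conj (a k) * b k) νF := hs.integrable_mul hb
  have i2 : Integrable (fun k => conj (a k) * a k) νF := hs.integrable_mul ha
  have i3 : Integrable (fun k => conj (a k) * b k - conj (a k) * a k) νF := i1.sub i2
  have i4 := (Complex.reCLM.integrable_comp i3).const_mul 2
  have i5 := ha.integrable_norm_pow two_ne_zero
  rw [← integral_sub i1 i2, ← Complex.reCLM_apply, ← ContinuousLinearMap.integral_comp_comm _ i3,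
    ← integral_const_mul, ← integral_add i5 i4]
  refine integral_mono (i5.add i4) (hb.integrable_norm_pow two_ne_zero) fun k => ?_
  have := norm_sq_ge_tangent (a k) (b k)
  rwa [mul_sub] at this

theorem integral_test_smul_real {η r : Slab → ℝ} (hη : IsTest η) (h1 : Integrable r)
    (h2 : MemLp r 2) : ((∫ x, η x * r x : ℝ) : ℂ) = ∫ k, conj (FTr η k) * FTr r k ∂νF := by
  have h3 := integral_test_smul hη (h2.ofReal (K := ℂ))
  have h4 : ∫ k, conj (FTr η k) * F2 (fun x => ((r x : ℝ) : ℂ)) k ∂νF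
      = ∫ k, conj (FTr η k) * FTr r k ∂νF := by
    refine integral_congr_ae ?_
    filter_upwards [F2_ae_eq (f := fun x => ((r x : ℝ) : ℂ)) h1.ofReal h2.ofReal] with k hk
    rw [hk]
  rw [← h4]
  refine Eq.trans ?_ h3
  rw [← integral_complex_ofReal]
  refine integral_congr_ae (Filter.Eventually.of_forall fun x => ?_)
  simp

/-- A weak limit of charge densities whose Coulomb fields converge weakly. -/
theorem isCharge_of_weak_limit {r : ℕ → Slab → ℝ} {q : Slab → ℝ} (hr : ∀ n, IsCharge (r n))
    (h1 : Integrable q) (h2 : MemLp q 2)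
    (hlim : ∀ η : Slab → ℝ, IsTest η →
      Filter.Tendsto (fun n => ∫ x, η x * r n x) Filter.atTop (𝓝 (∫ x, η x * q x)))
    {l : Freq → ℂ} (hl : MemLp l 2 νF)
    (hw : ∀ w : Freq → ℂ, MemLp w 2 νF → Filter.Tendsto (fun n => ∫ k, w k * lam (r n) k ∂νF)
      Filter.atTop (𝓝 (∫ k, w k * l k ∂νF))) :
    IsCharge q ∧ lam q =ᵐ[νF] l := by
  set S : Freq → ℂ := fun k => (Real.sqrt (waveSq k) : ℂ) with hS
  have hSb : ∀ k, ‖S k‖ ≤ bracket k := fun k => by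
    rw [hS, Complex.norm_real, Real.norm_of_nonneg (Real.sqrt_nonneg _)]
    exact Real.sqrt_le_sqrt (by linarith)
  have hSm : Measurable S := measurable_sqrt_waveSq
  -- Tested against η̂, the function `S * l` pairs as the limit of ∫ η · r n, because η̂ · |k| is
  -- square integrable; the same limit is the pairing with q̂.
  have hz : (fun k => FTr q k - S k * l k) =ᵐ[νF] 0 := by
    have hml : MemLp (fun k => ((bracket k : ℂ)⁻¹ * S k) * l k) 2 νF := by
      refine memLp_bdd_mul hl (C := 1)
        (continuous_bracket_inv.measurable.mul hSm).aestronglyMeasurable fun k => ?_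
      rw [norm_mul, norm_inv, Complex.norm_real, Real.norm_of_nonneg (bracket_pos k).le]
      exact inv_mul_le_one_of_le₀ (hSb k) (bracket_pos k).le
    have hmq : MemLp (fun k => (bracket k : ℂ)⁻¹ * FTr q k) 2 νF :=
      memLp_bdd_mul (memLp_FT h1.ofReal h2.ofReal)
        continuous_bracket_inv.measurable.aestronglyMeasurable norm_bracket_inv_le
    refine ae_eq_zero_of_integral_conj_FTr_mul ?_ fun η hη => ?_
    · refine (memLp_congr_ae (Filter.Eventually.of_forall fun k => ?_)).1 (hmq.sub hml)
      simp only [Pi.sub_apply]; ring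
    · have hη2 : MemLp (fun k => conj (FTr η k) * S k) 2 νF := by
        refine hη.memLp_bracket_mul_FTr.of_le ((Complex.continuous_conj.measurable.comp
          hη.continuous_FTr.measurable).mul hSm).aestronglyMeasurable
          (Filter.Eventually.of_forall fun k => ?_)
        rw [norm_mul, norm_mul, RCLike.norm_conj, Complex.norm_real (bracket k),
          Real.norm_of_nonneg (bracket_pos k).le, mul_comm]
        exact mul_le_mul_of_nonneg_right (hSb k) (norm_nonneg _)
      have t1 := hw _ hη2
      have t2 := (Complex.continuous_ofReal.tendsto _).comp (hlim η hη)
      have e1 : ∀ n, ∫ k, conj (FTr η k) * S k * lam (r n) k ∂νF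
          = ((∫ x, η x * r n x : ℝ) : ℂ) := fun n => by
        rw [integral_test_smul_real hη (hr n).integrable (hr n).memLp]
        refine integral_congr_ae ?_
        filter_upwards [waveSq_ne_zero_ae] with k hk
        have : (Real.sqrt (waveSq k) : ℂ) ≠ 0 := Complex.ofReal_ne_zero.2
          (Real.sqrt_pos.2 (lt_of_le_of_ne (waveSq_nonneg k) hk.symm)).ne'
        rw [lam, hS, mul_assoc, mul_div_cancel₀ _ this]
      simp only [e1] at t1
      have e2 := tendsto_nhds_unique t1 t2
      rw [integral_test_smul_real hη h1 h2] at e2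
      have hηs : MemLp (fun k => conj (FTr η k)) 2 νF := hη.memLp_FTr.star
      have i1 : Integrable (fun k => conj (FTr η k) * FTr q k) νF :=
        hηs.integrable_mul (memLp_FT h1.ofReal h2.ofReal)
      have i2 : Integrable (fun k => conj (FTr η k) * S k * l k) νF := hη2.integrable_mul hl
      have e3 : ∀ k, conj (FTr η k) * (FTr q k - S k * l k)
          = conj (FTr η k) * FTr q k - conj (FTr η k) * S k * l k := fun k => by ring
      simp only [e3]
      rw [integral_sub i1 i2, e2, sub_self]
  have hlam : lam q =ᵐ[νF] l := by
    filter_upwards [hz, waveSq_ne_zero_ae] with k hk hk0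
    have h3 : (Real.sqrt (waveSq k) : ℂ) ≠ 0 := Complex.ofReal_ne_zero.2
      (Real.sqrt_pos.2 (lt_of_le_of_ne (waveSq_nonneg k) hk0.symm)).ne'
    rw [lam, sub_eq_zero.1 hk, hS, mul_div_cancel_left₀ _ h3]
  exact ⟨IsCharge.of_memLp_lam h1 h2 ((memLp_congr_ae hlam).2 hl), hlam⟩

/-- Finite Coulomb energy forces neutrality. This replaces any tightness argument: a weak limit of
finite energy cannot have lost mass, and competitors of finite energy satisfy the constraint
automatically. -/
theorem mass_eq_of_isCharge (hI : ConditionI σ) (he : e ≠ 0) {ψ : Slab → ℂ} (h : InH1 ψ)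
    (hc : IsCharge (chargeDensity e σ ψ)) : ∫ x, ‖ψ x‖ ^ 2 = chargeNumber e σ := by
  have h0 := hc.integral_eq_zero
  simp only [chargeDensity] at h0
  rw [integral_sub hI.integrable (h.integrable_norm_sq.const_mul e), integral_const_mul] at h0
  rw [chargeNumber, eq_div_iff he]; linarith

/-- Weak lower semicontinuity and compactness for the energy. -/
theorem exists_energyReal_le {ħ m : ℝ} (hħ : 0 < ħ) (hm : 0 < m) (he : e ≠ 0) (hI : ConditionI σ)
    {u : ℕ → Slab → ℂ} (hu : ∀ n, u n ∈ neutralStates e σ)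
    (hc : ∀ n, IsCharge (chargeDensity e σ (u n))) {E : ℝ} {ε : ℕ → ℝ}
    (hε : Filter.Tendsto ε Filter.atTop (𝓝 0)) (hE : ∀ n, energyReal ħ m e σ (u n) ≤ E + ε n) :
    ∃ ψ ∈ neutralStates e σ, IsCharge (chargeDensity e σ ψ) ∧ energyReal ħ m e σ ψ ≤ E := by
  obtain ⟨B, hB⟩ := hε.bddAbove_range
  have hεB : ∀ n, ε n ≤ B := fun n => hB ⟨n, rfl⟩
  set a := ħ ^ 2 / (2 * m) with ha
  have ha0 : 0 < a := by positivity
  set Z := chargeNumber e σ with hZ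
  set G : ℕ → Freq → ℂ := fun n k => (bracket k : ℂ) * F2 (u n) k with hGdef
  set L : ℕ → Freq → ℂ := fun n => lam (chargeDensity e σ (u n)) with hLdef
  have hG : ∀ n, MemLp (G n) 2 νF := fun n => (hu n).1.memLp_bracket
  have hL : ∀ n, MemLp (L n) 2 νF := fun n => (hc n).memLp_lam
  have hGsq : ∀ n, ∫ k, ‖G n k‖ ^ 2 ∂νF = Z + dirichlet (u n) := fun n => by
    rw [hGdef, (hu n).1.integral_bracket_sq, (hu n).2]
  -- Adding `a * Z`, constant on admissible states, completes the kinetic term to the full squared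
  -- norm of `G n`.
  have hEn : ∀ n, a * (∫ k, ‖G n k‖ ^ 2 ∂νF) + 1 / 2 * (∫ k, ‖L n k‖ ^ 2 ∂νF) ≤ E + a * Z + ε n := by
    intro n
    have := hE n
    rw [energyReal] at this
    rw [hGsq]; linarith
  have hn1 : ∀ n, 0 ≤ ∫ k, ‖G n k‖ ^ 2 ∂νF := fun n => integral_nonneg fun _ => by positivity
  have hn2 : ∀ n, 0 ≤ ∫ k, ‖L n k‖ ^ 2 ∂νF := fun n => integral_nonneg fun _ => by positivity
  have hGb : ∀ n, ∫ k, ‖G n k‖ ^ 2 ∂νF ≤ (E + a * Z + B) / a := fun n => by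
    rw [le_div_iff₀ ha0]
    linarith [hEn n, hn2 n, hεB n]
  have hLb : ∀ n, ∫ k, ‖L n k‖ ^ 2 ∂νF ≤ 2 * (E + a * Z + B) := fun n => by
    have := mul_nonneg ha0.le (hn1 n)
    linarith [hEn n, hεB n]
  obtain ⟨g, hg, φ₁, hφ₁, hlim₁⟩ := exists_weak_limit hG hGb
  obtain ⟨l, hl, φ₂, hφ₂, hlim₂⟩ := exists_weak_limit (fun n => hL (φ₁ n)) fun n => hLb (φ₁ n)
  set s : ℕ → ℕ := fun n => φ₁ (φ₂ n) with hs
  have hst : Filter.Tendsto s Filter.atTop Filter.atTop := (hφ₁.comp hφ₂).tendsto_atTop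
  have hlimG : ∀ w : Freq → ℂ, MemLp w 2 νF → Filter.Tendsto (fun n => ∫ k, w k * G (s n) k ∂νF)
      Filter.atTop (𝓝 (∫ k, w k * g k ∂νF)) := fun w hw =>
    (hlim₁ w hw).comp hφ₂.tendsto_atTop
  have hgi : MemLp (fun k => (bracket k : ℂ)⁻¹ * g k) 2 νF := memLp_bdd_mul hg
    continuous_bracket_inv.measurable.aestronglyMeasurable norm_bracket_inv_le
  set v := F2inv fun k => (bracket k : ℂ)⁻¹ * g k with hv
  have hv2 : MemLp v 2 := memLp_F2inv _
  have hvg : F2 v =ᵐ[νF] fun k => (bracket k : ℂ)⁻¹ * g k := F2_F2inv hgi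
  have hvG : (fun k => (bracket k : ℂ) * F2 v k) =ᵐ[νF] g := by
    filter_upwards [hvg] with k hk
    rw [hk, mul_inv_cancel_left₀ (Complex.ofReal_ne_zero.2 (bracket_pos k).ne')]
  have hvH : InH1 v := InH1.of_memLp_bracket hv2 ((memLp_congr_ae hvG).2 hg)
  -- Local compactness passes the quadratic quantity |u|² to the limit, which weak convergence alone
  -- would not do.
  have hrel : ∀ η : Slab → ℝ, IsTest η → Filter.Tendsto
      (fun n => ∫ x, η x * ‖u (s n) x‖ ^ 2) Filter.atTop (𝓝 (∫ x, η x * ‖v x‖ ^ 2)) := by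
    intro η hη
    set M := Real.sqrt (max ((E + a * Z + B) / a) (∫ k, ‖g k‖ ^ 2 ∂νF)) with hM
    have hM2 : M ^ 2 = max ((E + a * Z + B) / a) (∫ k, ‖g k‖ ^ 2 ∂νF) :=
      Real.sq_sqrt (le_max_of_le_right (integral_nonneg fun _ => by positivity))
    exact tendsto_integral_mul_norm_sq hη (fun n => (hu (s n)).1.1) hv2 (fun n => hG (s n)) hg
      (Real.sqrt_nonneg _) (fun n => by rw [hM2]; exact le_max_of_le_left (hGb _))
      (by rw [hM2]; exact le_max_right _ _) (fun n => InH1.F2_eq_bracket_inv _) hvg hlimG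
  have hq : ∀ η : Slab → ℝ, IsTest η → Filter.Tendsto
      (fun n => ∫ x, η x * chargeDensity e σ (u (s n)) x) Filter.atTop
      (𝓝 (∫ x, η x * chargeDensity e σ v x)) := by
    intro η hη
    have hdec : ∀ ψ : Slab → ℂ, InH1 ψ → ∫ x, η x * chargeDensity e σ ψ x
        = (∫ x, η x * σ x) - e * ∫ x, η x * ‖ψ x‖ ^ 2 := by
      intro ψ hψ
      have i1 : Integrable fun x => η x * σ x := hη.integrable_smul hI.integrable.locallyIntegrable
      have i2 : Integrable fun x => η x * ‖ψ x‖ ^ 2 :=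
        hη.integrable_smul hψ.integrable_norm_sq.locallyIntegrable
      rw [← integral_const_mul, ← integral_sub i1 (i2.const_mul e)]
      refine integral_congr_ae (Filter.Eventually.of_forall fun x => ?_)
      simp only [chargeDensity]; ring
    rw [hdec v hvH]
    simp only [fun n => hdec (u (s n)) (hu (s n)).1]
    exact tendsto_const_nhds.sub ((hrel η hη).const_mul e)
  obtain ⟨hvc, hvl⟩ := isCharge_of_weak_limit (fun n => hc (s n))
    (integrable_chargeDensity hI hvH) (memLp_chargeDensity hI hvH) hq hl hlim₂
  -- The constraint is recovered from neutrality of the limit and not from convergence of the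
  -- masses.
  have hmass := mass_eq_of_isCharge hI he hvH hvc
  refine ⟨v, ⟨hvH, hmass⟩, hvc, ?_⟩
  have hEv : energyReal ħ m e σ v
      = a * (∫ k, ‖g k‖ ^ 2 ∂νF) + 1 / 2 * (∫ k, ‖l k‖ ^ 2 ∂νF) - a * Z := by
    have h1 := hvH.integral_bracket_sq
    have h2 : ∫ k, ‖(bracket k : ℂ) * F2 v k‖ ^ 2 ∂νF = ∫ k, ‖g k‖ ^ 2 ∂νF :=
      integral_congr_ae (by filter_upwards [hvG] with k hk; rw [hk])
    have h3 : ∫ k, ‖lam (chargeDensity e σ v) k‖ ^ 2 ∂νF = ∫ k, ‖l k‖ ^ 2 ∂νF :=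
      integral_congr_ae (by filter_upwards [hvl] with k hk; rw [hk])
    rw [energyReal, h3, ← h2, h1, hmass]; ring
  have hgs : MemLp (fun k => conj (g k)) 2 νF := hg.star
  have hls : MemLp (fun k => conj (l k)) 2 νF := hl.star
  have hre : ∀ {z : ℕ → ℂ} {z₀ : ℂ}, Filter.Tendsto z Filter.atTop (𝓝 z₀) →
      Filter.Tendsto (fun n => (z n - z₀).re) Filter.atTop (𝓝 0) := fun {z z₀} hz => by
    have := (Complex.continuous_re.tendsto _).comp (hz.sub_const z₀)
    rw [sub_self] at this
    exact this
  have t1 := hre (hlimG _ hgs)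
  have t2 := hre (hlim₂ _ hls)
  -- Lower semicontinuity by tangents: these affine minorants of the energies converge to the energy
  -- of the limit (shifted by `a * Z`).
  have hlhs : Filter.Tendsto (fun n => a * ((∫ k, ‖g k‖ ^ 2 ∂νF) + 2 * ((∫ k, conj (g k) * G (s n) k ∂νF)
      - ∫ k, conj (g k) * g k ∂νF).re) + 1 / 2 * ((∫ k, ‖l k‖ ^ 2 ∂νF) +
      2 * ((∫ k, conj (l k) * L (s n) k ∂νF) - ∫ k, conj (l k) * l k ∂νF).re)) Filter.atTop
      (𝓝 (a * ((∫ k, ‖g k‖ ^ 2 ∂νF) + 2 * 0) + 1 / 2 * ((∫ k, ‖l k‖ ^ 2 ∂νF) + 2 * 0))) :=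
    ((tendsto_const_nhds.add (t1.const_mul 2)).const_mul a).add
      ((tendsto_const_nhds.add (t2.const_mul 2)).const_mul _)
  have hrhs : Filter.Tendsto (fun n => E + a * Z + ε (s n)) Filter.atTop (𝓝 (E + a * Z + 0)) :=
    tendsto_const_nhds.add (hε.comp hst)
  have hfin := le_of_tendsto_of_tendsto' hlhs hrhs fun n => by
    refine le_trans ?_ (hEn (s n))
    exact add_le_add (mul_le_mul_of_nonneg_left (integral_norm_sq_ge_tangent hg (hG _)) ha0.le)
      (mul_le_mul_of_nonneg_left (integral_norm_sq_ge_tangent hl (hL _)) (by norm_num))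
  rw [hEv]; linarith

/-- Existence of a minimizer of the energy. -/
theorem exists_minimizer {ħ m : ℝ} (hħ : 0 < ħ) (hm : 0 < m) (he : 0 < e)
    (hI : ConditionI σ) (hIII : ConditionIII e σ) (hZ : 0 < chargeNumber e σ) :
    ∃ ψ ∈ neutralStates e σ, IsCharge (chargeDensity e σ ψ) ∧
      energy ħ m e σ ψ = ⨅ χ ∈ neutralStates e σ, energy ħ m e σ χ := by
  set I := ⨅ χ ∈ neutralStates e σ, energy ħ m e σ χ with hIdef
  obtain ⟨η, hη, hηZ⟩ := exists_test_norm_sq hZ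
  have hηH := inH1_of_test hη
  -- Condition III enters here: it provides one admissible state of finite energy, so the infimum is
  -- finite.
  have hηc : IsCharge (chargeDensity e σ fun x => (η x : ℂ)) := by
    refine (isCharge_sub_test hI hIII hη.sq hηZ).congr (Filter.Eventually.of_forall fun x => ?_)
    simp [chargeDensity]
  have hηM : (fun x => (η x : ℂ)) ∈ neutralStates e σ :=
    ⟨hηH, mass_eq_of_isCharge hI he.ne' hηH hηc⟩
  have hItop : I ≠ ⊤ := by
    refine ne_top_of_le_ne_top ?_ (iInf₂_le (fun x => (η x : ℂ)) hηM)
    rw [energy_eq hm hηH hηc]; exact ENNReal.ofReal_ne_top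
  have hex : ∀ n : ℕ, ∃ u ∈ neutralStates e σ,
      energy ħ m e σ u < I + ENNReal.ofReal (1 / ((n : ℝ) + 1)) := by
    intro n
    have : I < I + ENNReal.ofReal (1 / ((n : ℝ) + 1)) :=
      ENNReal.lt_add_right hItop (by simp; positivity)
    obtain ⟨u, hu⟩ := iInf_lt_iff.1 this
    obtain ⟨hu1, hu2⟩ := iInf_lt_iff.1 hu
    exact ⟨u, hu1, hu2⟩
  choose u hu hlt using hex
  have hc : ∀ n, IsCharge (chargeDensity e σ (u n)) := fun n =>
    isCharge_of_energy hI (hu n).1 (ne_top_of_lt (hlt n))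
  have hE : ∀ n, energyReal ħ m e σ (u n) ≤ I.toReal + 1 / ((n : ℝ) + 1) := by
    intro n
    have h1 := (hlt n).le
    rw [energy_eq hm (hu n).1 (hc n)] at h1
    have h2 := ENNReal.toReal_mono (by finiteness) h1
    rwa [ENNReal.toReal_ofReal (energyReal_nonneg hm _), ENNReal.toReal_add hItop (by finiteness),
      ENNReal.toReal_ofReal (by positivity)] at h2
  obtain ⟨ψ, hψ, hψc, hψE⟩ := exists_energyReal_le hħ hm he.ne' hI hu hc
    tendsto_one_div_add_atTop_nhds_zero_nat hE
  refine ⟨ψ, hψ, hψc, le_antisymm ?_ (iInf₂_le ψ hψ)⟩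
  rw [energy_eq hm hψ.1 hψc]
  exact ENNReal.ofReal_le_of_le_toReal hψE

/-! ### The Schrödinger equation in weak form -/

theorem integral_norm_add_sq {α : Type*} [MeasurableSpace α] {μ : Measure α} {a b : α → ℂ}
    (ha : MemLp a 2 μ) (hb : MemLp b 2 μ) (t : ℝ) :
    ∫ x, ‖a x + t * b x‖ ^ 2 ∂μ = (∫ x, ‖a x‖ ^ 2 ∂μ) + t * (2 * ∫ x, (conj (a x) * b x).re ∂μ)
      + t ^ 2 * ∫ x, ‖b x‖ ^ 2 ∂μ := by
  have hs : MemLp (fun k => conj (a k)) 2 μ := ha.star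
  have i1 : Integrable (fun x => (conj (a x) * b x).re) μ :=
    Complex.reCLM.integrable_comp (hs.integrable_mul hb)
  have i2 := ha.integrable_norm_pow two_ne_zero
  have i3 := hb.integrable_norm_pow two_ne_zero
  have i4 : Integrable (fun x => ‖a x‖ ^ 2 + t * (2 * (conj (a x) * b x).re)) μ :=
    i2.add ((i1.const_mul 2).const_mul t)
  rw [← integral_const_mul, ← integral_const_mul, ← integral_const_mul,
    ← integral_add i2 ((i1.const_mul 2).const_mul t), ← integral_add i4 (i3.const_mul _)]
  refine integral_congr_ae (Filter.Eventually.of_forall fun x => ?_)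
  simp only [← Complex.normSq_eq_norm_sq]
  simp only [Complex.normSq_apply, Complex.mul_re, Complex.conj_re, Complex.conj_im,
    Complex.add_re, Complex.add_im, Complex.mul_im, Complex.ofReal_re, Complex.ofReal_im]
  ring

/-- The Coulomb product `⟨Λ q, Λ r⟩`. -/
def coulombProd (q r : Slab → ℝ) : ℝ := ∫ k, (conj (lam q k) * lam r k).re ∂νF

theorem integrable_coulombProd {q r : Slab → ℝ} (hq : IsCharge q) (hr : IsCharge r) :
    Integrable (fun k => (conj (lam q k) * lam r k).re) νF :=
  Complex.reCLM.integrable_comp (MemLp.integrable_mul hq.memLp_lam.star hr.memLp_lam)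

theorem coulombProd_add_mul {q r s : Slab → ℝ} (hq : IsCharge q) (hr : IsCharge r)
    (hs : IsCharge s) (c d : ℝ) :
    coulombProd q (fun x => c * r x + d * s x) = c * coulombProd q r + d * coulombProd q s := by
  have h1 := (integrable_coulombProd hq hr).const_mul c
  have h2 := (integrable_coulombProd hq hs).const_mul d
  rw [coulombProd, coulombProd, coulombProd, ← integral_const_mul, ← integral_const_mul,
    ← integral_add h1 h2]
  refine integral_congr_ae (Filter.Eventually.of_forall fun k => ?_)
  simp only
  rw [IsCharge.lam_add (hr.const_mul c).integrable (hs.const_mul d).integrable,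
    IsCharge.lam_const_mul, IsCharge.lam_const_mul, mul_add, Complex.add_re,
    mul_left_comm, Complex.re_ofReal_mul, mul_left_comm, Complex.re_ofReal_mul]

/-- A first moment suffices since `growth` is at most 1 + |x₂| + |x₃|, so the density is integrable
against the growing potential. -/
theorem coulombProd_eq_integral {q r : Slab → ℝ} (hq : IsCharge q) (hr : Integrable r)
    (hr2 : MemLp r 2) (hrm : Integrable fun x => (|x.2.1| + |x.2.2|) * r x) (hr0 : ∫ x, r x = 0) :
    coulombProd q r = ∫ x, r x * potential q x := by
  have hc : IsCharge r := isCharge_of_moment hr hr2 hrm hr0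
  have hg : Integrable fun x => growth x * r x := by
    refine (hr.norm.add hrm.norm).mono'
      (continuous_growth.aestronglyMeasurable.mul hr.aestronglyMeasurable)
      (Filter.Eventually.of_forall fun x => ?_)
    have h1 : growth x ≤ 1 + |x.2.1| + |x.2.2| := by
      refine (Real.rpow_le_rpow_of_exponent_le ?_ (by norm_num : (1 / 2 : ℝ) ≤ 1)).trans
        (Real.rpow_one _).le
      linarith [abs_nonneg x.2.1, abs_nonneg x.2.2]
    rw [Pi.add_apply, norm_mul, norm_mul, Real.norm_of_nonneg (zero_le_one.trans (one_le_growth x)),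
      Real.norm_of_nonneg (by positivity : 0 ≤ |x.2.1| + |x.2.2|)]
    nlinarith [norm_nonneg (r x)]
  have hi : Integrable (fun k => conj (lam r k) * lam q k) νF :=
    MemLp.integrable_mul hc.memLp_lam.star hq.memLp_lam
  rw [← hq.re_integral_lam hr hr0 hg, ← Complex.reCLM_apply,
    ← ContinuousLinearMap.integral_comp_comm _ hi, coulombProd]
  refine integral_congr_ae (Filter.Eventually.of_forall fun k => ?_)
  simp only [Complex.reCLM_apply, Complex.mul_re, Complex.conj_re, Complex.conj_im]
  ring

theorem coulomb_expand {q r : Slab → ℝ} (hq : IsCharge q) (hr : IsCharge r) (t : ℝ) :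
    ∫ k, ‖lam (fun x => q x + t * r x) k‖ ^ 2 ∂νF = (∫ k, ‖lam q k‖ ^ 2 ∂νF)
      + t * (2 * coulombProd q r) + t ^ 2 * ∫ k, ‖lam r k‖ ^ 2 ∂νF := by
  rw [coulombProd, ← integral_norm_add_sq hq.memLp_lam hr.memLp_lam]
  refine integral_congr_ae (Filter.Eventually.of_forall fun k => ?_)
  simp only
  rw [IsCharge.lam_add hq.integrable (hr.const_mul t).integrable, IsCharge.lam_const_mul]

namespace InH1

variable {ψ χ : Slab → ℂ}

theorem hasWeakDeriv_add_mul (hψ : InH1 ψ) (hχ : InH1 χ) (c : ℂ) (i : Fin 3) :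
    HasWeakDeriv i (fun x => ψ x + c * χ x) fun x => weakDeriv i ψ x + c * weakDeriv i χ x :=
  (hasWeakDeriv_fun_weakDeriv hψ i).add
    ((hasWeakDeriv_fun_weakDeriv hχ i).clm_comp (ContinuousLinearMap.mul ℝ ℂ c))

theorem add_mul (hψ : InH1 ψ) (hχ : InH1 χ) (c : ℂ) : InH1 fun x => ψ x + c * χ x :=
  ⟨hψ.1.add (hχ.1.const_mul c), fun i => ⟨⟨_, hψ.hasWeakDeriv_add_mul hχ c i⟩,
    (memLp_congr_ae (hψ.hasWeakDeriv_add_mul hχ c i).weakDeriv_ae_eq).2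
      ((hψ.2 i).2.add ((hχ.2 i).2.const_mul c))⟩⟩

theorem hasWeakDeriv_const_mul (hψ : InH1 ψ) (c : ℂ) (i : Fin 3) :
    HasWeakDeriv i (fun x => c * ψ x) fun x => c * weakDeriv i ψ x :=
  (hasWeakDeriv_fun_weakDeriv hψ i).clm_comp (ContinuousLinearMap.mul ℝ ℂ c)

theorem const_mul (hψ : InH1 ψ) (c : ℂ) : InH1 fun x => c * ψ x :=
  ⟨hψ.1.const_mul c, fun i => ⟨⟨_, hψ.hasWeakDeriv_const_mul c i⟩,
    (memLp_congr_ae (hψ.hasWeakDeriv_const_mul c i).weakDeriv_ae_eq).2 ((hψ.2 i).2.const_mul c)⟩⟩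

theorem dirichlet_const_mul (hψ : InH1 ψ) (c : ℂ) :
    dirichlet (fun x => c * ψ x) = ‖c‖ ^ 2 * dirichlet ψ := by
  rw [dirichlet, dirichlet, Finset.mul_sum]
  refine Finset.sum_congr rfl fun i _ => ?_
  rw [← integral_const_mul]
  refine integral_congr_ae ?_
  filter_upwards [(hψ.hasWeakDeriv_const_mul c i).weakDeriv_ae_eq] with x hx
  rw [hx, norm_mul, mul_pow]

theorem dirichlet_add_mul (hψ : InH1 ψ) (hχ : InH1 χ) (t : ℝ) :
    dirichlet (fun x => ψ x + t * χ x) = dirichlet ψ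
      + t * (2 * ∑ i, ∫ x, (conj (weakDeriv i ψ x) * weakDeriv i χ x).re) + t ^ 2 * dirichlet χ := by
  simp only [dirichlet, Finset.mul_sum, ← Finset.sum_add_distrib]
  refine Finset.sum_congr rfl fun i _ => ?_
  rw [← integral_norm_add_sq (hψ.2 i).2 (hχ.2 i).2]
  refine integral_congr_ae ?_
  filter_upwards [(hψ.hasWeakDeriv_add_mul hχ t i).weakDeriv_ae_eq] with x hx
  rw [hx]

end InH1

section Localized

variable {η p : Slab → ℝ}

theorem IsTest.integrable_mul (hη : IsTest η) (hp : MemLp p 2) : Integrable fun x => η x * p x :=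
  hη.integrable_smul (hp.locallyIntegrable (by norm_num))

theorem IsTest.memLp_mul (hη : IsTest η) (hp : MemLp p 2) : MemLp (fun x => η x * p x) 2 := by
  obtain ⟨C, hC⟩ := hη.exists_bound
  refine (hp.const_mul C).of_le (hη.continuous.aestronglyMeasurable.mul hp.1)
    (Filter.Eventually.of_forall fun x => ?_)
  rw [norm_mul, norm_mul]
  exact mul_le_mul_of_nonneg_right ((hC x).trans (le_abs_self C)) (norm_nonneg _)

theorem IsTest.integrable_continuous_mul (hη : IsTest η) (hp : MemLp p 2) {g : Slab → ℝ}
    (hg : Continuous g) : Integrable fun x => g x * (η x * p x) := by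
  have hc : HasCompactSupport fun x => η x * g x := hη.2.mul_right
  have h1 : MemLp (fun x => η x * g x) 2 :=
    (hη.continuous.mul hg).memLp_of_hasCompactSupport hc
  refine (MemLp.integrable_mul h1 hp).congr (Filter.Eventually.of_forall fun x => ?_)
  simp only [Pi.mul_apply]; ring

end Localized

/-- A compactly supported variation of the charge density, compensated by a multiple of `σ`. -/
theorem coulombProd_variation {n : Slab → ℝ} (hn : IsTest n)
    (hσn : IsCharge fun x => σ x - e * n x) {ρ : Slab → ℝ} (hρ : IsCharge ρ) {η p : Slab → ℝ}
    (hη : IsTest η) (hp : MemLp p 2) {c : ℝ} (hc : ∫ x, η x * p x = c * ∫ x, n x) :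
    IsCharge (fun x => c * σ x - e * (η x * p x)) ∧
      coulombProd ρ (fun x => c * σ x - e * (η x * p x))
        = c * (coulombProd ρ (fun x => σ x - e * n x) + e * ∫ x, n x * potential ρ x)
          - e * ∫ x, η x * (p x * potential ρ x) := by
  -- The variation splits as c(σ - e n) + e(c n - η p). The second piece is neutral and compactly
  -- supported, so its Coulomb product is an integral against the potential. The first cannot be
  -- treated so, as σ may lack the required moment; its product with ρ stays as an unevaluated
  -- constant.
  set r : Slab → ℝ := fun x => c * n x - η x * p x with hr
  have i1 : Integrable r := (hn.integrable.const_mul c).sub (hη.integrable_mul hp)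
  have i2 : MemLp r 2 := ((hn.memLp 2).const_mul c).sub (hη.memLp_mul hp)
  have i3 : Integrable fun x => (|x.2.1| + |x.2.2|) * r x := by
    refine ((hn.integrable_moment.const_mul c).sub (hη.integrable_continuous_mul hp
      (by fun_prop : Continuous fun x : Slab => |x.2.1| + |x.2.2|))).congr
      (Filter.Eventually.of_forall fun x => ?_)
    simp only [hr, Pi.sub_apply]; ring
  have i4 : ∫ x, r x = 0 := by
    rw [hr, integral_sub (hn.integrable.const_mul c) (hη.integrable_mul hp), integral_const_mul, hc,
      sub_self]
  have hrc : IsCharge r := isCharge_of_moment i1 i2 i3 i4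
  have e1 : (fun x => c * σ x - e * (η x * p x))
      = fun x => c * (σ x - e * n x) + e * r x := by
    ext x; simp only [hr]; ring
  rw [e1]
  refine ⟨(hσn.const_mul c).add (hrc.const_mul e), ?_⟩
  rw [coulombProd_add_mul hρ hσn hrc, coulombProd_eq_integral hρ i1 i2 i3 i4]
  have j1 : Integrable fun x => n x * potential ρ x :=
    hn.integrable_smul hρ.continuous_potential.locallyIntegrable
  have j2 : Integrable fun x => η x * (p x * potential ρ x) :=
    (hη.integrable_continuous_mul hp hρ.continuous_potential).congr
      (Filter.Eventually.of_forall fun x => by simp only; ring)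
  have e2 : ∫ x, r x * potential ρ x
      = c * (∫ x, n x * potential ρ x) - ∫ x, η x * (p x * potential ρ x) := by
    rw [← integral_const_mul, ← integral_sub (j1.const_mul c) j2]
    refine integral_congr_ae (Filter.Eventually.of_forall fun x => ?_)
    simp only [hr]; ring
  rw [e2]; ring

theorem norm_add_mul_sq (z c : ℂ) (t s : ℝ) : ‖z + t * (c * s)‖ ^ 2
    = ‖z‖ ^ 2 + t * (s * (2 * (conj z * c).re)) + t ^ 2 * (s * (‖c‖ ^ 2 * s)) := by
  simp only [← Complex.normSq_eq_norm_sq]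
  simp only [Complex.normSq_apply, Complex.mul_re, Complex.conj_re, Complex.conj_im,
    Complex.add_re, Complex.add_im, Complex.mul_im, Complex.ofReal_re, Complex.ofReal_im]
  ring

/-- The first variation of the energy vanishes at a minimizer. -/
theorem first_variation {ħ m : ℝ} (hI : ConditionI σ)
    {n : Slab → ℝ} (hn : IsTest n) (hσn : IsCharge fun x => σ x - e * n x)
    (hnZ : ∫ x, n x = chargeNumber e σ) (hZ : 0 < chargeNumber e σ) (he : e ≠ 0)
    {ψ : Slab → ℂ} (hψ : ψ ∈ neutralStates e σ) (hc : IsCharge (chargeDensity e σ ψ))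
    (hmin : ∀ χ ∈ neutralStates e σ, IsCharge (chargeDensity e σ χ) →
      energyReal ħ m e σ ψ ≤ energyReal ħ m e σ χ) :
    ∃ K : ℝ, ∀ η : Slab → ℝ, IsTest η → ∀ c : ℂ,
      ħ ^ 2 / (2 * m) * ∑ i, ∫ x, (conj (weakDeriv i ψ x) * (c * pderiv i η x)).re
        = ∫ x, η x * ((K + e * potential (chargeDensity e σ ψ) x) * (conj (ψ x) * c).re) := by
  set a := ħ ^ 2 / (2 * m) with ha
  set Z := chargeNumber e σ with hZdef
  set ρ := chargeDensity e σ ψ with hρ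
  set φ := potential ρ with hφ
  set E₀ := energyReal ħ m e σ ψ with hE₀
  -- Collects every term proportional to `b1` in the derivative of `P` at 0; `-K₀ / Z` is the
  -- Lagrange multiplier of the mass constraint.
  set K₀ := a * dirichlet ψ + (coulombProd ρ (fun x => σ x - e * n x) + e * ∫ x, n x * φ x)
    - 2 * E₀ with hK₀
  refine ⟨-K₀ / Z, fun η hη c => ?_⟩
  have hψ1 := hψ.1
  set χ : Slab → ℂ := fun x => c * (η x : ℂ) with hχdef
  have hχ : InH1 χ := (inH1_of_test hη).const_mul c
  have hχd : ∀ i, weakDeriv i χ =ᵐ[volume] fun x => c * (pderiv i η x : ℂ) := fun i =>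
    HasWeakDeriv.weakDeriv_ae_eq (((hη.isSmooth.hasWeakDeriv i).clm_comp Complex.ofRealCLM).clm_comp
      (ContinuousLinearMap.mul ℝ ℂ c))
  set p1 : Slab → ℝ := fun x => 2 * (conj (ψ x) * c).re with hp1
  set p2 : Slab → ℝ := fun x => ‖c‖ ^ 2 * η x with hp2
  have hp1m : MemLp p1 2 := by
    have h1 : MemLp (fun x => c * conj (ψ x)) 2 := MemLp.const_mul hψ1.1.star c
    have h2 : MemLp (fun x => (c * conj (ψ x)).re) 2 := h1.re
    refine (memLp_congr_ae (Filter.Eventually.of_forall fun x => ?_)).1 (h2.const_mul 2)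
    simp only [hp1, mul_comm c]
  have hp2m : MemLp p2 2 := (hη.memLp 2).const_mul _
  set b1 := (∫ x, η x * p1 x) / Z with hb1
  set b2 := (∫ x, η x * p2 x) / Z with hb2
  obtain ⟨hr1, hB1⟩ := coulombProd_variation hn hσn hc hη hp1m (c := b1)
    (by rw [hnZ, hb1, div_mul_cancel₀ _ hZ.ne'])
  obtain ⟨hr2, -⟩ := coulombProd_variation hn hσn hc hη hp2m (c := b2)
    (by rw [hnZ, hb2, div_mul_cancel₀ _ hZ.ne'])
  set r1 : Slab → ℝ := fun x => b1 * σ x - e * (η x * p1 x) with hr1d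
  set r2 : Slab → ℝ := fun x => b2 * σ x - e * (η x * p2 x) with hr2d
  -- The mass of ψ + tχ is Z · b(t), so dividing by the square root of b(t) restores the constraint.
  -- The same coefficients make `r1` and `r2` neutral.
  set b : ℝ → ℝ := fun t => 1 + t * b1 + t ^ 2 * b2 with hb
  set T1 := 2 * ∑ i, ∫ x, (conj (weakDeriv i ψ x) * weakDeriv i χ x).re with hT1
  set A0 := ∫ k, ‖lam ρ k‖ ^ 2 ∂νF with hA0
  -- For b(t) > 0 this is b(t)² times the energy of the normalized competitor minus the energy of ψ.
  -- Clearing the denominator turns it into a polynomial, so nothing is differentiated under an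
  -- integral.
  set P : ℝ → ℝ := fun t => a * b t * (dirichlet ψ + t * T1 + t ^ 2 * dirichlet χ)
    + 1 / 2 * (A0 + t * (2 * (coulombProd ρ r1 + t * coulombProd ρ r2))
      + t ^ 2 * ((∫ k, ‖lam r1 k‖ ^ 2 ∂νF) + t * (2 * coulombProd r1 r2)
        + t ^ 2 * ∫ k, ‖lam r2 k‖ ^ 2 ∂νF)) - b t ^ 2 * E₀ with hP
  have hP0 : P 0 = 0 := by
    have : E₀ = a * dirichlet ψ + 1 / 2 * A0 := rfl
    simp only [hP, hb]; rw [this]; ring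
  have hbpos : ∀ᶠ t in 𝓝 (0 : ℝ), 0 < b t := by
    have : ContinuousAt b 0 := by simp only [hb]; fun_prop
    exact this.eventually (lt_mem_nhds (by simp [hb]))
  have hPnn : ∀ᶠ t in 𝓝 (0 : ℝ), 0 ≤ P t := by
    filter_upwards [hbpos] with t ht
    have hψt : InH1 fun x => ψ x + t * χ x := hψ1.add_mul hχ t
    set s : ℝ := (Real.sqrt (b t))⁻¹ with hs
    have hs2 : s ^ 2 = (b t)⁻¹ := by rw [hs, inv_pow, Real.sq_sqrt ht.le]
    have hst : InH1 fun x => (s : ℂ) * (ψ x + t * χ x) := hψt.const_mul s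
    have hR : IsCharge fun x => r1 x + t * r2 x := hr1.add (hr2.const_mul t)
    have hQ : IsCharge fun x => ρ x + t * (r1 x + t * r2 x) := hc.add (hR.const_mul t)
    -- Writing σ as b⁻¹ · bσ and expanding b distributes the ionic charge among ρ, `r1` and `r2`,
    -- each of finite Coulomb energy.
    have hdens : chargeDensity e σ (fun x => (s : ℂ) * (ψ x + t * χ x))
        = fun x => (b t)⁻¹ * (ρ x + t * (r1 x + t * r2 x)) := by
      ext x
      have hn1 : ‖ψ x + t * χ x‖ ^ 2
          = ‖ψ x‖ ^ 2 + t * (η x * p1 x) + t ^ 2 * (η x * p2 x) := norm_add_mul_sq _ _ _ _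
      have hσ : σ x = (b t)⁻¹ * (b t * σ x) := by rw [inv_mul_cancel_left₀ ht.ne']
      rw [chargeDensity, norm_mul, mul_pow, Complex.norm_real, Real.norm_eq_abs, sq_abs, hs2, hn1]
      conv_lhs => rw [hσ]
      simp only [hρ, chargeDensity, hr1d, hr2d, hb]
      ring
    have hch : IsCharge (chargeDensity e σ fun x => (s : ℂ) * (ψ x + t * χ x)) := by
      rw [hdens]; exact hQ.const_mul _
    have hmem : (fun x => (s : ℂ) * (ψ x + t * χ x)) ∈ neutralStates e σ :=
      ⟨hst, mass_eq_of_isCharge hI he hst hch⟩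
    have hle := hmin _ hmem hch
    have hlam : ∫ k, ‖lam (chargeDensity e σ fun x => (s : ℂ) * (ψ x + t * χ x)) k‖ ^ 2 ∂νF
        = (b t)⁻¹ ^ 2 * ∫ k, ‖lam (fun x => ρ x + t * (r1 x + t * r2 x)) k‖ ^ 2 ∂νF := by
      rw [hdens, ← integral_const_mul]
      refine integral_congr_ae (Filter.Eventually.of_forall fun k => ?_)
      simp only
      rw [IsCharge.lam_const_mul, norm_mul, mul_pow, Complex.norm_real, Real.norm_eq_abs, sq_abs]
    have hprod : coulombProd ρ (fun x => r1 x + t * r2 x)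
        = coulombProd ρ r1 + t * coulombProd ρ r2 := by
      have := coulombProd_add_mul hc hr1 hr2 1 t
      simpa using this
    rw [energyReal, hlam, hψt.dirichlet_const_mul, Complex.norm_real, Real.norm_eq_abs, sq_abs, hs2,
      hψ1.dirichlet_add_mul hχ, coulomb_expand hc hR, coulomb_expand hr1 hr2, hprod] at hle
    have hmul := mul_le_mul_of_nonneg_left hle (sq_nonneg (b t))
    have hbb : b t * (b t)⁻¹ = 1 := mul_inv_cancel₀ ht.ne'
    have e3 : P t = b t ^ 2 * (a * ((b t)⁻¹ * (dirichlet ψ + t * T1 + t ^ 2 * dirichlet χ))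
      + 1 / 2 * ((b t)⁻¹ ^ 2 * (A0 + t * (2 * (coulombProd ρ r1 + t * coulombProd ρ r2))
      + t ^ 2 * ((∫ k, ‖lam r1 k‖ ^ 2 ∂νF) + t * (2 * coulombProd r1 r2)
        + t ^ 2 * ∫ k, ‖lam r2 k‖ ^ 2 ∂νF)))) - b t ^ 2 * E₀ := by
      simp only [hP]
      field_simp
    rw [e3]
    linarith
  have hmin0 : IsLocalMin P 0 := by
    filter_upwards [hPnn] with t ht
    rw [hP0]; exact ht
  have hbd : HasDerivAt b b1 0 := by
    have := (((hasDerivAt_id (0 : ℝ)).mul_const b1).const_add 1).add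
      (((hasDerivAt_id (0 : ℝ)).pow 2).mul_const b2)
    exact this.congr_deriv (by simp)
  have hder : ∀ {x y z : ℝ}, HasDerivAt (fun t : ℝ => x + t * y + t ^ 2 * z) y 0 :=
    fun {x y z} => by
    have := (((hasDerivAt_id (0 : ℝ)).mul_const y).const_add x).add
      (((hasDerivAt_id (0 : ℝ)).pow 2).mul_const z)
    exact this.congr_deriv (by simp)
  have hd1 : HasDerivAt P (a * b1 * dirichlet ψ + a * T1 + coulombProd ρ r1 - 2 * b1 * E₀) 0 := by
    have h1 := (hbd.const_mul a).mul (hder (x := dirichlet ψ) (y := T1) (z := dirichlet χ))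
    have h2 : HasDerivAt (fun t : ℝ => A0 + t * (2 * (coulombProd ρ r1 + t * coulombProd ρ r2))
      + t ^ 2 * ((∫ k, ‖lam r1 k‖ ^ 2 ∂νF) + t * (2 * coulombProd r1 r2)
        + t ^ 2 * ∫ k, ‖lam r2 k‖ ^ 2 ∂νF)) (2 * coulombProd ρ r1) 0 := by
      have h3 := (((hasDerivAt_id (0 : ℝ)).mul (((((hasDerivAt_id (0 : ℝ)).mul_const
        (coulombProd ρ r2)).const_add (coulombProd ρ r1))).const_mul 2)).const_add A0).add
        (((hasDerivAt_id (0 : ℝ)).pow 2).mul (hder (x := ∫ k, ‖lam r1 k‖ ^ 2 ∂νF)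
          (y := 2 * coulombProd r1 r2) (z := ∫ k, ‖lam r2 k‖ ^ 2 ∂νF)))
      exact h3.congr_deriv (by simp)
    have h4 := (h1.add (h2.const_mul (1 / 2))).sub ((hbd.pow 2).mul_const E₀)
    refine h4.congr_deriv ?_
    simp [hb]
  have hzero := hmin0.hasDerivAt_eq_zero hd1
  rw [hB1] at hzero
  have hT1' : T1 = 2 * ∑ i, ∫ x, (conj (weakDeriv i ψ x) * (c * pderiv i η x)).re := by
    rw [hT1]
    congr 1
    refine Finset.sum_congr rfl fun i _ => integral_congr_ae ?_
    filter_upwards [hχd i] with x hx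
    rw [hx]
  have j1 : Integrable fun x => η x * p1 x := hη.integrable_mul hp1m
  have j2 : Integrable fun x => η x * (p1 x * φ x) :=
    (hη.integrable_continuous_mul hp1m hc.continuous_potential).congr
      (Filter.Eventually.of_forall fun x => by simp only; ring)
  have hrhs : ∫ x, η x * ((-K₀ / Z + e * φ x) * (conj (ψ x) * c).re)
      = -K₀ / 2 * b1 + e / 2 * ∫ x, η x * (p1 x * φ x) := by
    have : -K₀ / 2 * b1 = -K₀ / (2 * Z) * ∫ x, η x * p1 x := by rw [hb1]; field_simp
    rw [this, ← integral_const_mul, ← integral_const_mul,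
      ← integral_add (j1.const_mul _) (j2.const_mul _)]
    refine integral_congr_ae (Filter.Eventually.of_forall fun x => ?_)
    simp only [hp1]
    field_simp
  rw [hrhs]
  rw [hT1'] at hzero
  linarith [hzero, hK₀, show b1 * K₀ = b1 * (a * dirichlet ψ + (coulombProd ρ (fun x => σ x - e * n x)
    + e * ∫ x, n x * φ x) - 2 * E₀) by rw [hK₀]]

/-! ### A smooth weight -/

/-- The weight `1 + x₂² + x₃²`. -/
def weight (x : Slab) : ℝ := 1 + (x.2.1 ^ 2 + x.2.2 ^ 2)

/-- The coordinates on the cell, with the periodic coordinate replaced by `0`. -/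
def coord (j : Fin 3) (x : Slab) : ℝ := ![0, x.2.1, x.2.2] j

theorem one_le_weight (x : Slab) : 1 ≤ weight x := by
  unfold weight; nlinarith [sq_nonneg x.2.1, sq_nonneg x.2.2]

theorem weight_ne_zero (x : Slab) : weight x ≠ 0 := by linarith [one_le_weight x]

theorem isSmooth_weight : IsSmooth weight :=
  IsSmooth.comp_snd (v := fun y => 1 + (y.1 ^ 2 + y.2 ^ 2)) (by fun_prop)

theorem isSmooth_weight_inv : IsSmooth fun x => (weight x)⁻¹ :=
  isSmooth_weight.inv weight_ne_zero

theorem hasDerivAt_coord (j : Fin 3) (x : Slab) :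
    HasDerivAt (fun s : ℝ => coord j (x + axis j s)) (![0, 1, 1] j) 0 := by
  fin_cases j
  · simpa [coord, axis] using hasDerivAt_const (0 : ℝ) (0 : ℝ)
  · simpa [coord, axis] using (hasDerivAt_id (0 : ℝ)).const_add x.2.1
  · simpa [coord, axis] using (hasDerivAt_id (0 : ℝ)).const_add x.2.2

theorem hasDerivAt_weight (j : Fin 3) (x : Slab) :
    HasDerivAt (fun s : ℝ => weight (x + axis j s)) (2 * coord j x) 0 := by
  have h := (hasDerivAt_coord j x).pow 2
  fin_cases j
  · simpa [coord, axis, weight] using hasDerivAt_const (0 : ℝ) (weight x)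
  · have h1 := (h.add_const (x.2.2 ^ 2)).const_add 1
    simpa [coord, axis, weight] using h1
  · have h1 := (h.const_add (x.2.1 ^ 2)).const_add 1
    simpa [coord, axis, weight] using h1

theorem hasDerivAt_weight_inv (j : Fin 3) (x : Slab) :
    HasDerivAt (fun s : ℝ => (weight (x + axis j s))⁻¹) (-2 * coord j x * (weight x)⁻¹ ^ 2) 0 := by
  have h := (hasDerivAt_weight j x).inv (weight_ne_zero _)
  rw [axis_zero, add_zero] at h
  refine h.congr_deriv ?_
  have := weight_ne_zero x
  field_simp

theorem pderiv_weight_inv (j : Fin 3) :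
    pderiv j (fun x => (weight x)⁻¹) = fun x => -2 * coord j x * (weight x)⁻¹ ^ 2 :=
  funext fun x => (hasDerivAt_weight_inv j x).deriv

theorem pderiv_pderiv_weight_inv (j : Fin 3) (x : Slab) :
    pderiv j (pderiv j fun x => (weight x)⁻¹) x
      = -2 * (![0, 1, 1] j) * (weight x)⁻¹ ^ 2 + 8 * coord j x ^ 2 * (weight x)⁻¹ ^ 3 := by
  rw [pderiv_weight_inv]
  have h := ((hasDerivAt_coord j x).const_mul (-2)).mul ((hasDerivAt_weight_inv j x).pow 2)
  refine (h.congr_deriv ?_).deriv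
  simp only [Pi.pow_apply, axis_zero, add_zero]
  push_cast; ring

theorem coord_sq_le_weight (j : Fin 3) (x : Slab) : coord j x ^ 2 ≤ weight x := by
  have h1 := sq_nonneg x.2.1
  have h2 := sq_nonneg x.2.2
  fin_cases j <;> simp [coord, weight] <;> linarith

theorem weight_inv_le_one (x : Slab) : (weight x)⁻¹ ≤ 1 := inv_le_one_of_one_le₀ (one_le_weight x)

theorem weight_inv_pos (x : Slab) : 0 < (weight x)⁻¹ := inv_pos.2 (by linarith [one_le_weight x])

theorem abs_pderiv_weight_inv_le (j : Fin 3) (x : Slab) :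
    |pderiv j (fun x => (weight x)⁻¹) x| ≤ 2 := by
  rw [pderiv_weight_inv]
  have h1 := coord_sq_le_weight j x
  have h2 := weight_inv_le_one x
  have h3 := weight_inv_pos x
  have h4 : weight x * (weight x)⁻¹ = 1 := mul_inv_cancel₀ (weight_ne_zero x)
  have h5 : (coord j x * (weight x)⁻¹ ^ 2) ^ 2 ≤ 1 := by
    calc (coord j x * (weight x)⁻¹ ^ 2) ^ 2 = coord j x ^ 2 * (weight x)⁻¹ * (weight x)⁻¹ ^ 3 := by
          ring
      _ ≤ weight x * (weight x)⁻¹ * 1 := by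
          gcongr
          exact pow_le_one₀ h3.le h2
      _ = 1 := by rw [h4, one_mul]
  have h6 := (sq_le_one_iff_abs_le_one _).1 h5
  simp only [mul_assoc, abs_mul (-2 : ℝ), abs_neg, Nat.abs_ofNat]
  linarith

theorem abs_pderiv_pderiv_weight_inv_le (j : Fin 3) (x : Slab) :
    |pderiv j (pderiv j fun x => (weight x)⁻¹) x| ≤ 10 := by
  rw [pderiv_pderiv_weight_inv]
  have h1 := coord_sq_le_weight j x
  have h2 := weight_inv_le_one x
  have h3 := weight_inv_pos x
  have h4 : weight x * (weight x)⁻¹ = 1 := mul_inv_cancel₀ (weight_ne_zero x)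
  have h5 : coord j x ^ 2 * (weight x)⁻¹ ^ 3 ≤ 1 := by
    calc coord j x ^ 2 * (weight x)⁻¹ ^ 3 = coord j x ^ 2 * (weight x)⁻¹ * (weight x)⁻¹ ^ 2 := by
          ring
      _ ≤ weight x * (weight x)⁻¹ * 1 := by
          gcongr
          exact pow_le_one₀ h3.le h2
      _ = 1 := by rw [h4, one_mul]
  have h6 : (weight x)⁻¹ ^ 2 ≤ 1 := pow_le_one₀ h3.le h2
  have h7 : 0 ≤ coord j x ^ 2 * (weight x)⁻¹ ^ 3 := by positivity
  have h8 : 0 ≤ (weight x)⁻¹ ^ 2 := by positivity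
  have h9 : (0 : ℝ) ≤ ![0, 1, 1] j ∧ (![0, 1, 1] j : ℝ) ≤ 1 := by fin_cases j <;> simp
  rw [abs_le]
  constructor <;> nlinarith [mul_le_mul h9.2 h6 h8 zero_le_one, mul_nonneg h9.1 h8]

theorem growth_mul_weight_inv_le (x : Slab) : growth x * (weight x)⁻¹ ≤ 2 := by
  have h1 : growth x ≤ 1 + |x.2.1| + |x.2.2| := by
    refine (Real.rpow_le_rpow_of_exponent_le ?_ (by norm_num : (1 / 2 : ℝ) ≤ 1)).trans
      (Real.rpow_one _).le
    linarith [abs_nonneg x.2.1, abs_nonneg x.2.2]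
  rw [← div_eq_mul_inv, div_le_iff₀ (by linarith [one_le_weight x])]
  refine h1.trans ?_
  unfold weight
  nlinarith [sq_abs x.2.1, sq_abs x.2.2, sq_nonneg (|x.2.1| - 1), sq_nonneg (|x.2.2| - 1)]

/-! ### Regularity -/

theorem memLp_smul_of_bound {h : Slab → ℝ} (hh : Continuous h) {C : ℝ} (hC : ∀ x, |h x| ≤ C)
    {f : Slab → ℂ} (hf : MemLp f 2) : MemLp (fun x => h x • f x) 2 := by
  refine (hf.const_mul (C : ℂ)).of_le (hh.aestronglyMeasurable.smul hf.1)
    (Filter.Eventually.of_forall fun x => ?_)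
  rw [norm_smul, norm_mul, Complex.norm_real, Real.norm_eq_abs]
  exact mul_le_mul_of_nonneg_right ((hC x).trans (le_abs_self C)) (norm_nonneg _)

theorem InL2loc.add {E : Type*} [NormedAddCommGroup E] {f g : Slab → E} (hf : InL2loc f)
    (hg : InL2loc g) : InL2loc fun x => f x + g x := fun K hK => (hf K hK).add (hg K hK)

theorem InL2loc.smul_continuous {h : Slab → ℝ} (hh : Continuous h) {f : Slab → ℂ}
    (hf : InL2loc f) : InL2loc fun x => h x • f x := by
  intro K hK
  obtain ⟨C, hC⟩ := hK.exists_bound_of_continuousOn hh.continuousOn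
  refine ((hf K hK).const_mul (C : ℂ)).of_le (hh.aestronglyMeasurable.smul (hf K hK).1) ?_
  filter_upwards [ae_restrict_mem hK.measurableSet] with x hx
  rw [norm_smul, norm_mul, Complex.norm_real]
  exact mul_le_mul_of_nonneg_right ((hC x hx).trans (le_abs_self C)) (norm_nonneg _)

/-- If the weak Laplacian of `f ∈ H¹`, with derivatives `F`, is `g ∈ L²`, then `f ∈ H²`. -/
theorem exists_second_derivatives {f : Slab → ℂ} {F : Fin 3 → Slab → ℂ} {g : Slab → ℂ}
    (hf : MemLp f 2) (hfF : ∀ j, HasWeakDeriv j f (F j)) (hF : ∀ j, MemLp (F j) 2) (hg : MemLp g 2)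
    (h : ∀ η : Slab → ℝ, IsTest η → ∑ j, ∫ x, pderiv j η x • F j x = -∫ x, η x • g x) :
    ∃ f2 : Fin 3 → Fin 3 → Slab → ℂ, (∀ i j, MemLp (f2 i j) 2) ∧
      ∀ i j, HasWeakDeriv i (F j) (f2 i j) := by
  have h1 := F2_weak_divergence hF hg h
  have h2 : ∀ j, F2 (F j) =ᵐ[νF] fun k => -(Complex.I * wave j k) * F2 f k := fun j =>
    (hfF j).F2_ae_eq hf (hF j)
  have h3 : ∀ i j, MemLp (fun k => -(Complex.I * wave i k) * F2 (F j) k) 2 νF := by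
    intro i j
    refine (memLp_F2 g).of_le ((continuous_const.mul (continuous_wave_ofReal i)).neg.measurable.mul
      (measurable_F2 _)).aestronglyMeasurable ?_
    filter_upwards [h1, ae_all_iff.2 h2] with k a b
    have e1 : F2 g k = -(waveSq k : ℂ) * F2 f k := by
      rw [a, waveSq_eq_sum]
      simp only [b]
      push_cast
      rw [← Finset.sum_neg_distrib, Finset.sum_mul]
      refine Finset.sum_congr rfl fun l _ => ?_
      linear_combination ((wave l k : ℂ) ^ 2 * F2 f k) * Complex.I_sq
    rw [e1, b]
    simp only [norm_mul, norm_neg, Complex.norm_I, one_mul, Complex.norm_real, Real.norm_eq_abs,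
      abs_of_nonneg (waveSq_nonneg k)]
    rw [← mul_assoc]
    refine mul_le_mul_of_nonneg_right ?_ (norm_nonneg _)
    -- Here 2|kᵢ kⱼ| ≤ kᵢ² + kⱼ² ≤ 2|k|²: the Laplacian controls every second derivative in L².
    nlinarith [sq_wave_le i k, sq_wave_le j k, sq_abs (wave i k), sq_abs (wave j k),
      sq_nonneg (|wave i k| - |wave j k|)]
  refine ⟨fun i j => F2inv fun k => -(Complex.I * wave i k) * F2 (F j) k,
    fun i j => memLp_F2inv _, fun i j => ?_⟩
  exact hasWeakDeriv_of_F2 i (hF j) (memLp_F2inv _) (F2_F2inv (h3 i j))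

theorem integral_pderiv_smul_smul {η h : Slab → ℝ} (hη : IsTest η) (hh : IsSmooth h) {f : Slab → ℂ}
    (hf : LocallyIntegrable f) (j : Fin 3) :
    ∫ x, pderiv j η x • h x • f x
      = (∫ x, pderiv j (fun x => η x * h x) x • f x) - ∫ x, η x • pderiv j h x • f x := by
  have i1 : Integrable fun x => pderiv j (fun x => η x * h x) x • f x :=
    ((hη.mul_smooth hh).test_pderiv j).integrable_smul hf
  have i2 : Integrable fun x => η x • pderiv j h x • f x := by
    have := (hη.mul_smooth (hh.smooth_pderiv j)).integrable_smul hf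
    simpa only [mul_smul] using this
  rw [← integral_sub i1 i2]
  refine integral_congr_ae (Filter.Eventually.of_forall fun x => ?_)
  simp only
  rw [hη.isSmooth.pderiv_mul hh, add_smul, mul_smul, mul_smul, add_sub_cancel_right]

/-- Interior regularity for the weak Schrödinger equation. -/
theorem inH2loc_of_weak_schrodinger {ψ : Slab → ℂ} (hψ : InH1 ψ) {V : Slab → ℝ} (hV : Continuous V)
    {C : ℝ} (hVC : ∀ x, |V x| ≤ C * growth x)
    (h : ∀ η : Slab → ℝ, IsTest η →
      ∑ i, ∫ x, pderiv i η x • weakDeriv i ψ x = -∫ x, η x • V x • ψ x) :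
    InH2loc ψ ∧ weakLaplacian ψ =ᵐ[volume] fun x => V x • ψ x := by
  -- The product V ψ need not be in L² as V may grow, but V times this weight is bounded. The
  -- derivatives of the weight that occur are bounded too, so the weighted equation lives in L².
  set w : Slab → ℝ := fun x => (weight x)⁻¹ with hw
  have hws : IsSmooth w := isSmooth_weight_inv
  have hψd := hasWeakDeriv_fun_weakDeriv hψ
  have hψl : LocallyIntegrable ψ := hψ.1.locallyIntegrable (by norm_num)
  have hdl : ∀ j, LocallyIntegrable (weakDeriv j ψ) := fun j => (hψd j).2.1
  set f : Slab → ℂ := fun x => w x • ψ x with hf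
  set F : Fin 3 → Slab → ℂ := fun j x => pderiv j w x • ψ x + w x • weakDeriv j ψ x with hFdef
  have hw1 : ∀ x, |w x| ≤ 1 := fun x => by
    rw [abs_of_pos (weight_inv_pos x)]; exact weight_inv_le_one x
  have hfm : MemLp f 2 := memLp_smul_of_bound hws.continuous hw1 hψ.1
  have hfF : ∀ j, HasWeakDeriv j f (F j) := fun j => (hψd j).smul_smooth hws
  have hF : ∀ j, MemLp (F j) 2 := fun j =>
    (memLp_smul_of_bound (hws.smooth_pderiv j).continuous (abs_pderiv_weight_inv_le j) hψ.1).add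
      (memLp_smul_of_bound hws.continuous hw1 (hψ.2 j).2)
  -- The commutator terms 2 ∂ⱼw ∂ⱼψ + ∂ⱼ²w ψ in the Laplacian of wψ.
  set G0 : Fin 3 → Slab → ℂ := fun j x =>
    (2 : ℝ) • pderiv j w x • weakDeriv j ψ x + pderiv j (pderiv j w) x • ψ x with hG0
  have hG0m : ∀ j, MemLp (G0 j) 2 := fun j =>
    ((memLp_smul_of_bound (hws.smooth_pderiv j).continuous (abs_pderiv_weight_inv_le j)
      (hψ.2 j).2).const_smul (2 : ℝ)).add
      (memLp_smul_of_bound ((hws.smooth_pderiv j).smooth_pderiv j).continuous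
        (abs_pderiv_pderiv_weight_inv_le j) hψ.1)
  have hwV : MemLp (fun x => (w x * V x) • ψ x) 2 := by
    refine memLp_smul_of_bound (h := fun x => w x * V x) (hws.continuous.mul hV)
      (C := |C| * 2) (fun x => ?_) hψ.1
    rw [abs_mul, abs_of_pos (weight_inv_pos x), mul_comm]
    have hp := weight_inv_pos x
    calc |V x| * (weight x)⁻¹ ≤ (|C| * growth x) * (weight x)⁻¹ := by
          refine mul_le_mul_of_nonneg_right ((hVC x).trans ?_) hp.le
          exact mul_le_mul_of_nonneg_right (le_abs_self C) (zero_le_one.trans (one_le_growth x))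
      _ = |C| * (growth x * (weight x)⁻¹) := by ring
      _ ≤ |C| * 2 := mul_le_mul_of_nonneg_left (growth_mul_weight_inv_le x) (abs_nonneg C)
  set G : Slab → ℂ := fun x => (∑ j, G0 j x) + (w x * V x) • ψ x with hG
  have hGm : MemLp G 2 := (memLp_finsetSum _ fun j _ => hG0m j).add hwV
  have hdiv : ∀ η : Slab → ℝ, IsTest η →
      ∑ j, ∫ x, pderiv j η x • F j x = -∫ x, η x • G x := by
    intro η hη
    have hηw : IsTest fun x => η x * w x := hη.mul_smooth hws
    have hj : ∀ j, ∫ x, pderiv j η x • F j x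
        = (∫ x, pderiv j (fun x => η x * w x) x • weakDeriv j ψ x) - ∫ x, η x • G0 j x := by
      intro j
      have hws1 := hws.smooth_pderiv j
      have a1 := integral_pderiv_smul_smul hη hws1 hψl j
      have a2 := integral_pderiv_smul_smul hη hws (hdl j) j
      have a3 := (hψd j).2.2 _ (hη.mul_smooth hws1)
      have k1 : Integrable fun x => pderiv j η x • pderiv j w x • ψ x := by
        simpa only [mul_smul] using ((hη.test_pderiv j).mul_smooth hws1).integrable_smul hψl
      have k2 : Integrable fun x => pderiv j η x • w x • weakDeriv j ψ x := by
        simpa only [mul_smul] using ((hη.test_pderiv j).mul_smooth hws).integrable_smul (hdl j)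
      have k3 : Integrable fun x => η x • pderiv j w x • weakDeriv j ψ x := by
        simpa only [mul_smul] using (hη.mul_smooth hws1).integrable_smul (hdl j)
      have k4 : Integrable fun x => η x • pderiv j (pderiv j w) x • ψ x := by
        simpa only [mul_smul] using
          (hη.mul_smooth (hws1.smooth_pderiv j)).integrable_smul hψl
      have e1 : ∫ x, pderiv j η x • F j x = (∫ x, pderiv j η x • pderiv j w x • ψ x)
          + ∫ x, pderiv j η x • w x • weakDeriv j ψ x := by
        rw [← integral_add k1 k2]
        simp only [hFdef, smul_add]
      have e2 : ∫ x, η x • G0 j x = (2 : ℝ) • (∫ x, η x • pderiv j w x • weakDeriv j ψ x)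
          + ∫ x, η x • pderiv j (pderiv j w) x • ψ x := by
        have k8 : Integrable fun x => (2 : ℝ) • η x • pderiv j w x • weakDeriv j ψ x := k3.smul (2 : ℝ)
        rw [← integral_smul, ← integral_add k8 k4]
        refine integral_congr_ae (Filter.Eventually.of_forall fun x => ?_)
        simp only [hG0, smul_add]
        rw [smul_comm (η x) (2 : ℝ)]
      simp only [mul_smul] at a3
      rw [e1, e2, a1, a2, a3, two_smul]
      abel
    have k5 : ∀ j, Integrable fun x => η x • G0 j x := fun j =>
      hη.integrable_smul ((hG0m j).locallyIntegrable (by norm_num))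
    have k6 : Integrable fun x => η x • (w x * V x) • ψ x :=
      hη.integrable_smul (hwV.locallyIntegrable (by norm_num))
    have e3 : ∫ x, η x • G x = (∑ j, ∫ x, η x • G0 j x) + ∫ x, (η x * w x) • V x • ψ x := by
      rw [← integral_finsetSum _ fun j _ => k5 j]
      have k7 : ∀ x, (η x * w x) • V x • ψ x = η x • (w x * V x) • ψ x := fun x => by
        rw [smul_smul, smul_smul, mul_assoc]
      simp only [k7]
      rw [← integral_add (integrable_finsetSum _ fun j _ => k5 j) k6]
      simp only [hG, smul_add, Finset.smul_sum]
    have e4 := h _ hηw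
    simp only [hj]
    rw [Finset.sum_sub_distrib, e4, e3]
    ring
  obtain ⟨f2, hf2m, hf2⟩ := exists_second_derivatives hfm hfF hF hGm hdiv
  have hq := isSmooth_weight
  -- Multiplying back by the smooth weight costs global integrability and keeps local regularity.
  have hψf : (fun x => weight x • f x) = ψ := by
    ext x
    simp only [hf, hw]
    rw [smul_smul, mul_inv_cancel₀ (weight_ne_zero x), one_smul]
  set ψ1 : Fin 3 → Slab → ℂ := fun j x => pderiv j weight x • f x + weight x • F j x with hψ1
  set ψ2 : Fin 3 → Fin 3 → Slab → ℂ := fun i j x =>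
    (pderiv i (pderiv j weight) x • f x + pderiv j weight x • F i x)
      + (pderiv i weight x • F j x + weight x • f2 i j x) with hψ2
  have d1 : ∀ j, HasWeakDeriv j ψ (ψ1 j) := fun j => by
    have := (hfF j).smul_smooth hq
    rwa [hψf] at this
  have d2 : ∀ i j, HasWeakDeriv i (ψ1 j) (ψ2 i j) := fun i j =>
    ((hfF i).smul_smooth (hq.smooth_pderiv j)).add ((hf2 i j).smul_smooth hq)
  have l1 : ∀ j, InL2loc (ψ1 j) := fun j =>
    ((inL2loc_of_memLp hfm).smul_continuous (hq.smooth_pderiv j).continuous).add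
      ((inL2loc_of_memLp (hF j)).smul_continuous hq.continuous)
  have l2 : ∀ i j, InL2loc (ψ2 i j) := fun i j =>
    (((inL2loc_of_memLp hfm).smul_continuous
      ((hq.smooth_pderiv j).smooth_pderiv i).continuous).add
      ((inL2loc_of_memLp (hF i)).smul_continuous (hq.smooth_pderiv j).continuous)).add
    (((inL2loc_of_memLp (hF j)).smul_continuous (hq.smooth_pderiv i).continuous).add
      ((inL2loc_of_memLp (hf2m i j)).smul_continuous hq.continuous))
  obtain ⟨hH2, hlap⟩ := inH2loc_of_hasWeakDeriv (inL2loc_of_memLp hψ.1) d1 l1 d2 l2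
  refine ⟨hH2, hlap.trans ?_⟩
  have hVψ : LocallyIntegrable fun x => V x • ψ x := by
    rw [locallyIntegrable_iff]
    intro K hK
    have : IsFiniteMeasure (volume.restrict K) := ⟨by simpa using hK.measure_lt_top⟩
    exact ((InL2loc.smul_continuous hV (inL2loc_of_memLp hψ.1)) K hK).integrable (by norm_num)
  have hsum : LocallyIntegrable fun x => ∑ i, ψ2 i i x := by
    simp only [Fin.sum_univ_three]
    exact ((d2 0 0).2.1.add (d2 1 1).2.1).add (d2 2 2).2.1
  -- The second derivatives from the product rule need not visibly sum to Vψ; the weak equation and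
  -- the du Bois-Reymond lemma identify the sum.
  have hz : (fun x => (∑ i, ψ2 i i x) - V x • ψ x) =ᵐ[volume] 0 := by
    refine ae_eq_zero_of_integral_test_smul (hsum.sub hVψ) fun η hη => ?_
    simp only [smul_sub]
    rw [integral_sub (hη.integrable_smul hsum) (hη.integrable_smul hVψ)]
    simp only [Finset.smul_sum]
    rw [integral_finsetSum _ fun i _ => hη.integrable_smul (d2 i i).2.1]
    have e5 : ∀ i, ∫ x, η x • ψ2 i i x = -∫ x, pderiv i η x • weakDeriv i ψ x := fun i => by
      have := (d2 i i).2.2 η hη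
      rw [← neg_eq_iff_eq_neg.2 this, neg_inj]
      refine integral_congr_ae ?_
      filter_upwards [(d1 i).weakDeriv_ae_eq] with x hx
      rw [hx]
    simp only [e5]
    rw [Finset.sum_neg_distrib, h η hη, neg_neg, sub_self]
  filter_upwards [hz] with x hx
  exact sub_eq_zero.1 hx

/-! ### The Euler–Lagrange equations -/

theorem re_integral_test_smul {η : Slab → ℝ} (hη : IsTest η) {f : Slab → ℂ}
    (hf : LocallyIntegrable f) (c : ℂ) :
    (conj (∫ x, η x • f x) * c).re = ∫ x, η x * (conj (f x) * c).re := by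
  have hi := hη.integrable_smul hf
  have h1 := (Complex.reCLM.comp ((ContinuousLinearMap.mul ℝ ℂ c).comp
    (Complex.conjCLE.toContinuousLinearMap))).integral_comp_comm hi
  simp only [ContinuousLinearMap.comp_apply, Complex.reCLM_apply, ContinuousLinearMap.mul_apply',
    ContinuousLinearEquiv.coe_coe, Complex.conjCLE_apply] at h1
  rw [mul_comm, ← h1]
  refine integral_congr_ae (Filter.Eventually.of_forall fun x => ?_)
  simp only [Complex.real_smul, map_mul, Complex.conj_ofReal]
  rw [mul_left_comm, Complex.re_ofReal_mul, mul_comm c]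

/-- The energy variation sees only real parts. Real test functions multiplied by complex constants,
here 1 and i, recover the complex equation. -/
theorem eq_of_re_conj_mul {z w : ℂ} (h : ∀ c : ℂ, (conj z * c).re = (conj w * c).re) : z = w := by
  have h1 := h 1
  have h2 := h Complex.I
  simp at h1 h2
  exact Complex.ext h1 h2

/-- The Schrödinger equation for a minimizer, in weak form. -/
theorem weak_schrodinger {a K : ℝ} (ha : 0 < a) {ψ : Slab → ℂ} (hψ : InH1 ψ) {φ : Slab → ℝ}
    (hφ : Continuous φ)
    (h : ∀ η : Slab → ℝ, IsTest η → ∀ c : ℂ,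
      a * ∑ i, ∫ x, (conj (weakDeriv i ψ x) * (c * pderiv i η x)).re
        = ∫ x, η x * ((K + e * φ x) * (conj (ψ x) * c).re)) :
    ∀ η : Slab → ℝ, IsTest η → ∑ i, ∫ x, pderiv i η x • weakDeriv i ψ x
      = -∫ x, η x • (-(K + e * φ x) / a) • ψ x := by
  intro η hη
  have hVc : Continuous fun x => -(K + e * φ x) / a := by fun_prop
  have hVl : LocallyIntegrable fun x => (-(K + e * φ x) / a) • ψ x := by
    rw [locallyIntegrable_iff]
    intro Q hQ
    have : IsFiniteMeasure (volume.restrict Q) := ⟨by simpa using hQ.measure_lt_top⟩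
    exact ((InL2loc.smul_continuous hVc (inL2loc_of_memLp hψ.1)) Q hQ).integrable (by norm_num)
  refine eq_of_re_conj_mul fun c => ?_
  have hdl : ∀ i, LocallyIntegrable (weakDeriv i ψ) := fun i =>
    (hasWeakDeriv_fun_weakDeriv hψ i).2.1
  have e1 : (conj (∑ i, ∫ x, pderiv i η x • weakDeriv i ψ x) * c).re
      = ∑ i, ∫ x, (conj (weakDeriv i ψ x) * (c * pderiv i η x)).re := by
    rw [map_sum, Finset.sum_mul, Complex.re_sum]
    refine Finset.sum_congr rfl fun i _ => ?_
    rw [re_integral_test_smul (hη.test_pderiv i) (hdl i)]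
    refine integral_congr_ae (Filter.Eventually.of_forall fun x => ?_)
    simp only
    rw [← Complex.re_ofReal_mul]
    congr 1; ring
  rw [e1, map_neg, neg_mul, Complex.neg_re, re_integral_test_smul hη hVl]
  have h1 := h η hη c
  have e2 : ∫ x, η x * (conj ((-(K + e * φ x) / a) • ψ x) * c).re
      = -(1 / a) * ∫ x, η x * ((K + e * φ x) * (conj (ψ x) * c).re) := by
    rw [← integral_const_mul]
    refine integral_congr_ae (Filter.Eventually.of_forall fun x => ?_)
    simp only [Complex.real_smul, map_mul, Complex.conj_ofReal]
    rw [mul_assoc, Complex.re_ofReal_mul]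
    ring
  rw [e2, ← h1, neg_mul, neg_neg, one_div, inv_mul_cancel_left₀ ha.ne']

/-! ### The equation for the ion -/

/-- Taylor's bound for |θ| ≤ 1; for larger θ the triangle inequality gives 2|θ|, below 2θ². A bound
valid for all θ is needed since the frequencies are unbounded. -/
theorem norm_exp_sub_one_sub_le (θ : ℝ) :
    ‖Complex.exp (Complex.I * θ) - 1 - Complex.I * θ‖ ≤ 2 * θ ^ 2 := by
  by_cases h : |θ| ≤ 1
  · have h1 : ‖Complex.I * (θ : ℂ)‖ ≤ 1 := by simpa using h
    refine (Complex.norm_exp_sub_one_sub_id_le h1).trans ?_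
    simp only [norm_mul, Complex.norm_I, one_mul, Complex.norm_real, Real.norm_eq_abs, sq_abs]
    nlinarith [sq_nonneg θ]
  · have h1 : ‖Complex.exp (Complex.I * θ) - 1‖ ≤ |θ| := Real.norm_exp_I_mul_ofReal_sub_one_le
    have h2 : ‖Complex.I * (θ : ℂ)‖ = |θ| := by simp
    refine (norm_sub_le _ _).trans ?_
    rw [h2]
    nlinarith [sq_abs θ, not_le.1 h]

theorem dirichlet_translate {ψ : Slab → ℂ} (h : InH1 ψ) (a : Slab) :
    InH1 (fun x => ψ (x + a)) ∧ dirichlet (fun x => ψ (x + a)) = dirichlet ψ := by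
  have hmp : MeasurePreserving (fun x : Slab => x + a) := measurePreserving_add_right volume a
  have hd : ∀ i, HasWeakDeriv i (fun x => ψ (x + a)) fun x => weakDeriv i ψ (x + a) := fun i =>
    (hasWeakDeriv_fun_weakDeriv h i).translate a
  refine ⟨⟨h.1.comp_measurePreserving hmp, fun i => ⟨⟨_, hd i⟩, (memLp_congr_ae
    (hd i).weakDeriv_ae_eq).2 ((h.2 i).2.comp_measurePreserving hmp)⟩⟩, ?_⟩
  refine Finset.sum_congr rfl fun i _ => ?_
  rw [← integral_add_right_eq_self (fun x => ‖weakDeriv i ψ x‖ ^ 2) a]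
  refine integral_congr_ae ?_
  filter_upwards [(hd i).weakDeriv_ae_eq] with x hx
  rw [hx]

theorem FTr_translate_axis (n : Slab → ℝ) (j : Fin 3) (s : ℝ) (k : Freq) :
    FTr (fun x => n (x + axis j s)) k
      = Complex.exp (Complex.I * ((-(wave j k * s) : ℝ) : ℂ)) * FTr n k := by
  have h := FT_translate (fun x => (n x : ℂ)) (axis j s) k
  rw [FTr, h, character_axis, ← Complex.exp_conj]
  congr 2
  simp

/-- The derivative of the Coulomb energy under translations of a cloud `n`. -/
theorem integral_translation_eq_zero {ρ n : Slab → ℝ} (hρ : IsCharge ρ) (hn : Integrable n)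
    (hn2 : MemLp n 2) (j : Fin 3) (he : 0 < e)
    (hmin : ∀ s : ℝ, IsCharge (fun x => ρ x + e * (n x - n (x + axis j s))) →
      ∫ k, ‖lam ρ k‖ ^ 2 ∂νF ≤ ∫ k, ‖lam (fun x => ρ x + e * (n x - n (x + axis j s))) k‖ ^ 2 ∂νF) :
    ∫ k, (conj (FTr n k) * fieldMult ρ j k).re ∂νF = 0 := by
  have hnF : MemLp (FTr n) 2 νF := memLp_FT hn.ofReal hn2.ofReal
  set A : Freq → ℂ := lam ρ with hA
  set B : Freq → ℂ := lam n with hB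
  set D : Freq → ℝ := fun k => (conj (FTr n k) * fieldMult ρ j k).re with hD
  -- An integrable coefficient of s² dominating the remainder: each wave factor from the Taylor
  -- expansion is absorbed by the |k|⁻¹ of a `lam`.
  set H : Freq → ℝ := fun k => 4 * e * (‖FTr ρ k‖ * ‖FTr n k‖) + e ^ 2 * ‖FTr n k‖ ^ 2 with hH
  have hHi : Integrable H νF := by
    refine ((MemLp.integrable_mul hρ.memLp_FTr.norm hnF.norm).const_mul (4 * e)).add
      ((hnF.integrable_norm_pow two_ne_zero).const_mul (e ^ 2))
  have hDi : Integrable D νF :=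
    Complex.reCLM.integrable_comp (MemLp.integrable_mul hnF.star (hρ.memLp_fieldMult j))
  have hwB : ∀ k, |wave j k| * ‖B k‖ ≤ ‖FTr n k‖ := fun k => by
    have h2 : |wave j k| ≤ Real.sqrt (waveSq k) := Real.abs_le_sqrt (sq_wave_le j k)
    have h3 : ‖B k‖ = ‖FTr n k‖ / Real.sqrt (waveSq k) := by
      rw [hB, lam, norm_div, Complex.norm_real, Real.norm_of_nonneg (Real.sqrt_nonneg _)]
    rw [h3, mul_div_left_comm]
    exact mul_le_of_le_one_right (norm_nonneg _) (div_le_one_of_le₀ h2 (Real.sqrt_nonneg _))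
  have hwA : ∀ k, |wave j k| * ‖A k‖ ≤ ‖FTr ρ k‖ := fun k => by
    have h2 : |wave j k| ≤ Real.sqrt (waveSq k) := Real.abs_le_sqrt (sq_wave_le j k)
    have h3 : ‖A k‖ = ‖FTr ρ k‖ / Real.sqrt (waveSq k) := by
      rw [hA, lam, norm_div, Complex.norm_real, Real.norm_of_nonneg (Real.sqrt_nonneg _)]
    rw [h3, mul_div_left_comm]
    exact mul_le_of_le_one_right (norm_nonneg _) (div_le_one_of_le₀ h2 (Real.sqrt_nonneg _))
  have hDk : ∀ k, D k = (conj (A k) * (Complex.I * wave j k * B k)).re := fun k => by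
    have e1 : conj (FTr n k) * fieldMult ρ j k = conj (conj (A k) * (Complex.I * wave j k * B k)) := by
      have hs : (waveSq k : ℂ) = (Real.sqrt (waveSq k) : ℂ) * (Real.sqrt (waveSq k) : ℂ) := by
        rw [← Complex.ofReal_mul, Real.mul_self_sqrt (waveSq_nonneg k)]
      simp only [hA, hB, lam, fieldMult, potMult, map_mul, map_div₀, Complex.conj_conj,
        Complex.conj_I, Complex.conj_ofReal, hs]
      ring
    rw [hD]; simp only; rw [e1, Complex.conj_re]
  -- Minimality against all translations, with the Coulomb energy expanded to second order in s.
  have key : ∀ s : ℝ, 0 ≤ 2 * e * s * (∫ k, D k ∂νF) + s ^ 2 * ∫ k, H k ∂νF := by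
    intro s
    set z : Freq → ℂ := fun k => 1 - Complex.exp (Complex.I * ((-(wave j k * s) : ℝ) : ℂ)) with hz
    set r : Slab → ℝ := fun x => n x - n (x + axis j s) with hr
    have hmp : MeasurePreserving (fun x : Slab => x + axis j s) :=
      measurePreserving_add_right volume _
    have hns : Integrable fun x => n (x + axis j s) := hmp.integrable_comp_of_integrable hn
    have hr1 : Integrable r := hn.sub hns
    have hr2 : MemLp r 2 := hn2.sub (hn2.comp_measurePreserving hmp)
    have hFr : ∀ k, FTr r k = z k * FTr n k := fun k => by
      have h1 := IsCharge.FTr_add hn (hns.const_mul (-1)) k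
      rw [IsCharge.FTr_const_mul, FTr_translate_axis] at h1
      have h2 : (fun x => n x + -1 * n (x + axis j s)) = r := by ext x; simp only [hr]; ring
      rw [h2] at h1
      rw [h1, hz]; push_cast; ring
    have hlr : ∀ k, lam r k = z k * B k := fun k => by
      rw [lam, hFr, hB, lam, mul_div_assoc]
    have hz1 : ∀ k, ‖z k‖ ≤ |s| * |wave j k| := fun k => by
      rw [hz, norm_sub_rev]
      refine Real.norm_exp_I_mul_ofReal_sub_one_le.trans (le_of_eq ?_)
      rw [Real.norm_eq_abs, abs_neg, abs_mul, mul_comm]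
    have hz2 : ∀ k, ‖z k - Complex.I * (wave j k * s : ℝ)‖ ≤ 2 * (wave j k * s) ^ 2 := fun k => by
      have h1 := norm_exp_sub_one_sub_le (-(wave j k * s))
      rw [neg_sq, ← norm_neg] at h1
      refine le_trans (le_of_eq ?_) h1
      congr 1; rw [hz]; push_cast; ring
    have hrc : IsCharge r := by
      refine IsCharge.of_memLp_lam hr1 hr2 ((hnF.norm.const_mul |s|).of_le
        (measurable_lam hr1).aestronglyMeasurable (Filter.Eventually.of_forall fun k => ?_))
      rw [hlr, norm_mul, norm_mul, Real.norm_eq_abs, abs_abs, norm_norm]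
      calc ‖z k‖ * ‖B k‖ ≤ |s| * |wave j k| * ‖B k‖ :=
            mul_le_mul_of_nonneg_right (hz1 k) (norm_nonneg _)
        _ = |s| * (|wave j k| * ‖B k‖) := by ring
        _ ≤ _ := mul_le_mul_of_nonneg_left (hwB k) (abs_nonneg _)
    have hch : IsCharge fun x => ρ x + e * r x := hρ.add (hrc.const_mul e)
    have h1 := hmin s hch
    have hle : ∫ k, ‖lam (fun x => ρ x + e * r x) k‖ ^ 2 ∂νF
        ≤ ∫ k, (‖A k‖ ^ 2 + (2 * e * s * D k + s ^ 2 * H k)) ∂νF := by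
      refine integral_mono (hch.memLp_lam.integrable_norm_pow two_ne_zero)
        ((hρ.memLp_lam.integrable_norm_pow two_ne_zero).add
          ((hDi.const_mul _).add (hHi.const_mul _))) fun k => ?_
      simp only
      rw [IsCharge.lam_add hρ.integrable (hrc.const_mul e).integrable, IsCharge.lam_const_mul, hlr]
      have q1 : ‖A k + e * (z k * B k)‖ ^ 2 = ‖A k‖ ^ 2 + 2 * e * s * D k
          + 2 * e * (conj (A k) * ((z k - Complex.I * (wave j k * s : ℝ)) * B k)).re
          + e ^ 2 * (‖z k‖ * ‖B k‖) ^ 2 := by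
        rw [hDk, mul_pow]
        simp only [← Complex.normSq_eq_norm_sq]
        simp only [Complex.normSq_apply, Complex.mul_re, Complex.conj_re, Complex.conj_im,
          Complex.add_re, Complex.add_im, Complex.mul_im, Complex.ofReal_re, Complex.ofReal_im,
          Complex.sub_re, Complex.sub_im, Complex.I_re, Complex.I_im]
        ring
      have q2 : (conj (A k) * ((z k - Complex.I * (wave j k * s : ℝ)) * B k)).re
          ≤ s ^ 2 * (2 * (‖FTr ρ k‖ * ‖FTr n k‖)) := by
        refine (Complex.re_le_norm _).trans ?_
        rw [norm_mul, norm_mul, RCLike.norm_conj]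
        calc ‖A k‖ * (‖z k - Complex.I * (wave j k * s : ℝ)‖ * ‖B k‖)
            ≤ ‖A k‖ * (2 * (wave j k * s) ^ 2 * ‖B k‖) := by
              have := hz2 k
              gcongr
          _ = s ^ 2 * (2 * ((|wave j k| * ‖A k‖) * (|wave j k| * ‖B k‖))) := by
              rw [mul_pow, ← sq_abs (wave j k)]; ring
          _ ≤ _ := by
              have := hwA k
              have := hwB k
              gcongr
      have q3 : (‖z k‖ * ‖B k‖) ^ 2 ≤ s ^ 2 * ‖FTr n k‖ ^ 2 := by
        rw [← sq_abs s, ← mul_pow]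
        refine pow_le_pow_left₀ (by positivity) ?_ 2
        calc ‖z k‖ * ‖B k‖ ≤ |s| * |wave j k| * ‖B k‖ :=
              mul_le_mul_of_nonneg_right (hz1 k) (norm_nonneg _)
          _ = |s| * (|wave j k| * ‖B k‖) := by ring
          _ ≤ _ := mul_le_mul_of_nonneg_left (hwB k) (abs_nonneg _)
      rw [q1]
      simp only [hH]
      nlinarith [mul_le_mul_of_nonneg_left q2 he.le, mul_le_mul_of_nonneg_left q3 (sq_nonneg e)]
    have hDH : Integrable (fun k => 2 * e * s * D k + s ^ 2 * H k) νF :=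
      (hDi.const_mul _).add (hHi.const_mul _)
    rw [integral_add (hρ.memLp_lam.integrable_norm_pow two_ne_zero) hDH,
      integral_add (hDi.const_mul _) (hHi.const_mul _), integral_const_mul, integral_const_mul] at hle
    have h2 := h1.trans hle
    linarith
  set d := ∫ k, D k ∂νF with hd
  set h := ∫ k, H k ∂νF with hh
  have hh0 : 0 ≤ h := integral_nonneg fun k => by positivity
  -- Near the minimizer of the quadratic in s; `h + 1` in place of `h` avoids division by zero, and
  -- the value is still negative unless e · d = 0.
  have k1 := key (-(e * d) / (h + 1))
  have h1 : 0 < h + 1 := by linarith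
  have e1 : 2 * e * (-(e * d) / (h + 1)) * d + (-(e * d) / (h + 1)) ^ 2 * h
      = -((e * d) ^ 2 * (h + 2)) / (h + 1) ^ 2 := by
    field_simp; ring
  rw [e1] at k1
  have h2 : (e * d) ^ 2 * (h + 2) ≤ 0 := by
    by_contra hc
    have := div_neg_of_neg_of_pos (neg_neg_of_pos (not_le.1 hc)) (pow_pos h1 2)
    linarith
  have h3 : (e * d) ^ 2 ≤ 0 := by nlinarith [sq_nonneg (e * d)]
  have h4 : e * d = 0 := by nlinarith [sq_nonneg (e * d), pow_eq_zero_iff (M₀ := ℝ) (a := e * d) two_ne_zero]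
  exact (mul_eq_zero.1 h4).resolve_left he.ne'

theorem integral_mul_field {ρ q : Slab → ℝ} (hρ : IsCharge ρ) (hq : Integrable q)
    (hq2 : MemLp q 2) (j : Fin 3) :
    ∫ x, field ρ j x * q x = ∫ k, (conj (FTr q k) * fieldMult ρ j k).re ∂νF := by
  have hqc : MemLp (fun x => (q x : ℂ)) 2 := hq2.ofReal
  have hqF : MemLp (FTr q) 2 νF := memLp_FT hq.ofReal hqc
  have h1 := integral_conj_mul_F2 hqc (memLp_F2inv (fieldMult ρ j))
  have i1 : Integrable fun x => conj (q x : ℂ) * F2inv (fieldMult ρ j) x :=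
    MemLp.integrable_mul hqc.star (memLp_F2inv _)
  have i2 : Integrable (fun k => conj (FTr q k) * fieldMult ρ j k) νF :=
    MemLp.integrable_mul hqF.star (hρ.memLp_fieldMult j)
  have e1 : ∫ k, conj (F2 (fun x => (q x : ℂ)) k) * F2 (F2inv (fieldMult ρ j)) k ∂νF
      = ∫ k, conj (FTr q k) * fieldMult ρ j k ∂νF := by
    refine integral_congr_ae ?_
    filter_upwards [F2_ae_eq (f := fun x => (q x : ℂ)) hq.ofReal hqc, F2_F2inv (hρ.memLp_fieldMult j)]
      with k a b
    rw [a, b]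
  rw [e1] at h1
  have h2 := congrArg Complex.reCLM h1
  rw [← ContinuousLinearMap.integral_comp_comm _ i1, ← ContinuousLinearMap.integral_comp_comm _ i2]
    at h2
  simp only [Complex.reCLM_apply] at h2
  rw [h2]
  refine integral_congr_ae (Filter.Eventually.of_forall fun x => ?_)
  simp only [field, Complex.conj_ofReal]
  rw [Complex.re_ofReal_mul, mul_comm]

/-- A charge exerts no net force on itself: in Fourier variables the integrand is |ρ̂|² times a
purely imaginary number. -/
theorem integral_self_mul_field {ρ : Slab → ℝ} (hρ : IsCharge ρ) (j : Fin 3) :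
    ∫ x, field ρ j x * ρ x = 0 := by
  rw [integral_mul_field hρ hρ.integrable hρ.memLp]
  refine (integral_congr_ae (Filter.Eventually.of_forall fun k => ?_)).trans (integral_zero _ _)
  have e1 : conj (FTr ρ k) * fieldMult ρ j k
      = ((-(wave j k) * ‖FTr ρ k‖ ^ 2 / waveSq k : ℝ) : ℂ) * Complex.I := by
    have h1 : conj (FTr ρ k) * FTr ρ k = ((‖FTr ρ k‖ ^ 2 : ℝ) : ℂ) := by
      rw [mul_comm, Complex.mul_conj, Complex.normSq_eq_norm_sq]
    have h2 : conj (FTr ρ k) * fieldMult ρ j k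
        = -(wave j k) * (conj (FTr ρ k) * FTr ρ k) / waveSq k * Complex.I := by
      rw [fieldMult, potMult]; ring
    rw [h2, h1]; push_cast; ring
  rw [e1, Complex.re_ofReal_mul, Complex.I_re, mul_zero]

theorem energyReal_le_of_minimizer {ħ m : ℝ} (hm : 0 < m) {ψ : Slab → ℂ}
    (hψ : ψ ∈ neutralStates e σ) (hc : IsCharge (chargeDensity e σ ψ))
    (hinf : energy ħ m e σ ψ = ⨅ χ ∈ neutralStates e σ, energy ħ m e σ χ) :
    ∀ χ ∈ neutralStates e σ, IsCharge (chargeDensity e σ χ) →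
      energyReal ħ m e σ ψ ≤ energyReal ħ m e σ χ := by
  intro χ hχ hχc
  have h1 : energy ħ m e σ ψ ≤ energy ħ m e σ χ := hinf ▸ iInf₂_le χ hχ
  rwa [energy_eq hm hψ.1 hc, energy_eq hm hχ.1 hχc,
    ENNReal.ofReal_le_ofReal_iff (energyReal_nonneg hm χ)] at h1

/-- Moving the electron cloud with the ion fixed changes only the Coulomb energy, so the force on
|ψ|² vanishes at a minimizer. Since σ = ρ + e|ψ|² and ρ has no self-force, the force on σ vanishes
as well. -/
theorem integral_field_mul_ion {ħ m : ℝ} (he : 0 < e) (hI : ConditionI σ) {ψ : Slab → ℂ}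
    (hψ : ψ ∈ neutralStates e σ) (hc : IsCharge (chargeDensity e σ ψ))
    (hmin : ∀ χ ∈ neutralStates e σ, IsCharge (chargeDensity e σ χ) →
      energyReal ħ m e σ ψ ≤ energyReal ħ m e σ χ) (j : Fin 3) :
    ∫ x, field (chargeDensity e σ ψ) j x * σ x = 0 := by
  set ρ := chargeDensity e σ ψ with hρ
  set n : Slab → ℝ := fun x => ‖ψ x‖ ^ 2 with hn
  have hn1 : Integrable n := hψ.1.integrable_norm_sq
  have hn2 : MemLp n 2 := hψ.1.memLp_norm_sq
  have hz : ∫ k, (conj (FTr n k) * fieldMult ρ j k).re ∂νF = 0 := by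
    refine integral_translation_eq_zero hc hn1 hn2 j he fun s hs => ?_
    obtain ⟨hH, hdir⟩ := dirichlet_translate hψ.1 (axis j s)
    have hden : (fun x => ρ x + e * (n x - n (x + axis j s)))
        = chargeDensity e σ fun x => ψ (x + axis j s) := by
      ext x; simp only [hρ, hn, chargeDensity]; ring
    rw [hden] at hs ⊢
    have h1 := hmin _ ⟨hH, mass_eq_of_isCharge hI he.ne' hH hs⟩ hs
    rw [energyReal, energyReal, hdir] at h1
    linarith
  have hsq : ∀ {q : Slab → ℝ}, MemLp q 2 → Integrable fun x => field ρ j x * q x := fun hq =>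
    MemLp.integrable_mul (memLp_field ρ j) hq
  have hσ : ∀ x, field ρ j x * σ x = field ρ j x * ρ x + e * (field ρ j x * n x) := fun x => by
    simp only [hρ, hn, chargeDensity]; ring
  simp only [hσ]
  rw [integral_add (hsq hc.memLp) ((hsq hn2).const_mul e), integral_self_mul_field hc,
    integral_const_mul, integral_mul_field hc hn1 hn2, hz, mul_zero, add_zero]

end CrystalSlab

end

/-! ### The main theorem, assembled from the preceding parts. -/

theorem mainTheorem7 (ħ m e : ℝ) (hħ : 0 < ħ) (hm : 0 < m) (he : 0 < e)
    (σ : CrystalSlab.Slab → ℝ)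
    (hI : CrystalSlab.ConditionI σ) (hIII : CrystalSlab.ConditionIII e σ)
    (hZ : 0 < CrystalSlab.chargeNumber e σ) :
    ∃ ψ ∈ CrystalSlab.neutralStates e σ,
      -- the minimum of the energy is attained at `ψ`, and it is finite
      (CrystalSlab.energy ħ m e σ ψ
          = ⨅ χ ∈ CrystalSlab.neutralStates e σ, CrystalSlab.energy ħ m e σ χ) ∧
      CrystalSlab.energy ħ m e σ ψ ≠ ⊤ ∧
      CrystalSlab.InH2loc ψ ∧
      ∃ (φ : CrystalSlab.Slab → ℝ) (freq : ℝ),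
        CrystalSlab.InH2loc φ ∧
        -- the Schrödinger equation
        (∀ᵐ x : CrystalSlab.Slab,
          ((ħ * freq : ℝ) : ℂ) * ψ x
            = -((ħ ^ 2 / (2 * m) : ℝ) : ℂ) * CrystalSlab.weakLaplacian ψ x
              - ((e * φ x : ℝ) : ℂ) * ψ x) ∧
        -- the Poisson equation
        (∀ᵐ x : CrystalSlab.Slab,
          -CrystalSlab.weakLaplacian φ x = CrystalSlab.chargeDensity e σ ψ x) ∧
        -- the equation for the ion at the origin
        (∀ i : Fin 3,
          MeasureTheory.Integrable (fun x => CrystalSlab.weakDeriv i φ x * σ x) ∧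
            0 = -∫ x, CrystalSlab.weakDeriv i φ x * σ x) ∧
        -- the bound for the potential
        ∃ C : ℝ, ∀ x : CrystalSlab.Slab,
          |φ x| ≤ C * (1 + |x.2.1| + |x.2.2|) ^ (1 / 2 : ℝ) := by
  open CrystalSlab in
  obtain ⟨ψ, hψ, hc, hinf⟩ := exists_minimizer hħ hm he hI hIII hZ
  have hmin := energyReal_le_of_minimizer hm hψ hc hinf
  -- The square of this test function is the compactly supported reference density of mass Z₁ used
  -- in the variation.
  obtain ⟨η, hη, hηZ⟩ := exists_test_norm_sq hZ
  obtain ⟨K, hK⟩ := first_variation hI hη.sq (isCharge_sub_test hI hIII hη.sq hηZ) hηZ hZ he.ne'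
    hψ hc hmin
  set ρ := chargeDensity e σ ψ with hρ
  have ha : 0 < ħ ^ 2 / (2 * m) := by positivity
  obtain ⟨C, hC⟩ := hc.exists_abs_potential_le
  have hV : Continuous fun x => -(K + e * potential ρ x) / (ħ ^ 2 / (2 * m)) :=
    (continuous_const.add (continuous_const.mul hc.continuous_potential)).neg.div_const _
  have hVb : ∀ x, |-(K + e * potential ρ x) / (ħ ^ 2 / (2 * m))|
      ≤ (|K| + e * C) / (ħ ^ 2 / (2 * m)) * growth x := by
    intro x
    rw [abs_div, abs_neg, abs_of_pos ha, div_mul_eq_mul_div]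
    refine div_le_div_of_nonneg_right ?_ ha.le
    refine (abs_add_le _ _).trans ?_
    rw [abs_mul, abs_of_pos he]
    have h1 := mul_le_mul_of_nonneg_left (hC x) he.le
    have h2 := mul_le_mul_of_nonneg_left (one_le_growth x) (abs_nonneg K)
    linarith
  obtain ⟨hH2, hlap⟩ := inH2loc_of_weak_schrodinger hψ.1 hV hVb
    (weak_schrodinger ha hψ.1 hc.continuous_potential hK)
  obtain ⟨hφ, hpoisson⟩ := hc.inH2loc_potential
  -- The multiplier `K` satisfies Kψ = -(ħ²/2m)Δψ - eφψ, so the frequency is `K / ħ`.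
  refine ⟨ψ, hψ, hinf, ?_, hH2, potential ρ, K / ħ, hφ, ?_, hpoisson, fun i => ?_, C, hC⟩
  · rw [energy_eq hm hψ.1 hc]
    exact ENNReal.ofReal_ne_top
  · filter_upwards [hlap] with x hx
    rw [hx, Complex.real_smul, mul_div_cancel₀ _ hħ.ne', ← mul_assoc, ← sub_mul]
    congr 1
    rw [← Complex.ofReal_neg, ← Complex.ofReal_mul, ← Complex.ofReal_sub, Complex.ofReal_inj]
    field_simp
    ring
  · have hd : weakDeriv i (potential ρ) =ᵐ[volume] field ρ i :=
      (hc.hasWeakDeriv_potential i).weakDeriv_ae_eq_real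
    have hds : (fun x => weakDeriv i (potential ρ) x * σ x) =ᵐ[volume] fun x => field ρ i x * σ x := by
      filter_upwards [hd] with x hx
      rw [hx]
    refine ⟨(MemLp.integrable_mul (memLp_field ρ i) hI.2).congr hds.symm, ?_⟩
    rw [integral_congr_ae hds, integral_field_mul_ion he hI hψ hc hmin, neg_zero]
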